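/- Let $D\ge 2$, let $\eta=\mathrm{diag}(-1,1,\dots,1)$ be the Minkowski metric on $\mathbb R^D$, $\sigma(y)=\eta_{\mu\nu}y^\mu y^\nu$, $m^2\in\mathbb R$, and let $H_F(x_1,x_2)=H_F(x_1-x_2)$ be a Poincaré-invariant Feynman parametrix of the Klein–Gordon operator. That is, $H_F=\lim_{\varepsilon\to0^+}H_\varepsilon$ with $$H_\varepsilon(y)=\frac{U(\sigma)}{(\sigma+i\varepsilon)^{D/2-1}}+V(\sigma)\log\frac{\sigma+i\varepsilon}{\ell^{2}}+W(\sigma),$$ where $\ell>0$, where $U,V,W$ are smooth ($V=0$ if $D$ is odd), and where $(-\partial^2+m^2)H_F=-i\delta+h$ with $h$ smooth. Let $\chi(y,z)$ be a smooth translation-invariant cutoff function which, for each $z$, equals $1$ for $y$ near $z$ and has compact support in $y$. For multi-indices $\gamma_1,\gamma_2$ with $|\gamma_1|=p$, $|\gamma_2|=q$, $r=p+q$, and for $\Lambda$ in the restricted Lorentz group $SO^+(1,D-1)$, put $$Q_{\gamma_1\gamma_2}(\Lambda)=(-1)^{1+r}\,i\int d^Dy\,\big[\chi(\Lambda^{-1}y,0)-\chi(y,0)\big]\,\partial_{\gamma_1}H_F(y)\,\partial_{\gamma_2}H_F(y),$$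 $$(B^{\kappa\rho})_{\gamma_1\gamma_2}=(-1)^{1+r}\,i\,(l^{\kappa\rho})^{\sigma}{}_{\tau}\int d^Dy\,y^{\tau}\partial_\sigma\chi(y,0)\,\partial_{\gamma_1}H_F(y)\,\partial_{\gamma_2}H_F(y),\qquad (l^{\kappa\rho})^\mu{}_\nu=\eta^{\mu\kappa}\delta^\rho_\nu-\eta^{\mu\rho}\delta^\kappa_\nu .$$ The products of distributions, which are paired here with test functions supported away from $y=0$, are the limits as $\varepsilon\to0^+$ of the products formed with $H_\varepsilon$. Let $D(\Lambda)$ be the representation on covariant tensors of rank $r$, $(D(\Lambda)T)_{\mu_1\cdots\mu_r}=(\Lambda^{-1})^{\alpha_1}{}_{\mu_1}\cdots(\Lambda^{-1})^{\alpha_r}{}_{\mu_r}T_{\alpha_1\cdots\alpha_r}$. Let $\mathbb L^{\kappa\rho}$ be the sum over the $r$ slots of $l^{\kappa\rho}$ acting in that slot by $(l^{\kappa\rho}T)_\mu=(l^{\kappa\rho})^{\alpha}{}_{\mu}T_\alpha$. Then the following holds for all $p,q\ge 0$. 1. The limits defining $Q(\Lambda)$ and $B^{\kappa\rho}$ exist.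 For each $\varepsilon>0$ and each $z$, the integral that defines $Q_{\gamma_1\gamma_2}(\Lambda^{-1})$ with $H_\varepsilon$ in place of $H_F$ equals the Taylor coefficient $\partial^{(x_1)}_{\gamma_1}\partial^{(x_2)}_{\gamma_2}\big[\Omega_\varepsilon(\Lambda x_1,\Lambda x_2;\Lambda z)-\Omega_\varepsilon(x_1,x_2;z)\big]_{x_1=x_2=z}$ of the cut-off integral $\Omega_\varepsilon(x_1,x_2;z)=-i\int d^Dy\,\chi(y,z)H_\varepsilon(y-x_1)H_\varepsilon(y-x_2)$. 2. $Q$ is a 1-cocycle: $Q(\Lambda_1\Lambda_2)=Q(\Lambda_1)+D(\Lambda_1)Q(\Lambda_2)$. 3. There is a $\Lambda$-independent tensor $a$ of rank $r$ with $Q(\Lambda)=(D(\Lambda)-I)a$ for all $\Lambda\in SO^+(1,D-1)$. If $a$ is one solution, then $a'$ is a solution if and only if $a'-a$ is Lorentz-invariant. 4. For every $r\ge 0$ there is a complete family of orthogonal idempotents $E_\lambda$, indexed by the partitions $\lambda$ of $r$ and spanning the centre of $\mathbb C[S_r]$, with real $c_\lambda$ such that the sum of all transpositions is $\sum_\lambda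 c_\lambda E_\lambda$. For every such family put $\tilde c_\lambda=2r(D-1)+4c_\lambda$. Then every solution $a$ satisfies $$a=\sum_{\lambda:\ \tilde c_\lambda\neq0}\frac1{\tilde c_\lambda}E_\lambda\Big(-\mathbb L_{\kappa\rho}B^{\kappa\rho}+4\sum_{i<j\le r}\eta_{\mu_i\mu_j}\,\mathrm{tr}_{ij}a\Big)$$ modulo Lorentz-invariant tensors. Conversely, define tensors by induction on the rank by this formula, where $\mathrm{tr}_{ij}a$ is replaced by the tensor of rank $r-2$ obtained in the same way from $\mathrm{tr}_{ij}B^{\kappa\rho}$. The tensor $a$ so obtained from $B^{\kappa\rho}$ is a solution of $Q(\Lambda)=(D(\Lambda)-I)a$. -/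

import Mathlib

open Filter Topology MeasureTheory
open scoped ContDiff

noncomputable section

/-! ### Minkowski spacetime of dimension `D = d + 1` (signature `-+⋯+`, index `0` is time) -/

/-- Points of Minkowski spacetime in global inertial coordinates. -/
abbrev Spacetime (d : ℕ) : Type := Fin (d + 1) → ℝ

/-- The Minkowski metric `diag(-1, 1, …, 1)`; numerically it equals its inverse. -/
def minkowski (d : ℕ) : Matrix (Fin (d + 1)) (Fin (d + 1)) ℝ :=
  Matrix.diagonal fun μ => if μ = 0 then -1 else 1

/-- The signed squared geodesic distance of `y` from the origin. -/
def sqDist {d : ℕ} (y : Spacetime d) : ℝ :=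
  ∑ μ, ∑ ν, minkowski d μ ν * y μ * y ν

/-- The restricted (proper orthochronous) Lorentz group `SO⁺(1, D - 1)`. -/
def restrictedLorentz (d : ℕ) : Set (Matrix (Fin (d + 1)) (Fin (d + 1)) ℝ) :=
  {Λ | Λ.transpose * minkowski d * Λ = minkowski d ∧ Λ.det = 1 ∧ 0 < Λ 0 0}

/-- The coordinate derivative `∂_{μ₁} ⋯ ∂_{μₚ} f` at `y`. -/
def partials {d p : ℕ} (μ : Fin p → Fin (d + 1)) (f : Spacetime d → ℂ) (y : Spacetime d) : ℂ :=
  iteratedFDeriv ℝ p f y fun k => Pi.single (μ k) 1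

/-- The Klein-Gordon operator `-η^{μν} ∂_μ ∂_ν + m²`. -/
def kleinGordon {d : ℕ} (m2 : ℝ) (f : Spacetime d → ℂ) (y : Spacetime d) : ℂ :=
  -(∑ μ, ∑ ν, (minkowski d μ ν : ℂ) * partials ![μ, ν] f y) + (m2 : ℂ) * f y

/-! ### Feynman parametrices -/

/-- The function
`U(σ) / (σ + iε)^{D/2 - 1} + V(σ) log (ℓ⁻² (σ + iε)) + W(σ)`, `σ = η_{μν} y^μ y^ν`. -/
def hadamardForm (d : ℕ) (l : ℝ) (U V W : ℝ → ℂ) (ε : ℝ) (y : Spacetime d) : ℂ :=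
  U (sqDist y) / ((sqDist y : ℂ) + Complex.I * (ε : ℂ)) ^ (((d : ℂ) + 1) / 2 - 1)
    + V (sqDist y) * Complex.log (((sqDist y : ℂ) + Complex.I * (ε : ℂ)) / (l : ℂ) ^ 2)
    + W (sqDist y)

/-- A Poincaré-invariant Feynman parametrix `H_F(x₁, x₂) = H_F(x₁ - x₂)` of the Klein-Gordon
operator on `D = d + 1` dimensional Minkowski spacetime. It is the distribution of Hadamard form
obtained by the Feynman prescription, that is, the limit as `ε → 0⁺` of the smooth functions
`hadamardForm d l U V W ε`, and it satisfies `(-∂² + m²) H_F = -i δ + h` with `h` smooth. -/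
structure FeynmanParametrix (d : ℕ) (m2 : ℝ) where
  l : ℝ
  l_pos : 0 < l
  U : ℝ → ℂ
  V : ℝ → ℂ
  W : ℝ → ℂ
  smooth_U : ContDiff ℝ ∞ U
  smooth_V : ContDiff ℝ ∞ V
  smooth_W : ContDiff ℝ ∞ W
  V_eq_zero : Odd (d + 1) → V = 0
  green : ∃ h : Spacetime d → ℂ, ContDiff ℝ ∞ h ∧
    ∀ f : Spacetime d → ℂ, ContDiff ℝ ∞ f → HasCompactSupport f →
      Tendsto (fun ε : ℝ => ∫ y, hadamardForm d l U V W ε y * kleinGordon m2 f y) (𝓝[>] 0)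
        (𝓝 (-Complex.I * f 0 + ∫ y, h y * f y))

/-- The smooth functions `H_ε` whose limit as `ε → 0⁺` is the Feynman parametrix. -/
def FeynmanParametrix.reg {d : ℕ} {m2 : ℝ} (H : FeynmanParametrix d m2) (ε : ℝ)
    (y : Spacetime d) : ℂ :=
  hadamardForm d H.l H.U H.V H.W ε y

/-! ### Cutoff functions -/

/-- A cutoff function `χ(y, z)`: smooth, equal to `1` for `y` near `z`, and of compact support
in `y`. -/
structure Cutoff (d : ℕ) where
  χ : Spacetime d → Spacetime d → ℝ
  smooth : ContDiff ℝ ∞ fun p : Spacetime d × Spacetime d => χ p.1 p.2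
  eq_one : ∀ z, ∀ᶠ y in 𝓝 z, χ y z = 1
  compact : ∀ z, HasCompactSupport fun y => χ y z

def Cutoff.TranslationInvariant {d : ℕ} (c : Cutoff d) : Prop :=
  ∀ y z v, c.χ (y + v) (z + v) = c.χ y z

/-! ### Tensors -/

/-- Covariant tensors of rank `r`, by components. A pair of multi-indices `γ₁`, `γ₂` with
`|γ₁| = p`, `|γ₂| = q` is an index of a tensor of rank `p + q`. -/
abbrev CTensor (d r : ℕ) : Type := (Fin r → Fin (d + 1)) → ℂ

def firstIdx {d p q : ℕ} (μ : Fin (p + q) → Fin (d + 1)) : Fin p → Fin (d + 1) :=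
  fun k => μ (Fin.castAdd q k)

def secondIdx {d p q : ℕ} (μ : Fin (p + q) → Fin (d + 1)) : Fin q → Fin (d + 1) :=
  fun k => μ (Fin.natAdd p k)

/-- The representation `D(Λ)` on covariant tensors:
`(D(Λ) T)_{μ₁ ⋯ μᵣ} = (Λ⁻¹)^{α₁}_{μ₁} ⋯ (Λ⁻¹)^{αᵣ}_{μᵣ} T_{α₁ ⋯ αᵣ}`. -/
def lorentzAct {d r : ℕ} (Λ : Matrix (Fin (d + 1)) (Fin (d + 1)) ℝ) (T : CTensor d r) :
    CTensor d r :=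
  fun μ => ∑ α : Fin r → Fin (d + 1), (∏ k, ((Λ⁻¹ (α k) (μ k) : ℝ) : ℂ)) * T α

def IsLorentzInvariant {d r : ℕ} (T : CTensor d r) : Prop :=
  ∀ Λ ∈ restrictedLorentz d, lorentzAct Λ T = T

/-! ### The cut-off integral and the tensors `Q` and `B` -/

/-- The cut-off integral `Ω(x₁, x₂; z) = -i ∫ χ(y, z) H(y, x₁) H(y, x₂) dy` at regulator `ε`. -/
def omegaReg {d : ℕ} {m2 : ℝ} (c : Cutoff d) (H : FeynmanParametrix d m2) (ε : ℝ)
    (x₁ x₂ z : Spacetime d) : ℂ :=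
  -Complex.I * ∫ y, (c.χ y z : ℂ) * H.reg ε (y - x₁) * H.reg ε (y - x₂)

/-- `i (-1)^{1 + p + q} ∫ f(y) ∂_{γ₁} H(y) ∂_{γ₂} H(y) dy` at regulator `ε`. -/
def pairReg {d : ℕ} {m2 : ℝ} (H : FeynmanParametrix d m2) (p q : ℕ) (f : Spacetime d → ℝ)
    (ε : ℝ) : CTensor d (p + q) :=
  fun μ => Complex.I * (-1) ^ (1 + p + q) *
    ∫ y, (f y : ℂ) * partials (firstIdx μ) (H.reg ε) y * partials (secondIdx μ) (H.reg ε) y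

/-- The pairing `i (-1)^{1 + p + q} ∫ f(y) ∂_{γ₁} H_F(y) ∂_{γ₂} H_F(y) dy` of a test function `f`
supported away from the origin with the product of distributions `∂_{γ₁} H_F ∂_{γ₂} H_F`. -/
def pairing {d : ℕ} {m2 : ℝ} (H : FeynmanParametrix d m2) (p q : ℕ) (f : Spacetime d → ℝ) :
    CTensor d (p + q) :=
  fun μ => limUnder (𝓝[>] (0 : ℝ)) fun ε => pairReg H p q f ε μ

/-- The function `χ(Λ⁻¹ y, 0) - χ(y, 0)`. -/
def cutoffDiff {d : ℕ} (c : Cutoff d) (Λ : Matrix (Fin (d + 1)) (Fin (d + 1)) ℝ)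
    (y : Spacetime d) : ℝ :=
  c.χ (Λ⁻¹.mulVec y) 0 - c.χ y 0

/-- The tensor `Q_{γ₁ γ₂}(Λ)`. -/
def tensorQ {d : ℕ} {m2 : ℝ} (c : Cutoff d) (H : FeynmanParametrix d m2) (p q : ℕ)
    (Λ : Matrix (Fin (d + 1)) (Fin (d + 1)) ℝ) : CTensor d (p + q) :=
  pairing H p q (cutoffDiff c Λ)

/-- The generator `(l^{κρ})^μ_ν = η^{μκ} δ^ρ_ν - η^{μρ} δ^κ_ν`. -/
def lorentzGen {d : ℕ} (κ ρ : Fin (d + 1)) : Matrix (Fin (d + 1)) (Fin (d + 1)) ℝ :=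
  fun μ ν => minkowski d μ κ * (if ρ = ν then 1 else 0)
    - minkowski d μ ρ * (if κ = ν then 1 else 0)

/-- The generator with lowered labels, `l_{κρ} = η_{κκ'} η_{ρρ'} l^{κ'ρ'}`. -/
def lorentzGenLow {d : ℕ} (κ ρ : Fin (d + 1)) : Matrix (Fin (d + 1)) (Fin (d + 1)) ℝ :=
  ∑ κ', ∑ ρ', (minkowski d κ κ' * minkowski d ρ ρ') • lorentzGen κ' ρ'

/-- The function `(l^{κρ})^σ_τ y^τ ∂_σ χ(y, 0)`. -/
def cutoffGen {d : ℕ} (c : Cutoff d) (κ ρ : Fin (d + 1)) (y : Spacetime d) : ℝ :=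
  ∑ σ, ∑ τ, lorentzGen κ ρ σ τ * y τ * fderiv ℝ (fun y' => c.χ y' 0) y (Pi.single σ 1)

/-- The tensors `(B^{κρ})_{γ₁ γ₂}`. -/
def tensorB {d : ℕ} {m2 : ℝ} (c : Cutoff d) (H : FeynmanParametrix d m2) (p q : ℕ)
    (κ ρ : Fin (d + 1)) : CTensor d (p + q) :=
  pairing H p q (cutoffGen c κ ρ)

/-! ### Ingredients of the inductive formula -/

/-- `l ⊗ I ⊗ ⋯ ⊗ I + ⋯ + I ⊗ ⋯ ⊗ I ⊗ l` on covariant tensors. -/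
def genAct {d r : ℕ} (l : Matrix (Fin (d + 1)) (Fin (d + 1)) ℝ) (T : CTensor d r) :
    CTensor d r :=
  fun μ => ∑ k, ∑ α, (l α (μ k) : ℂ) * T (Function.update μ k α)

/-- The contraction `𝕃_{κρ} B^{κρ}`. -/
def genContract {d r : ℕ} (B : Fin (d + 1) → Fin (d + 1) → CTensor d r) : CTensor d r :=
  ∑ κ, ∑ ρ, genAct (lorentzGenLow κ ρ) (B κ ρ)

/-- The trace over the slots `i.castSucc` and `j`, for `i.castSucc < j`. -/
def traceAt {d r : ℕ} (j : Fin (r + 2)) (i : Fin (r + 1)) (T : CTensor d (r + 2)) :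
    CTensor d r :=
  fun μ => ∑ α, ∑ β, (minkowski d α β : ℂ) *
    T (j.insertNth (α := fun _ => Fin (d + 1)) β
      (i.insertNth (α := fun _ => Fin (d + 1)) α μ))

/-- The tensor product with `η` placed in the slots `i.castSucc` and `j`,
for `i.castSucc < j`. -/
def metricMulAt {d r : ℕ} (j : Fin (r + 2)) (i : Fin (r + 1)) (S : CTensor d r) :
    CTensor d (r + 2) :=
  fun μ => (minkowski d (μ i.castSucc) (μ j) : ℂ) * S fun k => μ (j.succAbove (i.succAbove k))

/-- The sum of `η_{μᵢ μⱼ} S_{ij}` over the pairs of slots `i < j`. -/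
def metricSum {d r : ℕ} (S : Fin (r + 2) → Fin (r + 1) → CTensor d r) : CTensor d (r + 2) :=
  ∑ j : Fin (r + 2), ∑ i : Fin (r + 1),
    if i.castSucc < j then metricMulAt j i (S j i) else 0

/-- `∑_{i < j} η_{μᵢ μⱼ} tr_{ij} T`. -/
def metricTraceSum {d : ℕ} : (r : ℕ) → CTensor d r → CTensor d r
  | 0, _ => 0
  | 1, _ => 0
  | _ + 2, T => metricSum fun j i => traceAt j i T

/-- The complex group algebra of the symmetric group `S_r`. -/
abbrev SymGroupAlg (r : ℕ) : Type := MonoidAlgebra ℂ (Equiv.Perm (Fin r))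

/-- The action of the group algebra on tensors by permutation of the slots. -/
def permAct {d r : ℕ} (x : SymGroupAlg r) (T : CTensor d r) : CTensor d r :=
  fun μ => ∑ π : Equiv.Perm (Fin r), x.coeff π * T (μ ∘ π)

/-- A complete family of orthogonal idempotents `E_λ` spanning the centre of the group algebra of
`S_r`, one for each partition of `r`, and the real coefficients `c_λ` of the sum of all
transpositions in this family. -/
structure SymIdempotents (r : ℕ) where
  E : r.Partition → SymGroupAlg r
  c : r.Partition → ℝ
  complete : CompleteOrthogonalIdempotents E
  span_eq : Submodule.span ℂ (Set.range E) =
    Subalgebra.toSubmodule (Subalgebra.center ℂ (SymGroupAlg r))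
  sum_swap : ∑ i : Fin r, ∑ j : Fin r,
    (if i < j then MonoidAlgebra.single (Equiv.swap i j) (1 : ℂ) else 0) = ∑ lam, (c lam : ℂ) • E lam

/-- `c̃_λ = 2 r (D - 1) + 4 c_λ`. -/
def SymIdempotents.cTilde {r : ℕ} (S : SymIdempotents r) (d : ℕ) (lam : r.Partition) : ℝ :=
  2 * r * d + 4 * S.c lam

/-- `∑_{λ : c̃_λ ≠ 0} (1 / c̃_λ) E_λ X`. -/
def SymIdempotents.solve {d r : ℕ} (S : SymIdempotents r) (X : CTensor d r) : CTensor d r :=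
  ∑ lam : r.Partition, if S.cTilde d lam ≠ 0 then
    ((1 / S.cTilde d lam : ℝ) : ℂ) • permAct (S.E lam) X else 0

/-- The tensor defined from `B^{κρ}` by induction on the rank:
`a = ∑_{λ : c̃_λ ≠ 0} (1 / c̃_λ) E_λ (-𝕃_{κρ} B^{κρ} + 4 ∑_{i < j} η_{μᵢ μⱼ} a_{ij})`,
where `a_{ij}` is the tensor so defined from the traces `tr_{ij} B^{κρ}`. -/
def inductiveSol {d : ℕ} (S : ∀ r, SymIdempotents r) :
    (r : ℕ) → (Fin (d + 1) → Fin (d + 1) → CTensor d r) → CTensor d r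
  | 0, B => (S 0).solve (-genContract B)
  | 1, B => (S 1).solve (-genContract B)
  | r + 2, B => (S (r + 2)).solve (-genContract B +
      (4 : ℂ) • metricSum fun j i => inductiveSol S r fun κ ρ => traceAt j i (B κ ρ))

end

/-! ### Tensor algebra -/

section TensorAlgebra

variable {d r : ℕ}

/-! For `ε > 0` the function `H_ε` is smooth, so the cutoff `χ(·, 0)` itself, and not only its
variation, can be paired with `∂H_ε ∂H_ε`. Call the resulting tensor `a_ε`. Since `H_ε` depends on
`σ` alone and proper Lorentz maps have determinant one, the substitution `y ↦ Λ⁻¹y` gives `Q_ε(Λ) =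
D(Λ)a_ε - a_ε` exactly, and integration by parts gives `B_ε^{κρ} = 𝕃^{κρ}a_ε` (`pairReg_cutoffDiff`,
`pairReg_cutoffGen`). Convergence of `a_ε` as `ε → 0⁺` is not needed: once `Q_ε` and `B_ε` converge,
the limit lies in the range of `a ↦ (D(Λ)a - a, 𝕃^{κρ}a)`, which is finite-dimensional and hence
closed. So one tensor `b` produces both `Q` and `B` (`exists_coboundary_of_tendsto`), without any
vanishing theorem for cohomology. The cocycle identity and uniqueness modulo invariants are then
formal.

The limits exist because the test functions vanish near the origin, the only critical point of `σ`.
A vector field `X` with `Xσ = 1` turns `F'(σ + iε)` into `X(F(σ + iε))`, so the `ε`-derivative of a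
pairing with `F(σ + iε)` is again a pairing with the same `F`. Integrating in `ε` repeatedly removes
any polynomial blow-up (`exists_tendsto_coneIntegral`). Sums of terms `g(y)F(σ + iε)` are closed
under products and derivatives, so they include `∂H_ε ∂H_ε`.

The formula comes from the quadratic Casimir operator: `-𝕃_{κρ}𝕃^{κρ}` plus four times the
metric-trace sum equals `2r(D-1)` plus four times the sum of transpositions
(`neg_genContract_add_metricTraceSum`). The latter is central in the group algebra and acts on the
range of `E_λ` as `c̃_λ`, so it is inverted wherever `c̃_λ ≠ 0`. Components with `c̃_λ = 0` are even
invariant under unimodular matrices, by the equality case of a norm estimate with the Casimir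
operator of `gl(D)` (`slotAct_eq_of_casimir_eq_zero`). Traces commute with the generators, which
makes the recursion on the rank work.

The idempotents exist because the centre of the group algebra is reduced, hence a product of copies
of `ℂ`, with as many factors as `S_r` has cycle types. -/

lemma minkowski_apply (μ ν : Fin (d + 1)) :
    minkowski d μ ν = if μ = ν then (if μ = 0 then -1 else 1) else 0 := by
  simp [minkowski, Matrix.diagonal_apply]

lemma minkowski_comm (μ ν : Fin (d + 1)) : minkowski d μ ν = minkowski d ν μ := by
  rw [minkowski_apply, minkowski_apply]
  by_cases h : μ = ν
  · simp [h]
  · simp [h, Ne.symm h]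

lemma minkowski_mul_self : minkowski d * minkowski d = 1 := by
  rw [minkowski, Matrix.diagonal_mul_diagonal, ← Matrix.diagonal_one]
  congr 1
  ext μ
  split_ifs <;> simp

lemma sum_minkowski_mul (α β : Fin (d + 1)) :
    ∑ γ, minkowski d α γ * minkowski d γ β = if α = β then 1 else 0 := by
  rw [← Matrix.mul_apply, minkowski_mul_self, Matrix.one_apply]

/-- The action of a matrix on all slots of a covariant tensor. -/
noncomputable def slotAct (M : Matrix (Fin (d + 1)) (Fin (d + 1)) ℝ) :
    CTensor d r →ₗ[ℂ] CTensor d r where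
  toFun T := fun μ => ∑ α : Fin r → Fin (d + 1), (∏ k, ((M (α k) (μ k) : ℝ) : ℂ)) * T α
  map_add' S T := by
    ext μ
    simp [mul_add, Finset.sum_add_distrib]
  map_smul' a T := by
    ext μ
    simp only [Pi.smul_apply, smul_eq_mul, RingHom.id_apply, Finset.mul_sum]
    exact Finset.sum_congr rfl fun _ _ => by ring

lemma slotAct_apply (M : Matrix (Fin (d + 1)) (Fin (d + 1)) ℝ) (T : CTensor d r)
    (μ : Fin r → Fin (d + 1)) :
    slotAct M T μ = ∑ α : Fin r → Fin (d + 1), (∏ k, ((M (α k) (μ k) : ℝ) : ℂ)) * T α := rfl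

lemma lorentzAct_eq_slotAct (Λ : Matrix (Fin (d + 1)) (Fin (d + 1)) ℝ) (T : CTensor d r) :
    lorentzAct Λ T = slotAct Λ⁻¹ T := rfl

lemma slotAct_one (T : CTensor d r) : slotAct 1 T = T := by
  ext μ
  rw [slotAct_apply, Finset.sum_eq_single μ]
  · simp
  · intro α _ hα
    obtain ⟨k, hk⟩ := Function.ne_iff.1 hα
    rw [Finset.prod_eq_zero (Finset.mem_univ k) (by simp [hk]), zero_mul]
  · simp

lemma slotAct_mul (M N : Matrix (Fin (d + 1)) (Fin (d + 1)) ℝ) (T : CTensor d r) :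
    slotAct (M * N) T = slotAct N (slotAct M T) := by
  ext μ
  simp only [slotAct_apply, Matrix.mul_apply, Complex.ofReal_sum, Complex.ofReal_mul,
    Finset.mul_sum]
  rw [Finset.sum_comm]
  refine Finset.sum_congr rfl fun β _ => ?_
  rw [Finset.prod_univ_sum, Fintype.piFinset_univ, Finset.sum_mul]
  refine Finset.sum_congr rfl fun α _ => ?_
  rw [Finset.prod_mul_distrib]
  ring

/-- The sum over the slots of the action of a matrix, as a linear map. -/
noncomputable def genActHom (l : Matrix (Fin (d + 1)) (Fin (d + 1)) ℝ) :
    CTensor d r →ₗ[ℂ] CTensor d r where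
  toFun := genAct l
  map_add' S T := by
    ext μ
    simp [genAct, mul_add, Finset.sum_add_distrib]
  map_smul' a T := by
    ext μ
    simp only [genAct, Pi.smul_apply, smul_eq_mul, RingHom.id_apply, Finset.mul_sum]
    exact Finset.sum_congr rfl fun _ _ => Finset.sum_congr rfl fun _ _ => by ring

/-! ### Traces and metric insertions under actions on the slots -/

lemma sum_insertNth {X M : Type*} [Fintype X] [AddCommMonoid M] {n : ℕ} (p : Fin (n + 1))
    (f : (Fin (n + 1) → X) → M) :
    ∑ α, f α = ∑ x, ∑ β : Fin n → X, f (p.insertNth (α := fun _ => X) x β) := by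
  rw [← (Fin.insertNthEquiv (fun _ => X) p).sum_comp, Fintype.sum_prod_type]
  rfl

/-- The trace uses the metric with upper indices, so the relevant invariance is `M η Mᵀ = η`;
inserting a metric uses `Mᵀ η M = η` instead. -/
lemma traceAt_slotAct {M : Matrix (Fin (d + 1)) (Fin (d + 1)) ℝ}
    (hM : M * minkowski d * M.transpose = minkowski d) (j : Fin (r + 2)) (i : Fin (r + 1))
    (T : CTensor d (r + 2)) :
    traceAt j i (slotAct M T) = slotAct M (traceAt j i T) := by
  have hM' : ∀ a b, (∑ α, ∑ β, (M a α : ℂ) * (minkowski d α β : ℂ) * (M b β : ℂ))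
      = (minkowski d a b : ℂ) := by
    intro a b
    conv_rhs => rw [← hM]
    simp only [Matrix.mul_apply, Matrix.transpose_apply, Complex.ofReal_sum, Complex.ofReal_mul,
      Finset.sum_mul]
    exact Finset.sum_comm
  ext μ
  -- The metric on one side is hidden behind the opaque name `m`, so that rewriting `η` as `M η Mᵀ`
  -- acts there only and does not loop.
  obtain ⟨m, hm⟩ : ∃ m : Fin (d + 1) → Fin (d + 1) → ℂ, ∀ a b, (minkowski d a b : ℂ) = m a b :=
    ⟨_, fun _ _ => rfl⟩
  have hmM : ∀ a b, m a b = _ := fun a b => (hm a b).symm.trans (hM' a b).symm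
  simp only [traceAt, slotAct_apply]
  conv_rhs => simp only [hm]
  simp only [sum_insertNth j, sum_insertNth i, Fin.prod_univ_succAbove _ j,
    Fin.prod_univ_succAbove _ i, Fin.insertNth_apply_same, Fin.insertNth_apply_succAbove]
  simp only [hmM, Finset.mul_sum, Finset.sum_mul]
  simp only [← Finset.sum_product', Finset.univ_product_univ]
  refine Finset.sum_bij' (fun x _ => (x.2.2.2.2, x.2.2.2.1, x.2.2.1, x.1, x.2.1))
    (fun x _ => (x.2.2.2.1, x.2.2.2.2, x.2.2.1, x.2.1, x.1)) ?_ ?_ ?_ ?_ ?_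
  · simp
  · simp
  · simp
  · simp
  · intro x _
    ring

lemma metricMulAt_slotAct {M : Matrix (Fin (d + 1)) (Fin (d + 1)) ℝ}
    (hM : M.transpose * minkowski d * M = minkowski d) (j : Fin (r + 2)) (i : Fin (r + 1))
    (hij : i.castSucc < j) (S : CTensor d r) :
    slotAct M (metricMulAt j i S) = metricMulAt j i (slotAct M S) := by
  have hM' : ∀ a b, (∑ α, ∑ β, (M α a : ℂ) * (minkowski d α β : ℂ) * (M β b : ℂ))
      = (minkowski d a b : ℂ) := by
    intro a b
    conv_rhs => rw [← hM]
    simp only [Matrix.mul_apply, Matrix.transpose_apply, Complex.ofReal_sum, Complex.ofReal_mul,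
      Finset.sum_mul]
    exact Finset.sum_comm
  -- The condition `i.castSucc < j` is what makes `i.castSucc` the slot that remains at position `i`
  -- after `j` is removed.
  have hs : i.castSucc = j.succAbove i := (Fin.succAbove_of_castSucc_lt _ _ hij).symm
  ext μ
  obtain ⟨m, hm⟩ : ∃ m : Fin (d + 1) → Fin (d + 1) → ℂ, ∀ a b, (minkowski d a b : ℂ) = m a b :=
    ⟨_, fun _ _ => rfl⟩
  have hmM : ∀ a b, m a b = _ := fun a b => (hm a b).symm.trans (hM' a b).symm
  simp only [metricMulAt, slotAct_apply, hs]
  conv_rhs => simp only [hm]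
  simp only [sum_insertNth j, sum_insertNth i, Fin.prod_univ_succAbove _ j,
    Fin.prod_univ_succAbove _ i, Fin.insertNth_apply_same, Fin.insertNth_apply_succAbove]
  simp only [hmM, Finset.mul_sum, Finset.sum_mul]
  simp only [← Finset.sum_product', Finset.univ_product_univ]
  refine Finset.sum_bij' (fun x _ => (x.2.2, x.2.1, x.1))
    (fun x _ => (x.2.2, x.2.1, x.1)) ?_ ?_ ?_ ?_ ?_
  · simp
  · simp
  · simp
  · simp
  · intro x _
    ring

/-- The terms in which `l` hits one of the two contracted slots cancel by skewness of `l η`; the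
other terms commute with the contraction. -/
lemma traceAt_genAct {l : Matrix (Fin (d + 1)) (Fin (d + 1)) ℝ}
    (hl : l * minkowski d + minkowski d * l.transpose = 0) (j : Fin (r + 2)) (i : Fin (r + 1))
    (T : CTensor d (r + 2)) :
    traceAt j i (genAct l T) = genAct l (traceAt j i T) := by
  have hl' : ∀ a b, (∑ γ, (l a γ : ℂ) * (minkowski d γ b : ℂ))
      + ∑ γ, (minkowski d a γ : ℂ) * (l b γ : ℂ) = 0 := by
    intro a b
    have h := congrFun (congrFun hl a) b
    simp only [Matrix.add_apply, Matrix.mul_apply, Matrix.transpose_apply,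
      Matrix.zero_apply] at h
    exact_mod_cast h
  ext μ
  simp only [traceAt, genAct, Fin.sum_univ_succAbove _ j, Fin.sum_univ_succAbove _ i,
    Fin.insertNth_apply_same, Fin.insertNth_apply_succAbove, Fin.update_insertNth,
    ← Fin.insertNth_update, mul_add, Finset.sum_add_distrib]
  rw [← add_assoc]
  set F : Fin (d + 1) → Fin (d + 1) → ℂ := fun α β => T (j.insertNth (α := fun _ => Fin (d + 1)) β
      (i.insertNth (α := fun _ => Fin (d + 1)) α μ)) with hF
  have h0 : (∑ α, ∑ β, (minkowski d α β : ℂ) * ∑ γ, (l γ β : ℂ) * F α γ)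
      + (∑ α, ∑ β, (minkowski d α β : ℂ) * ∑ γ, (l γ α : ℂ) * F γ β) = 0 := by
    have h1 : (∑ α, ∑ β, (minkowski d α β : ℂ) * ∑ γ, (l γ β : ℂ) * F α γ)
        = ∑ α, ∑ β, (∑ γ, (minkowski d α γ : ℂ) * (l β γ : ℂ)) * F α β := by
      refine Finset.sum_congr rfl fun α _ => ?_
      simp only [Finset.mul_sum, Finset.sum_mul]
      rw [Finset.sum_comm]
      exact Finset.sum_congr rfl fun _ _ => Finset.sum_congr rfl fun _ _ => by ring
    have h2 : (∑ α, ∑ β, (minkowski d α β : ℂ) * ∑ γ, (l γ α : ℂ) * F γ β)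
        = ∑ α, ∑ β, (∑ γ, (l α γ : ℂ) * (minkowski d γ β : ℂ)) * F α β := by
      rw [Finset.sum_comm]
      conv_rhs => rw [Finset.sum_comm]
      refine Finset.sum_congr rfl fun α _ => ?_
      simp only [Finset.mul_sum, Finset.sum_mul]
      rw [Finset.sum_comm]
      exact Finset.sum_congr rfl fun _ _ => Finset.sum_congr rfl fun _ _ => by ring
    rw [h1, h2, ← Finset.sum_add_distrib]
    refine Finset.sum_eq_zero fun α _ => ?_
    rw [← Finset.sum_add_distrib]
    refine Finset.sum_eq_zero fun β _ => ?_
    rw [← add_mul, add_comm, hl', zero_mul]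
  rw [h0, zero_add]
  simp only [Finset.mul_sum]
  simp only [← Finset.sum_product', Finset.univ_product_univ]
  refine Finset.sum_bij' (fun x _ => (x.2.2.1, x.2.2.2, x.1, x.2.1))
    (fun x _ => (x.2.2.1, x.2.2.2, x.1, x.2.1)) ?_ ?_ ?_ ?_ ?_
  · simp
  · simp
  · simp
  · simp
  · intro x _
    ring

lemma sum_ne_eq_two_mul_sum_lt (f : Fin r → Fin r → ℂ) (hf : ∀ i j, f i j = f j i) :
    ∑ i, ∑ j, (if j = i then 0 else f i j) = 2 * ∑ i, ∑ j, if i < j then f i j else 0 := by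
  have h : ∀ i j, (if j = i then 0 else f i j)
      = (if i < j then f i j else 0) + if j < i then f j i else 0 := by
    intro i j
    rcases lt_trichotomy i j with h | h | h
    · simp [h, h.ne', h.not_gt]
    · simp [h]
    · simp [h, h.ne, h.not_gt, hf i j]
  simp only [h, Finset.sum_add_distrib]
  rw [two_mul]
  congr 1
  exact Finset.sum_comm

/-- `η_{μᵢ μⱼ}` times the trace over the slots `i` and `j`. -/
noncomputable def pairTrace (T : CTensor d r) (μ : Fin r → Fin (d + 1)) (i j : Fin r) : ℂ :=
  (minkowski d (μ i) (μ j) : ℂ) * ∑ α, ∑ β, (minkowski d α β : ℂ) *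
    T (Function.update (Function.update μ i α) j β)

lemma pairTrace_comm (T : CTensor d r) (μ : Fin r → Fin (d + 1)) {i j : Fin r} (h : i ≠ j) :
    pairTrace T μ i j = pairTrace T μ j i := by
  unfold pairTrace
  rw [minkowski_comm, Finset.sum_comm]
  congr 1
  refine Finset.sum_congr rfl fun α _ => Finset.sum_congr rfl fun β _ => ?_
  rw [minkowski_comm, Function.update_comm h]

/-- This form addresses slots by `Function.update` uniformly in the rank, which is how products of
two generators present themselves. -/
lemma metricTraceSum_apply (T : CTensor d r) (μ : Fin r → Fin (d + 1)) :
    metricTraceSum r T μ = ∑ i, ∑ j, if i < j then pairTrace T μ i j else 0 := by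
  match r with
  | 0 => simp [metricTraceSum]
  | 1 => simp [metricTraceSum]
  | r + 2 =>
    rw [metricTraceSum, metricSum, Finset.sum_comm (f := fun i j => if i < j then _ else _),
      Finset.sum_apply]
    refine Finset.sum_congr rfl fun j _ => ?_
    -- The last slot is never the smaller member of a pair, so `i` may range over `Fin (r + 1)`
    -- through `castSucc`.
    rw [Finset.sum_apply, Fin.sum_univ_castSucc (n := r + 1),
      if_neg (Fin.le_last j).not_gt, add_zero]
    refine Finset.sum_congr rfl fun i _ => ?_
    split_ifs with hij
    · have hs : j.succAbove i = i.castSucc := Fin.succAbove_of_castSucc_lt _ _ hij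
      simp only [metricMulAt, traceAt, pairTrace]
      congr 1
      refine Finset.sum_congr rfl fun α _ => Finset.sum_congr rfl fun β _ => ?_
      congr 2
      have h1 : (i.insertNth (α := fun _ => Fin (d + 1)) α
          fun k => μ (j.succAbove (i.succAbove k)))
          = Function.update (fun k => μ (j.succAbove k)) i α :=
        Fin.insertNth_removeNth i α (fun k => μ (j.succAbove k))
      have h2 := Fin.insertNth_removeNth j β μ
      rw [h1, Fin.insertNth_update, hs, Function.update_comm hij.ne, ← h2]
      rfl
    · rfl

/-! ### The generators of the Lorentz algebra and their quadratic Casimir operator -/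

lemma lorentzGenLow_apply (κ ρ α μ : Fin (d + 1)) :
    lorentzGenLow κ ρ α μ = (if α = κ then 1 else 0) * minkowski d ρ μ
      - (if α = ρ then 1 else 0) * minkowski d κ μ := by
  have h : ∀ κ' ρ', (minkowski d κ κ' * minkowski d ρ ρ') * lorentzGen κ' ρ' α μ
      = (minkowski d α κ' * minkowski d κ' κ) * (minkowski d ρ ρ' * if ρ' = μ then 1 else 0)
        - (minkowski d κ κ' * if κ' = μ then 1 else 0)
          * (minkowski d α ρ' * minkowski d ρ' ρ) := by
    intro κ' ρ'
    rw [lorentzGen, minkowski_comm κ' κ, minkowski_comm ρ' ρ]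
    ring
  simp only [lorentzGenLow, Matrix.sum_apply, Matrix.smul_apply, smul_eq_mul, h,
    Finset.sum_sub_distrib, ← Finset.mul_sum, ← Finset.sum_mul, sum_minkowski_mul]
  simp

/-- The first term produces the metric-trace terms of the Casimir operator, the second the
transpositions of slots. -/
lemma lorentzGen_contract (α m β n : Fin (d + 1)) :
    ∑ κ : Fin (d + 1), ∑ ρ : Fin (d + 1), lorentzGenLow κ ρ α m * lorentzGen κ ρ β n
      = 2 * (minkowski d α β * minkowski d m n)
        - 2 * ((if β = m then 1 else 0) * (if α = n then 1 else 0)) := by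
  have h : ∀ κ ρ : Fin (d + 1), lorentzGenLow κ ρ α m * lorentzGen κ ρ β n
      = ((if α = κ then 1 else 0) * minkowski d β κ) * (minkowski d ρ m * if ρ = n then 1 else 0)
      - ((if α = κ then 1 else 0) * (if κ = n then 1 else 0)) * (minkowski d β ρ * minkowski d ρ m)
      - (minkowski d β κ * minkowski d κ m) * ((if α = ρ then 1 else 0) * (if ρ = n then 1 else 0))
      + (minkowski d κ m * if κ = n then 1 else 0) * ((if α = ρ then 1 else 0) * minkowski d β ρ)
      := by
    intro κ ρ
    rw [lorentzGenLow_apply, lorentzGen]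
    ring
  simp only [h, Finset.sum_add_distrib, Finset.sum_sub_distrib, ← Finset.mul_sum,
    ← Finset.sum_mul, sum_minkowski_mul]
  simp
  rw [minkowski_comm n m, minkowski_comm β α]
  split_ifs <;> ring

/-- This is the infinitesimal form of `M η Mᵀ = η`, as required by `traceAt_genAct`. -/
lemma lorentzGen_skew (κ ρ : Fin (d + 1)) :
    lorentzGen κ ρ * minkowski d + minkowski d * (lorentzGen κ ρ).transpose = 0 := by
  ext α β
  simp only [Matrix.add_apply, Matrix.mul_apply, Matrix.transpose_apply, lorentzGen,
    Matrix.zero_apply, sub_mul, mul_sub, Finset.sum_sub_distrib, mul_assoc]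
  simp
  rw [minkowski_comm κ β, minkowski_comm ρ β]
  ring

/-- It makes the linear vector field `y ↦ l y` divergence-free, so integration by parts leaves no
zeroth-order term. -/
lemma lorentzGen_trace (κ ρ : Fin (d + 1)) : ∑ σ, lorentzGen κ ρ σ σ = 0 := by
  simp [lorentzGen, Finset.sum_sub_distrib, minkowski_comm κ ρ]

/-- The sum of the actions of all transpositions of slots. -/
noncomputable def swapSum (T : CTensor d r) : CTensor d r :=
  fun μ => ∑ i : Fin r, ∑ j : Fin r, if i < j then T (μ ∘ Equiv.swap i j) else 0

lemma comp_swap_eq_update {X : Type*} (μ : Fin r → X) (i j : Fin r) :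
    Function.update (Function.update μ i (μ j)) j (μ i) = μ ∘ Equiv.swap i j := by
  ext k
  by_cases hj : k = j
  · subst hj; simp
  · by_cases hi : k = i
    · subst hi; simp [hj]
    · simp [hi, hj, Equiv.swap_apply_of_ne_of_ne]

/-- The Casimir operator of the Lorentz algebra in terms of transpositions and traces. -/
theorem neg_genContract_add_metricTraceSum (a : CTensor d r) :
    -genContract (fun κ ρ => genAct (lorentzGen κ ρ) a) + (4 : ℂ) • metricTraceSum r a
      = (2 * r * d : ℂ) • a + (4 : ℂ) • swapSum a := by
  have hcon : ∀ α m β n : Fin (d + 1), (∑ κ : Fin (d + 1), ∑ ρ : Fin (d + 1),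
      (lorentzGenLow κ ρ α m : ℂ) * (lorentzGen κ ρ β n : ℂ))
      = 2 * ((minkowski d α β : ℂ) * (minkowski d m n : ℂ))
        - 2 * ((if β = m then 1 else 0) * (if α = n then 1 else 0)) := by
    intro α m β n
    have h := congrArg (fun x : ℝ => (x : ℂ)) (lorentzGen_contract α m β n)
    simpa only [Complex.ofReal_sum, Complex.ofReal_mul, Complex.ofReal_sub,
      apply_ite Complex.ofReal, Complex.ofReal_one, Complex.ofReal_zero,
      Complex.ofReal_ofNat] using h
  ext μ
  have h1 : genContract (fun κ ρ => genAct (lorentzGen κ ρ) a) μ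
      = ∑ i, ∑ j, ∑ α, ∑ β, (2 * ((minkowski d α β : ℂ)
          * (minkowski d (μ i) (Function.update μ i α j) : ℂ))
          - 2 * ((if β = μ i then 1 else 0) * (if α = Function.update μ i α j then 1 else 0)))
          * a (Function.update (Function.update μ i α) j β) := by
    simp only [← hcon]
    simp only [genContract, Finset.sum_apply, genAct, Finset.mul_sum, Finset.sum_mul]
    simp only [← Finset.sum_product', Finset.univ_product_univ]
    refine Finset.sum_bij' (fun x _ => (x.2.2.1, x.2.2.2.2.1, x.2.2.2.1, x.2.2.2.2.2, x.1, x.2.1))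
      (fun x _ => (x.2.2.2.2.1, x.2.2.2.2.2, x.1, x.2.2.1, x.2.1, x.2.2.2.1)) ?_ ?_ ?_ ?_ ?_
    · simp
    · simp
    · simp
    · simp
    · intro x _
      ring
  -- For `i = j` the two terms of the contraction contribute `2` and `-2(d + 1)`, together `-2d` for
  -- each slot. For `i ≠ j` they give a trace and a transposition.
  have h2 : ∀ i j, (∑ α, ∑ β, (2 * ((minkowski d α β : ℂ)
          * (minkowski d (μ i) (Function.update μ i α j) : ℂ))
          - 2 * ((if β = μ i then 1 else 0) * (if α = Function.update μ i α j then 1 else 0)))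
          * a (Function.update (Function.update μ i α) j β))
      = (if j = i then -(2 * d * a μ) else 0)
        + if j = i then 0 else 2 * pairTrace a μ i j - 2 * a (μ ∘ Equiv.swap i j) := by
    intro i j
    split_ifs with hij
    · subst hij
      have h3 : ∀ β, (∑ α, (minkowski d α β : ℂ) * (minkowski d (μ j) α : ℂ))
          = if μ j = β then 1 else 0 := by
        intro β
        have h4 := congrArg (fun x : ℝ => (x : ℂ)) (sum_minkowski_mul (μ j) β)
        simp only [Complex.ofReal_sum, Complex.ofReal_mul, apply_ite Complex.ofReal,
          Complex.ofReal_one, Complex.ofReal_zero] at h4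
        rw [← h4]
        exact Finset.sum_congr rfl fun _ _ => mul_comm _ _
      simp only [Function.update_self, Function.update_idem, if_true, mul_one, sub_mul,
        Finset.sum_sub_distrib]
      rw [Finset.sum_comm]
      simp only [mul_assoc, ← Finset.mul_sum]
      simp only [← mul_assoc, ← Finset.sum_mul, h3]
      simp
      ring
    · simp only [Function.update_of_ne hij, sub_mul, Finset.sum_sub_distrib, zero_add]
      congr 1
      · simp only [pairTrace, Finset.mul_sum]
        exact Finset.sum_congr rfl fun _ _ => Finset.sum_congr rfl fun _ _ => by ring
      · rw [← comp_swap_eq_update]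
        simp
  have h5 : ∑ i : Fin r, ∑ j : Fin r, (if j = i then -(2 * d * a μ) else 0) = -(2 * r * d * a μ) := by
    simp
    ring
  have h6 : (∑ i : Fin r, ∑ j : Fin r, if j = i then 0 else
      2 * pairTrace a μ i j - 2 * a (μ ∘ Equiv.swap i j))
      = 4 * (∑ i : Fin r, ∑ j : Fin r, if i < j then pairTrace a μ i j else 0)
        - 4 * ∑ i : Fin r, ∑ j : Fin r, if i < j then a (μ ∘ Equiv.swap i j) else 0 := by
    have h7 := sum_ne_eq_two_mul_sum_lt (fun i j => if i = j then 0 else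
      2 * pairTrace a μ i j - 2 * a (μ ∘ Equiv.swap i j)) (by
        intro i j
        by_cases hij : i = j
        · simp [hij]
        · simp only [hij, Ne.symm hij, if_false]
          rw [pairTrace_comm a μ hij, Equiv.swap_comm])
    have h8 : ∀ i j : Fin r, (if j = i then 0 else if i = j then 0 else
      2 * pairTrace a μ i j - 2 * a (μ ∘ Equiv.swap i j)) = if j = i then 0 else
      2 * pairTrace a μ i j - 2 * a (μ ∘ Equiv.swap i j) := by
      intro i j
      by_cases hij : j = i
      · simp [hij]
      · simp [hij, Ne.symm hij]
    have h9 : ∀ i j : Fin r, (if i < j then if i = j then 0 else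
      2 * pairTrace a μ i j - 2 * a (μ ∘ Equiv.swap i j) else 0) =
      2 * (if i < j then pairTrace a μ i j else 0)
        - 2 * if i < j then a (μ ∘ Equiv.swap i j) else 0 := by
      intro i j
      by_cases hij : i < j
      · simp [hij, hij.ne]
      · simp [hij]
    simp only [h8, h9, Finset.sum_sub_distrib, ← Finset.mul_sum] at h7
    rw [h7]
    ring
  simp only [Pi.add_apply, Pi.neg_apply, Pi.smul_apply, smul_eq_mul, h1, h2,
    Finset.sum_add_distrib, h5, h6, metricTraceSum_apply, swapSum]
  ring

end TensorAlgebra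

/-! ### Tensors annihilated by the Casimir operator -/

section Casimir

variable {d r : ℕ}

/-- The number of slots with index `a`. -/
def weight (μ : Fin r → Fin (d + 1)) (a : Fin (d + 1)) : ℕ :=
  (Finset.univ.filter fun k => μ k = a).card

lemma sum_weight (μ : Fin r → Fin (d + 1)) : ∑ a, weight μ a = r := by
  have h := Finset.card_eq_sum_card_fiberwise (f := μ) (s := Finset.univ) (t := Finset.univ)
    (fun _ _ => Finset.mem_coe.2 (Finset.mem_univ _))
  simpa [weight] using h.symm

lemma genAct_single (a b : Fin (d + 1)) (T : CTensor d r) (μ : Fin r → Fin (d + 1)) :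
    genAct (Matrix.single a b 1) T μ
      = ∑ k, if μ k = b then T (Function.update μ k a) else 0 := by
  simp only [genAct]
  refine Finset.sum_congr rfl fun k _ => ?_
  rw [Finset.sum_eq_single a]
  · by_cases h : μ k = b
    · simp [h]
    · simp [h, Ne.symm h]
  · intro α _ hα
    simp [hα.symm]
  · simp

lemma genAct_single_self (a : Fin (d + 1)) (T : CTensor d r) (μ : Fin r → Fin (d + 1)) :
    genAct (Matrix.single a a 1) T μ = weight μ a * T μ := by
  rw [genAct_single, weight, Finset.card_filter, Nat.cast_sum, Finset.sum_mul]
  refine Finset.sum_congr rfl fun k _ => ?_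
  split_ifs with h
  · rw [← h, Function.update_eq_self]; simp
  · simp

/-- This is the Casimir operator of `gl(D)`: both factors on one slot contribute `D`, and factors on
different slots exchange them, each transposition occurring twice. -/
lemma sum_genAct_single (T : CTensor d r) :
    ∑ a : Fin (d + 1), ∑ b : Fin (d + 1),
      genAct (Matrix.single a b 1) (genAct (Matrix.single b a 1) T)
      = (r * (d + 1) : ℂ) • T + (2 : ℂ) • swapSum T := by
  ext μ
  have h1 : ∀ k j, (∑ a : Fin (d + 1), ∑ b : Fin (d + 1), if μ k = b then
      (if Function.update μ k a j = a then
        T (Function.update (Function.update μ k a) j b) else 0) else 0)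
      = (if j = k then ((d + 1 : ℕ) : ℂ) * T μ else 0)
        + if j = k then 0 else T (μ ∘ Equiv.swap k j) := by
    intro k j
    by_cases hjk : j = k
    · subst hjk
      simp
    · simp only [hjk, if_false, zero_add, Finset.sum_ite_eq, Finset.mem_univ, if_true,
        Function.update_of_ne hjk]
      rw [comp_swap_eq_update]
  have h2 := sum_ne_eq_two_mul_sum_lt (fun i j => T (μ ∘ Equiv.swap i j))
    (fun i j => by rw [Equiv.swap_comm])
  have h3 : (∑ a : Fin (d + 1), ∑ b : Fin (d + 1),
      genAct (Matrix.single a b 1) (genAct (Matrix.single b a 1) T)) μ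
      = ∑ k, ∑ j, ∑ a : Fin (d + 1), ∑ b : Fin (d + 1), if μ k = b then
      (if Function.update μ k a j = a then
        T (Function.update (Function.update μ k a) j b) else 0) else 0 := by
    simp only [Finset.sum_apply, genAct_single]
    have h4 : ∀ a b k, (if μ k = b then ∑ j, (if Function.update μ k a j = a then
        T (Function.update (Function.update μ k a) j b) else 0) else 0)
        = ∑ j, if μ k = b then (if Function.update μ k a j = a then
        T (Function.update (Function.update μ k a) j b) else 0) else 0 := by
      intro a b k
      split_ifs <;> simp
    simp only [h4]
    simp only [← Finset.sum_product', Finset.univ_product_univ]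
    exact Finset.sum_bij' (fun x _ => (x.2.2.1, x.2.2.2, x.1, x.2.1))
      (fun x _ => (x.2.2.1, x.2.2.2, x.1, x.2.1)) (by simp) (by simp) (by simp) (by simp)
      (fun x _ => rfl)
  rw [h3]
  simp only [h1, Finset.sum_add_distrib, h2]
  simp [swapSum]
  ring

lemma sum_conj_mul_genAct (l : Matrix (Fin (d + 1)) (Fin (d + 1)) ℝ) (S T : CTensor d r) :
    ∑ μ, (starRingEnd ℂ) (S μ) * genAct l T μ
      = ∑ μ, (starRingEnd ℂ) (genAct l.transpose S μ) * T μ := by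
  simp only [genAct, Matrix.transpose_apply, map_sum, map_mul, Complex.conj_ofReal,
    Finset.mul_sum, Finset.sum_mul]
  rw [Finset.sum_comm]
  conv_rhs => rw [Finset.sum_comm]
  refine Finset.sum_congr rfl fun k _ => ?_
  simp only [← Finset.sum_product', Finset.univ_product_univ]
  -- The reindexing is an involution: it exchanges the value in slot `k` with the summation index.
  refine Finset.sum_bij' (fun x _ => (Function.update x.1 k x.2, x.1 k))
    (fun x _ => (Function.update x.1 k x.2, x.1 k)) (by simp) (by simp) (by simp) (by simp) ?_
  intro x _
  simp
  ring

/-- The elementary matrices `e_{ab}` and `e_{ba}` act as mutual adjoints, so the expectation of the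
`gl(D)` Casimir operator is a sum of squared norms. -/
lemma sum_normSq_genAct_single (T : CTensor d r) :
    ∑ a : Fin (d + 1), ∑ b : Fin (d + 1), ∑ μ, Complex.normSq (genAct (Matrix.single a b 1) T μ)
      = (∑ μ, (starRingEnd ℂ) (T μ) * ((r * (d + 1) : ℂ) • T + (2 : ℂ) • swapSum T) μ).re := by
  have h : ∑ μ, (starRingEnd ℂ) (T μ) * ((r * (d + 1) : ℂ) • T + (2 : ℂ) • swapSum T) μ
      = ∑ a : Fin (d + 1), ∑ b : Fin (d + 1), ∑ μ, (starRingEnd ℂ) (T μ)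
        * genAct (Matrix.single a b 1) (genAct (Matrix.single b a 1) T) μ := by
    rw [← sum_genAct_single]
    simp only [Finset.sum_apply, Finset.mul_sum]
    rw [Finset.sum_comm]
    exact Finset.sum_congr rfl fun a _ => Finset.sum_comm
  rw [h, Finset.sum_comm, Complex.re_sum]
  refine Finset.sum_congr rfl fun b _ => ?_
  rw [Complex.re_sum]
  refine Finset.sum_congr rfl fun a _ => ?_
  rw [sum_conj_mul_genAct, Matrix.transpose_single, Complex.re_sum]
  refine Finset.sum_congr rfl fun μ _ => ?_
  rw [Complex.conj_mul', ← Complex.ofReal_pow, Complex.ofReal_re, Complex.normSq_eq_norm_sq]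

/-- Equality case of the bound on the sum of all transpositions. -/
lemma eq_zero_of_casimir_eq_zero {T : CTensor d r}
    (hT : (2 * r * d : ℂ) • T + (4 : ℂ) • swapSum T = 0) :
    (∀ a b : Fin (d + 1), a ≠ b → genAct (Matrix.single a b 1) T = 0) ∧
      ∀ μ, T μ ≠ 0 → ∀ a, weight μ a ≤ 1 := by
  -- Since `r(d + 1) + 2S = r + ½(2rd + 4S)`, with `S` the sum of transpositions, the hypothesis
  -- makes the `gl(D)` Casimir operator act as `r`.
  have h1 : ((r * (d + 1) : ℂ) • T + (2 : ℂ) • swapSum T) = (r : ℂ) • T := by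
    have : (r * (d + 1) : ℂ) • T + (2 : ℂ) • swapSum T
        = (r : ℂ) • T + (1 / 2 : ℂ) • ((2 * r * d : ℂ) • T + (4 : ℂ) • swapSum T) := by
      module
    rw [this, hT, smul_zero, add_zero]
  have h2 := sum_normSq_genAct_single T
  rw [h1] at h2
  have h3 : (∑ μ, (starRingEnd ℂ) (T μ) * ((r : ℂ) • T) μ).re
      = ∑ μ, (∑ a, (weight μ a : ℝ)) * Complex.normSq (T μ) := by
    rw [Complex.re_sum]
    refine Finset.sum_congr rfl fun μ _ => ?_
    rw [← Nat.cast_sum, sum_weight, Pi.smul_apply, smul_eq_mul, mul_left_comm,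
      Complex.conj_mul', ← Complex.ofReal_pow, Complex.normSq_eq_norm_sq]
    norm_cast
  set f : Fin (d + 1) → Fin (d + 1) → ℝ := fun a b =>
    ∑ μ, Complex.normSq (genAct (Matrix.single a b 1) T μ) with hf
  have hf0 : ∀ a b, 0 ≤ f a b := fun a b => Finset.sum_nonneg fun _ _ => Complex.normSq_nonneg _
  have h4 : ∑ a, f a a = ∑ μ, (∑ a, (weight μ a : ℝ) ^ 2) * Complex.normSq (T μ) := by
    simp only [hf, genAct_single_self, Complex.normSq_mul, Complex.normSq_natCast, ← sq,
      Finset.sum_mul]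
    exact Finset.sum_comm
  -- The diagonal part carries `∑ w²` for the weights `w`, while the total carries `∑ w = r`. The
  -- difference splits into the off-diagonal norms and the terms `(w² - w)|T|²`, all non-negative
  -- and summing to zero, so each vanishes.
  have h5 : ∑ a, (∑ b, f a b - f a a)
      + ∑ μ, (∑ a, ((weight μ a : ℝ) ^ 2 - weight μ a)) * Complex.normSq (T μ) = 0 := by
    simp only [Finset.sum_sub_distrib, sub_mul, h4, ← h3, ← h2]
    ring
  have h6 : ∀ a, 0 ≤ ∑ b, f a b - f a a := fun a =>
    sub_nonneg.2 (Finset.single_le_sum (fun b _ => hf0 a b) (Finset.mem_univ a))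
  have hw : ∀ (μ : Fin r → Fin (d + 1)) a, 0 ≤ (weight μ a : ℝ) ^ 2 - weight μ a := by
    intro μ a
    rw [sub_nonneg]
    exact_mod_cast Nat.le_self_pow two_ne_zero _
  have h7 : ∀ μ : Fin r → Fin (d + 1), 0 ≤ (∑ a, ((weight μ a : ℝ) ^ 2 - weight μ a))
      * Complex.normSq (T μ) :=
    fun μ => mul_nonneg (Finset.sum_nonneg fun a _ => hw μ a) (Complex.normSq_nonneg _)
  have h8 := (add_eq_zero_iff_of_nonneg (Finset.sum_nonneg fun a _ => h6 a)
    (Finset.sum_nonneg fun μ _ => h7 μ)).1 h5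
  constructor
  · intro a b hab
    have h9 := (Finset.sum_eq_zero_iff_of_nonneg fun a _ => h6 a).1 h8.1 a (Finset.mem_univ a)
    rw [← Finset.add_sum_erase _ _ (Finset.mem_univ a), add_sub_cancel_left] at h9
    have h10 := (Finset.sum_eq_zero_iff_of_nonneg fun b _ => hf0 a b).1 h9 b
      (Finset.mem_erase.2 ⟨hab.symm, Finset.mem_univ b⟩)
    ext μ
    exact Complex.normSq_eq_zero.1 ((Finset.sum_eq_zero_iff_of_nonneg
      fun μ _ => Complex.normSq_nonneg _).1 h10 μ (Finset.mem_univ μ))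
  · intro μ hμ a
    have h9 := (Finset.sum_eq_zero_iff_of_nonneg fun μ _ => h7 μ).1 h8.2 μ (Finset.mem_univ μ)
    have h10 := (mul_eq_zero.1 h9).resolve_right (Complex.normSq_pos.2 hμ).ne'
    have h11 := (Finset.sum_eq_zero_iff_of_nonneg fun a _ => hw μ a).1 h10 a (Finset.mem_univ a)
    by_contra h
    push Not at h
    have : (1 : ℝ) < weight μ a := by exact_mod_cast h
    nlinarith

/-- If `b` occurs in `μ` and `a` does not, replace one `b` by `a`: at this index only one term of
`e_{ba}T` survives, and it is `T μ ≠ 0`. With weights at most one, all weights therefore agree. -/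
lemma weight_eq_of_casimir_eq_zero {T : CTensor d r}
    (hT : (2 * r * d : ℂ) • T + (4 : ℂ) • swapSum T = 0) {μ : Fin r → Fin (d + 1)}
    (hμ : T μ ≠ 0) (a b : Fin (d + 1)) : weight μ a = weight μ b := by
  obtain ⟨h1, h2⟩ := eq_zero_of_casimir_eq_zero hT
  have key : ∀ a b : Fin (d + 1), weight μ a = 0 → weight μ b = 0 := by
    intro a b ha
    by_contra hb
    obtain ⟨k, hk⟩ := Finset.card_ne_zero.1 hb
    simp only [Finset.mem_filter, Finset.mem_univ, true_and] at hk
    have ha' : ∀ j, μ j ≠ a := by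
      intro j hj
      have := Finset.card_eq_zero.1 ha
      exact Finset.notMem_empty j (this ▸ Finset.mem_filter.2 ⟨Finset.mem_univ j, hj⟩)
    have hab : b ≠ a := fun h => ha' k (hk.trans h)
    have h3 := congrFun (h1 b a hab) (Function.update μ k a)
    rw [genAct_single, Finset.sum_eq_single k] at h3
    · simp only [Function.update_self, if_true, Function.update_idem, Pi.zero_apply] at h3
      rw [← hk, Function.update_eq_self] at h3
      exact hμ h3
    · intro j _ hj
      rw [Function.update_of_ne hj, if_neg (ha' j)]
    · simp
  have ha := h2 μ hμ a
  have hb := h2 μ hμ b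
  have hab := key a b
  have hba := key b a
  omega

lemma hasDerivAt_slotAct_transvection (a b : Fin (d + 1)) (T : CTensor d r) :
    HasDerivAt (fun t : ℝ => slotAct (Matrix.transvection a b t) T)
      (genAct (Matrix.single a b 1) T) 0 := by
  rw [hasDerivAt_pi]
  intro μ
  simp only [slotAct_apply]
  have h1 : ∀ α : Fin r → Fin (d + 1), HasDerivAt (fun t : ℝ =>
      (∏ k, ((Matrix.transvection a b t (α k) (μ k) : ℝ) : ℂ)) * T α)
      ((∑ k, (∏ j ∈ Finset.univ.erase k, if α j = μ j then (1 : ℂ) else 0)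
        * ((Matrix.single a b (1 : ℝ) (α k) (μ k) : ℝ) : ℂ)) * T α) 0 := by
    intro α
    have h2 : ∀ k ∈ Finset.univ, HasDerivAt (fun t : ℝ =>
        ((Matrix.transvection a b t (α k) (μ k) : ℝ) : ℂ))
        ((Matrix.single a b (1 : ℝ) (α k) (μ k) : ℝ) : ℂ) 0 := by
      intro k _
      have h3 : (fun t : ℝ => ((Matrix.transvection a b t (α k) (μ k) : ℝ) : ℂ))
          = fun t : ℝ => (((1 : Matrix (Fin (d + 1)) (Fin (d + 1)) ℝ) (α k) (μ k)
            + t * Matrix.single a b (1 : ℝ) (α k) (μ k) : ℝ) : ℂ) := by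
        ext t
        rw [Matrix.transvection, Matrix.add_apply, ← mul_one t, ← smul_eq_mul,
          ← Matrix.smul_single, Matrix.smul_apply]
        simp
      rw [h3]
      have h4 := ((hasDerivAt_id (0 : ℝ)).mul_const
        (Matrix.single a b (1 : ℝ) (α k) (μ k))).const_add
          ((1 : Matrix (Fin (d + 1)) (Fin (d + 1)) ℝ) (α k) (μ k))
      rw [one_mul] at h4
      exact HasDerivAt.ofReal_comp h4
    have h4 := (HasDerivAt.fun_finsetProd h2).mul_const (T α)
    simpa [Matrix.one_apply, apply_ite Complex.ofReal] using h4
  have h5 := HasDerivAt.fun_sum fun α (_ : α ∈ Finset.univ) => h1 α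
  convert h5 using 1
  simp only [genAct, Finset.sum_mul]
  conv_rhs => rw [Finset.sum_comm]
  refine Finset.sum_congr rfl fun k _ => ?_
  -- By the product rule at the identity, only the indices that agree with `μ` outside slot `k`
  -- contribute.
  refine Finset.sum_of_injOn (fun β => Function.update μ k β) ?_ ?_ ?_ ?_
  · exact fun β _ β' _ h => Function.update_injective μ k h
  · exact fun _ _ => Finset.mem_coe.2 (Finset.mem_univ _)
  · intro α _ hα
    have : ∃ j, j ≠ k ∧ α j ≠ μ j := by
      by_contra! h
      refine hα ⟨α k, Finset.mem_coe.2 (Finset.mem_univ _), ?_⟩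
      ext j
      by_cases hj : j = k
      · subst hj; simp
      · simp [hj, h j hj]
    obtain ⟨j, hjk, hj⟩ := this
    rw [Finset.prod_eq_zero (Finset.mem_erase.2 ⟨hjk, Finset.mem_univ j⟩) (if_neg hj)]
    simp
  · intro β _
    rw [Finset.prod_eq_one]
    · simp
    · intro j hj
      rw [Function.update_of_ne (Finset.ne_of_mem_erase hj), if_pos rfl]

/-- Transvections with fixed `a ≠ b` form a one-parameter group, so the derivative at any `t` is the
image of the derivative at `0`, which vanishes. -/
lemma slotAct_transvection_of_genAct_eq_zero {a b : Fin (d + 1)} (hab : a ≠ b) {T : CTensor d r}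
    (hT : genAct (Matrix.single a b 1) T = 0) (t : ℝ) :
    slotAct (Matrix.transvection a b t) T = T := by
  have h1 : ∀ t : ℝ, HasDerivAt (fun t : ℝ => slotAct (Matrix.transvection a b t) T) 0 t := by
    intro t
    have h2 := hasDerivAt_slotAct_transvection a b T
    rw [hT] at h2
    have h3 := (LinearMap.toContinuousLinearMap
      ((slotAct (r := r) (Matrix.transvection a b t)).restrictScalars ℝ)).hasFDerivAt.comp_hasDerivAt
        (0 : ℝ) h2
    rw [map_zero] at h3
    have h4 : HasDerivAt (fun s : ℝ => slotAct (Matrix.transvection a b s) T) 0 (t - t) := by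
      rwa [sub_self, ← hT, hT]
    have h5 : (fun s : ℝ => slotAct (Matrix.transvection a b s) T)
        = fun s : ℝ => slotAct (Matrix.transvection a b t)
          (slotAct (Matrix.transvection a b (s - t)) T) := by
      ext1 s
      rw [← slotAct_mul, Matrix.transvection_mul_transvection_same _ _ hab, sub_add_cancel]
    rw [h5]
    have h6 : HasDerivAt (fun s : ℝ => s - t) 1 t := (hasDerivAt_id t).sub_const t
    have h7 := HasDerivAt.scomp (h := fun s : ℝ => s - t) (h' := 1) t
      (g₁ := fun s : ℝ => slotAct (Matrix.transvection a b t)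
          (slotAct (Matrix.transvection a b s) T)) (g₁' := 0) (by rw [sub_self]; exact h3) h6
    rw [smul_zero] at h7
    exact h7
  have h2 := is_const_of_deriv_eq_zero (fun t => (h1 t).differentiableAt)
    (fun t => (h1 t).deriv) t 0
  simpa [slotAct_one] using h2

lemma slotAct_diagonal (D : Fin (d + 1) → ℝ) (T : CTensor d r) (μ : Fin r → Fin (d + 1)) :
    slotAct (Matrix.diagonal D) T μ = (∏ a, (D a : ℂ) ^ weight μ a) * T μ := by
  rw [slotAct_apply, Finset.sum_eq_single μ]
  · simp only [Matrix.diagonal_apply_eq]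
    rw [← Finset.prod_fiberwise_of_maps_to (t := Finset.univ) (g := μ)
      (fun _ _ => Finset.mem_univ _)]
    congr 1
    refine Finset.prod_congr rfl fun a _ => ?_
    rw [Finset.prod_congr rfl (g := fun _ => (D a : ℂ)), Finset.prod_const, weight]
    intro k hk
    rw [(Finset.mem_filter.1 hk).2]
  · intro α _ hα
    obtain ⟨k, hk⟩ := Function.ne_iff.1 hα
    rw [Finset.prod_eq_zero (Finset.mem_univ k) (by simp [hk]), zero_mul]
  · simp

/-- A tensor on which the sum of all transpositions takes the value `-r d / 2` is invariant under
unimodular matrices. -/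
theorem slotAct_eq_of_casimir_eq_zero {T : CTensor d r}
    (hT : (2 * r * d : ℂ) • T + (4 : ℂ) • swapSum T = 0)
    {M : Matrix (Fin (d + 1)) (Fin (d + 1)) ℝ} (hM : M.det = 1) : slotAct M T = T := by
  -- Every matrix is a product of transvections and a diagonal matrix of the same determinant, so
  -- these two cases suffice.
  refine Matrix.diagonal_transvection_induction (fun M => slotAct M T = T) M ?_ ?_ ?_
  · intro D hD
    rw [hM, Matrix.det_diagonal] at hD
    ext μ
    rw [slotAct_diagonal]
    by_cases hμ : T μ = 0
    · simp [hμ]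
    -- All weights of `μ` are equal, so the scalar is a power of the determinant, that is `1`.
    · rw [Finset.prod_congr rfl fun a _ => by rw [weight_eq_of_casimir_eq_zero hT hμ a 0],
        Finset.prod_pow, ← Complex.ofReal_prod, hD]
      simp
  · intro t
    exact slotAct_transvection_of_genAct_eq_zero t.hij
      ((eq_zero_of_casimir_eq_zero hT).1 _ _ t.hij) t.c
  · intro A B hA hB
    rw [slotAct_mul, hA, hB]

end Casimir

/-! ### Central idempotents of the group algebra of the symmetric group -/

section GroupAlgebra

lemma MonoidAlgebra.mem_center_iff_single {G : Type*} [Group G] (x : MonoidAlgebra ℂ G) :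
    x ∈ Subalgebra.center ℂ (MonoidAlgebra ℂ G) ↔
      ∀ g, MonoidAlgebra.single g 1 * x = x * MonoidAlgebra.single g 1 := by
  rw [Subalgebra.mem_center_iff]
  refine ⟨fun h g => h _, fun h y => ?_⟩
  induction y using MonoidAlgebra.induction_on with
  | of g => exact h g
  | add y z hy hz => rw [add_mul, mul_add, hy, hz]
  | smul c y hy => rw [smul_mul_assoc, mul_smul_comm, hy]

lemma MonoidAlgebra.mem_center_iff_coeff {G : Type*} [Group G] (x : MonoidAlgebra ℂ G) :
    x ∈ Subalgebra.center ℂ (MonoidAlgebra ℂ G) ↔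
      ∀ g h, x.coeff (g * h * g⁻¹) = x.coeff h := by
  rw [MonoidAlgebra.mem_center_iff_single]
  constructor
  · intro h g k
    have := congrArg (fun y => y.coeff (g * k)) (h g)
    simpa using this.symm
  · intro h g
    ext k
    simpa using (h g (g⁻¹ * k)).symm

/-- A central element of square zero lies in the Jacobson radical, and the radical is zero by
Maschke's theorem. -/
instance MonoidAlgebra.isReduced_center {G : Type*} [Group G] [Finite G] :
    IsReduced (Subalgebra.center ℂ (MonoidAlgebra ℂ G)) := by
  rw [isReduced_iff_pow_one_lt 2 (by norm_num)]
  intro x hx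
  have hx2 : (x : MonoidAlgebra ℂ G) * x = 0 := by
    have := congrArg Subtype.val hx
    simpa [sq] using this
  have hmem : (x : MonoidAlgebra ℂ G) ∈ Ring.jacobson (MonoidAlgebra ℂ G) := by
    rw [← Ideal.jacobson_bot, Ideal.mem_jacobson_iff]
    intro y
    -- As `x` is central with `x² = 0`, also `(yx)² = 0`, so `1 - yx` inverts `1 + yx`.
    refine ⟨1 - y * x, ?_⟩
    have hc := Subalgebra.mem_center_iff.1 x.2 y
    have h : (1 - y * (x : MonoidAlgebra ℂ G)) * y * x + (1 - y * x) - 1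
        = -(y * (x * y) * x) := by noncomm_ring
    rw [h, ← hc, mul_assoc, mul_assoc, hx2]
    simp
  have : NeZero (Nat.card G : ℂ) := ⟨Nat.cast_ne_zero.2 Nat.card_pos.ne'⟩
  rw [IsSemisimpleRing.jacobson_eq_bot] at hmem
  exact Subtype.ext hmem

/-- A finite-dimensional reduced commutative algebra over `ℂ` is a product of copies of `ℂ`. -/
noncomputable def reducedAlgEquivPi (Z : Type*) [CommRing Z] [Algebra ℂ Z] [Module.Finite ℂ Z]
    [IsArtinianRing Z] [IsReduced Z] : Z ≃ₐ[ℂ] (MaximalSpectrum Z → ℂ) :=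
  ((IsArtinianRing.equivPi Z).restrictScalars ℂ).trans
    (AlgEquiv.piCongrRight fun I : MaximalSpectrum Z =>
      haveI := I.isMaximal.isPrime
      (AlgEquiv.ofBijective (Algebra.ofId ℂ (Z ⧸ I.asIdeal))
        IsAlgClosed.algebraMap_bijective_of_isIntegral).symm)

/-- Cycle types omit fixed points. The parts at least `2` are realized as a cycle type, and the sum
condition forces the number of parts equal to `1`. -/
lemma Equiv.Perm.partition_surjective {α : Type*} [Fintype α] [DecidableEq α] :
    Function.Surjective (Equiv.Perm.partition (α := α)) := by
  intro lam
  have hsplit : lam.parts.filter (fun n => 2 ≤ n) + lam.parts.filter (fun n => ¬ 2 ≤ n)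
      = lam.parts := Multiset.filter_add_not _ _
  have hone : lam.parts.filter (fun n => ¬ 2 ≤ n)
      = Multiset.replicate (Multiset.card (lam.parts.filter (fun n => ¬ 2 ≤ n))) 1 := by
    rw [Multiset.eq_replicate_card]
    intro n hn
    rw [Multiset.mem_filter] at hn
    have := lam.parts_pos hn.1
    omega
  have hsum : (lam.parts.filter fun n => 2 ≤ n).sum
      + Multiset.card (lam.parts.filter (fun n => ¬ 2 ≤ n)) = Fintype.card α := by
    have h := lam.parts_sum
    rw [← hsplit, Multiset.sum_add, hone, Multiset.sum_replicate, smul_eq_mul, mul_one] at h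
    exact h
  obtain ⟨σ, hσ⟩ := (Equiv.Perm.exists_with_cycleType_iff α
    (m := lam.parts.filter fun n => 2 ≤ n)).2
      ⟨by omega, fun a ha => (Multiset.mem_filter.1 ha).2⟩
  refine ⟨σ, ?_⟩
  rw [Nat.Partition.ext_iff, Equiv.Perm.parts_partition, ← Equiv.Perm.sum_cycleType, hσ]
  conv_rhs => rw [← hsplit, hone]
  congr 2
  omega

/-- The central element of the group algebra of a symmetric group given by a function of the cycle
type. -/
noncomputable def classFunction {α : Type*} [Fintype α] [DecidableEq α]
    (f : (Fintype.card α).Partition → ℂ) :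
    Subalgebra.center ℂ (MonoidAlgebra ℂ (Equiv.Perm α)) :=
  ⟨MonoidAlgebra.ofCoeff (Finsupp.equivFunOnFinite.symm fun σ : Equiv.Perm α => f σ.partition), by
    rw [MonoidAlgebra.mem_center_iff_coeff]
    intro g h
    have : (g * h * g⁻¹).partition = h.partition :=
      (Equiv.Perm.partition_eq_of_isConj.1 (isConj_iff.2 ⟨g, rfl⟩)).symm
    simp [this]⟩

lemma coeff_classFunction {α : Type*} [Fintype α] [DecidableEq α]
    (f : (Fintype.card α).Partition → ℂ) (σ : Equiv.Perm α) :
    (classFunction f : MonoidAlgebra ℂ (Equiv.Perm α)).coeff σ = f σ.partition := rfl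

/-- Class functions on a symmetric group are the elements of the centre of the group algebra. -/
noncomputable def classFunctionEquivCenter (α : Type*) [Fintype α] [DecidableEq α] :
    ((Fintype.card α).Partition → ℂ) ≃ₗ[ℂ]
      Subalgebra.center ℂ (MonoidAlgebra ℂ (Equiv.Perm α)) :=
  LinearEquiv.ofBijective
    { toFun := classFunction
      map_add' := fun f g => by
        apply Subtype.ext
        ext σ
        simp [coeff_classFunction]
      map_smul' := fun c f => by
        apply Subtype.ext
        ext σ
        simp [coeff_classFunction] }
    (by
      constructor
      · intro f g hfg
        ext lam
        obtain ⟨σ, rfl⟩ := Equiv.Perm.partition_surjective lam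
        exact congrArg (fun x : Subalgebra.center ℂ (MonoidAlgebra ℂ (Equiv.Perm α)) =>
          (x : MonoidAlgebra ℂ (Equiv.Perm α)).coeff σ) hfg
      · intro x
        refine ⟨fun lam => (x : MonoidAlgebra ℂ (Equiv.Perm α)).coeff
          (Function.surjInv Equiv.Perm.partition_surjective lam), ?_⟩
        apply Subtype.ext
        ext σ
        have h := Equiv.Perm.partition_eq_of_isConj.2
          (Function.surjInv_eq Equiv.Perm.partition_surjective σ.partition)
        obtain ⟨g, hg⟩ := isConj_iff.1 h
        have h2 := (MonoidAlgebra.mem_center_iff_coeff _).1 x.2 g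
          (Function.surjInv Equiv.Perm.partition_surjective σ.partition)
        rw [hg] at h2
        exact h2.symm)

/-- Both sides are the dimension of the centre, computed from its product decomposition and from
class functions. -/
lemma card_maximalSpectrum_center (r : ℕ) :
    Nat.card (MaximalSpectrum (Subalgebra.center ℂ (SymGroupAlg r)))
      = Nat.card r.Partition := by
  have : IsArtinianRing (Subalgebra.center ℂ (SymGroupAlg r)) :=
    IsArtinianRing.of_finite ℂ _
  have := Fintype.ofFinite (MaximalSpectrum (Subalgebra.center ℂ (SymGroupAlg r)))
  have h1 := (reducedAlgEquivPi (Subalgebra.center ℂ (SymGroupAlg r))).toLinearEquiv.finrank_eq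
  have h2 := (classFunctionEquivCenter (Fin r)).finrank_eq
  rw [Module.finrank_fintype_fun_eq_card] at h1 h2
  rw [Nat.card_eq_fintype_card, ← h1, ← h2, ← Nat.card_eq_fintype_card, Fintype.card_fin]

/-- The sum of all transpositions in the group algebra of `S_r`. -/
noncomputable def swapElement (r : ℕ) : SymGroupAlg r :=
  ∑ i : Fin r, ∑ j : Fin r,
    if i < j then MonoidAlgebra.single (Equiv.swap i j) (1 : ℂ) else 0

lemma two_smul_swapElement (r : ℕ) : (2 : ℂ) • swapElement r = ∑ i : Fin r, ∑ j : Fin r,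
    if i = j then 0 else MonoidAlgebra.single (Equiv.swap i j) (1 : ℂ) := by
  have h : ∀ i j : Fin r, (if i = j then 0 else MonoidAlgebra.single (Equiv.swap i j) (1 : ℂ))
      = (if i < j then MonoidAlgebra.single (Equiv.swap i j) (1 : ℂ) else 0)
        + if j < i then MonoidAlgebra.single (Equiv.swap j i) (1 : ℂ) else 0 := by
    intro i j
    rcases lt_trichotomy i j with h | h | h
    · simp [h, h.ne, h.not_gt]
    · simp [h]
    · simp [h, h.ne', h.not_gt, Equiv.swap_comm i j]
  simp only [h, Finset.sum_add_distrib]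
  rw [two_smul, swapElement]
  congr 1
  exact Finset.sum_comm

/-- Conjugation by `g` maps `(i j)` to `(g i g j)` and permutes the ordered pairs with `i ≠ j`. It
need not preserve `i < j`, which is why twice the element is treated. -/
lemma swapElement_mem_center (r : ℕ) :
    swapElement r ∈ Subalgebra.center ℂ (SymGroupAlg r) := by
  have h : swapElement r = (1 / 2 : ℂ) • ((2 : ℂ) • swapElement r) := by
    rw [smul_smul]; norm_num
  rw [h]
  refine Subalgebra.smul_mem _ ?_ _
  rw [two_smul_swapElement, MonoidAlgebra.mem_center_iff_single]
  intro g
  simp only [Finset.mul_sum, Finset.sum_mul]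
  conv_rhs => rw [← Equiv.sum_comp g]
  refine Finset.sum_congr rfl fun i _ => ?_
  conv_rhs => rw [← Equiv.sum_comp g]
  refine Finset.sum_congr rfl fun j _ => ?_
  by_cases hij : i = j
  · simp [hij]
  · rw [if_neg hij, if_neg fun h => hij (g.injective h), MonoidAlgebra.single_mul_single,
      MonoidAlgebra.single_mul_single, Equiv.swap_apply_apply]
    simp

/-- Transpositions are involutions, so left multiplication by their sum is self-adjoint for the `ℓ²`
inner product of coefficients, and its eigenvalues are real. -/
lemma im_eq_zero_of_swapElement_mul {r : ℕ} {x : SymGroupAlg r} (hx : x ≠ 0) {c : ℂ}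
    (h : swapElement r * x = c • x) : c.im = 0 := by
  have hpair : ∀ i j : Fin r, ∑ g, (starRingEnd ℂ) (x.coeff g) * x.coeff (Equiv.swap i j * g)
      = (starRingEnd ℂ) (∑ g, (starRingEnd ℂ) (x.coeff g) * x.coeff (Equiv.swap i j * g)) := by
    intro i j
    rw [map_sum, ← Equiv.sum_comp (Equiv.mulLeft (Equiv.swap i j))]
    refine Finset.sum_congr rfl fun g _ => ?_
    simp [mul_comm]
  have hs : ∀ g, (swapElement r * x).coeff g = ∑ i : Fin r, ∑ j : Fin r,
      if i < j then x.coeff (Equiv.swap i j * g) else 0 := by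
    intro g
    simp only [swapElement, Finset.sum_mul, MonoidAlgebra.coeff_sum, Finsupp.finsetSum_apply]
    refine Finset.sum_congr rfl fun i _ => Finset.sum_congr rfl fun j _ => ?_
    split_ifs
    · simp
    · simp
  have h1 : ∑ g, (starRingEnd ℂ) (x.coeff g) * (swapElement r * x).coeff g
      = ∑ i : Fin r, ∑ j : Fin r, if i < j then
        ∑ g, (starRingEnd ℂ) (x.coeff g) * x.coeff (Equiv.swap i j * g) else 0 := by
    simp only [hs, Finset.mul_sum]
    rw [Finset.sum_comm]
    refine Finset.sum_congr rfl fun i _ => ?_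
    rw [Finset.sum_comm]
    refine Finset.sum_congr rfl fun j _ => ?_
    split_ifs <;> simp
  have h2 : (∑ g, (starRingEnd ℂ) (x.coeff g) * (swapElement r * x).coeff g).im = 0 := by
    rw [h1, Complex.im_sum]
    refine Finset.sum_eq_zero fun i _ => ?_
    rw [Complex.im_sum]
    refine Finset.sum_eq_zero fun j _ => ?_
    split_ifs
    · exact Complex.conj_eq_iff_im.1 (hpair i j).symm
    · simp
  have h3 : ∑ g, (starRingEnd ℂ) (x.coeff g) * (swapElement r * x).coeff g
      = ((∑ g, Complex.normSq (x.coeff g) : ℝ) : ℂ) * c := by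
    rw [h, Complex.ofReal_sum, Finset.sum_mul]
    refine Finset.sum_congr rfl fun g _ => ?_
    rw [Complex.normSq_eq_conj_mul_self]
    simp
    ring
  rw [h3, Complex.im_ofReal_mul] at h2
  refine (mul_eq_zero.1 h2).resolve_left fun h0 => hx ?_
  ext g
  exact Complex.normSq_eq_zero.1 ((Finset.sum_eq_zero_iff_of_nonneg
    fun g _ => Complex.normSq_nonneg _).1 h0 g (Finset.mem_univ g))

theorem nonempty_symIdempotents (r : ℕ) : Nonempty (SymIdempotents r) := by
  set Z := Subalgebra.center ℂ (SymGroupAlg r) with hZ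
  have : IsArtinianRing Z := IsArtinianRing.of_finite ℂ _
  have := Fintype.ofFinite (MaximalSpectrum Z)
  classical
  let Φ := reducedAlgEquivPi Z
  -- The labelling of the factors by partitions is an arbitrary bijection between sets of equal
  -- size.
  obtain ⟨e⟩ : Nonempty (r.Partition ≃ MaximalSpectrum Z) :=
    Finite.card_eq.1 (card_maximalSpectrum_center r).symm
  let E : r.Partition → SymGroupAlg r := fun lam => (Φ.symm (Pi.single (e lam) 1) : Z)
  have hE : CompleteOrthogonalIdempotents E :=
    (CompleteOrthogonalIdempotents.equiv e).2
      ((CompleteOrthogonalIdempotents.single (fun _ : MaximalSpectrum Z => ℂ)).map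
        (Z.val.comp (Φ.symm : (MaximalSpectrum Z → ℂ) →ₐ[ℂ] Z)).toRingHom)
  -- Coordinates in the product of copies of `ℂ` are coefficients along the `E_λ`; applied to the
  -- sum of transpositions this yields the `c_λ`.
  have hexp : ∀ z : Z, (z : SymGroupAlg r) = ∑ lam, Φ z (e lam) • E lam := by
    intro z
    have h : Φ z = ∑ lam, Φ z (e lam) • Pi.single (e lam) (1 : ℂ) := by
      rw [Equiv.sum_comp e (fun I => Φ z I • Pi.single I (1 : ℂ))]
      ext I
      simp [Finset.sum_apply, Pi.single_apply]
    have h2 : z = Φ.symm (∑ lam, Φ z (e lam) • Pi.single (e lam) (1 : ℂ)) := by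
      rw [← h, AlgEquiv.symm_apply_apply]
    conv_lhs => rw [h2]
    simp [E, map_sum]
  have hE0 : ∀ lam, E lam ≠ 0 := by
    intro lam h
    have h1 : Φ.symm (Pi.single (e lam) 1) = 0 := Subtype.ext h
    rw [map_eq_zero_iff _ Φ.symm.injective, Pi.single_eq_zero_iff] at h1
    exact one_ne_zero h1
  have hs := hexp ⟨swapElement r, swapElement_mem_center r⟩
  set c : r.Partition → ℂ := fun lam => Φ ⟨swapElement r, swapElement_mem_center r⟩ (e lam)
  have hmul : ∀ lam, swapElement r * E lam = c lam • E lam := by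
    intro lam
    change (Subtype.val (⟨swapElement r, swapElement_mem_center r⟩ : Z)) * E lam = _
    rw [hs, Finset.sum_mul, Finset.sum_eq_single lam]
    · rw [smul_mul_assoc, (hE.idem lam).eq]
    · intro lam' _ hne
      rw [smul_mul_assoc, hE.ortho hne, smul_zero]
    · simp
  have hc : ∀ lam, ((c lam).re : ℂ) = c lam := fun lam =>
    Complex.ext rfl (im_eq_zero_of_swapElement_mul (hE0 lam) (hmul lam)).symm
  refine ⟨{ E := E, c := fun lam => (c lam).re, complete := hE, span_eq := ?_, sum_swap := ?_ }⟩
  · apply le_antisymm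
    · rw [Submodule.span_le]
      rintro _ ⟨lam, rfl⟩
      exact (Φ.symm (Pi.single (e lam) 1)).2
    · intro z hz
      have := hexp ⟨z, hz⟩
      change z = _ at this
      rw [this]
      exact Submodule.sum_mem _ fun lam _ =>
        Submodule.smul_mem _ _ (Submodule.subset_span ⟨lam, rfl⟩)
  · simp only [hc]
    exact hs

end GroupAlgebra

/-! ### The inductive formula -/

section InductiveFormula

variable {d r : ℕ}

/-- The action of the group algebra on tensors by permutation of the slots, as an algebra
homomorphism. -/
noncomputable def permActHom (d r : ℕ) : SymGroupAlg r →ₐ[ℂ] Module.End ℂ (CTensor d r) :=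
  MonoidAlgebra.lift ℂ (Module.End ℂ (CTensor d r)) (Equiv.Perm (Fin r))
    { toFun := fun π => LinearMap.funLeft ℂ ℂ fun μ : Fin r → Fin (d + 1) => μ ∘ π
      map_one' := rfl
      map_mul' := fun _ _ => rfl }

lemma permActHom_single (π : Equiv.Perm (Fin r)) (T : CTensor d r) (μ : Fin r → Fin (d + 1)) :
    permActHom d r (MonoidAlgebra.single π 1) T μ = T (μ ∘ π) := by
  simp only [permActHom, MonoidAlgebra.lift_single, one_smul]
  rfl

lemma permAct_eq (x : SymGroupAlg r) (T : CTensor d r) : permAct x T = permActHom d r x T := by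
  rw [permActHom, MonoidAlgebra.lift_apply, Finsupp.sum_fintype _ _ (by simp)]
  ext μ
  simp [permAct]
  rfl

lemma permActHom_swapElement (T : CTensor d r) : permActHom d r (swapElement r) T = swapSum T := by
  ext μ
  simp only [swapElement, map_sum, swapSum, LinearMap.sum_apply, Finset.sum_apply]
  refine Finset.sum_congr rfl fun i _ => Finset.sum_congr rfl fun j _ => ?_
  split_ifs
  · exact permActHom_single _ _ _
  · simp

/-- The same matrix acts in every slot, so renaming the slots in the sum is harmless. -/
lemma slotAct_permAct (M : Matrix (Fin (d + 1)) (Fin (d + 1)) ℝ) (x : SymGroupAlg r)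
    (T : CTensor d r) : slotAct M (permAct x T) = permAct x (slotAct M T) := by
  ext μ
  simp only [slotAct_apply, permAct, Finset.mul_sum]
  rw [Finset.sum_comm]
  refine Finset.sum_congr rfl fun π _ => ?_
  rw [← Equiv.sum_comp (Equiv.arrowCongr π (Equiv.refl (Fin (d + 1))))]
  refine Finset.sum_congr rfl fun α _ => ?_
  rw [← Equiv.prod_comp π]
  have h : (Equiv.arrowCongr π (Equiv.refl (Fin (d + 1)))) α ∘ π = α := by
    ext k
    simp
  rw [h]
  simp
  ring

/-- The proper Lorentz group. -/
def properLorentz (d : ℕ) : Set (Matrix (Fin (d + 1)) (Fin (d + 1)) ℝ) :=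
  {Λ | Λ.transpose * minkowski d * Λ = minkowski d ∧ Λ.det = 1}

lemma restrictedLorentz_subset : restrictedLorentz d ⊆ properLorentz d :=
  fun _ h => ⟨h.1, h.2.1⟩

lemma properLorentz.mul {Λ₁ Λ₂ : Matrix (Fin (d + 1)) (Fin (d + 1)) ℝ}
    (h₁ : Λ₁ ∈ properLorentz d) (h₂ : Λ₂ ∈ properLorentz d) : Λ₁ * Λ₂ ∈ properLorentz d := by
  refine ⟨?_, by rw [Matrix.det_mul, h₁.2, h₂.2, one_mul]⟩
  calc (Λ₁ * Λ₂).transpose * minkowski d * (Λ₁ * Λ₂)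
      = Λ₂.transpose * (Λ₁.transpose * minkowski d * Λ₁) * Λ₂ := by
        rw [Matrix.transpose_mul]
        simp only [mul_assoc]
    _ = minkowski d := by rw [h₁.1, h₂.1]

lemma properLorentz.isUnit_det {Λ : Matrix (Fin (d + 1)) (Fin (d + 1)) ℝ}
    (h : Λ ∈ properLorentz d) : IsUnit Λ.det := by
  rw [h.2]
  exact isUnit_one

lemma properLorentz.det_inv {Λ : Matrix (Fin (d + 1)) (Fin (d + 1)) ℝ}
    (h : Λ ∈ properLorentz d) : Λ⁻¹.det = 1 := by
  rw [Matrix.det_nonsing_inv, h.2, Ring.inverse_one]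

lemma properLorentz.inv_transpose_mul {Λ : Matrix (Fin (d + 1)) (Fin (d + 1)) ℝ}
    (h : Λ ∈ properLorentz d) : Λ⁻¹.transpose * minkowski d * Λ⁻¹ = minkowski d := by
  have hu := properLorentz.isUnit_det h
  conv_lhs => rw [← h.1]
  have h1 : Λ⁻¹.transpose * Λ.transpose = 1 := by
    rw [← Matrix.transpose_mul, Matrix.mul_nonsing_inv _ hu, Matrix.transpose_one]
  rw [← mul_assoc, ← mul_assoc, h1, one_mul, mul_assoc, Matrix.mul_nonsing_inv _ hu, mul_one]

/-- Since `η² = 1`, the relation for `Λ⁻¹` exhibits a left inverse of it, which is also a right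
inverse; this passes from the metric with lower indices to that with upper indices. -/
lemma properLorentz.inv_mul_transpose {Λ : Matrix (Fin (d + 1)) (Fin (d + 1)) ℝ}
    (h : Λ ∈ properLorentz d) : Λ⁻¹ * minkowski d * Λ⁻¹.transpose = minkowski d := by
  have h1 : (minkowski d * Λ⁻¹.transpose * minkowski d) * Λ⁻¹ = 1 := by
    rw [mul_assoc (minkowski d), mul_assoc, properLorentz.inv_transpose_mul h,
      minkowski_mul_self]
  have h2 := mul_eq_one_comm.1 h1
  calc Λ⁻¹ * minkowski d * Λ⁻¹.transpose
      = Λ⁻¹ * minkowski d * Λ⁻¹.transpose * (minkowski d * minkowski d) := by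
        rw [minkowski_mul_self, mul_one]
    _ = (Λ⁻¹ * (minkowski d * Λ⁻¹.transpose * minkowski d)) * minkowski d := by
        simp only [mul_assoc]
    _ = minkowski d := by rw [h2, one_mul]

/-- The space of Lorentz-invariant tensors. -/
noncomputable def lorentzInvariants (d r : ℕ) : Submodule ℂ (CTensor d r) where
  carrier := {T | IsLorentzInvariant T}
  add_mem' := fun {S T} hS hT Λ hΛ => by
    have h1 := hS Λ hΛ
    have h2 := hT Λ hΛ
    rw [lorentzAct_eq_slotAct] at *
    rw [map_add, h1, h2]
  zero_mem' := fun Λ _ => by rw [lorentzAct_eq_slotAct, map_zero]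
  smul_mem' := fun c T hT Λ hΛ => by
    have h1 := hT Λ hΛ
    rw [lorentzAct_eq_slotAct] at *
    rw [map_smul, h1]

lemma mem_lorentzInvariants {T : CTensor d r} :
    T ∈ lorentzInvariants d r ↔ IsLorentzInvariant T := Iff.rfl

/-- The map `X ↦ ∑_{c̃_λ ≠ 0} (1 / c̃_λ) E_λ X`, as a linear map. -/
noncomputable def SymIdempotents.solveHom (S : SymIdempotents r) (d : ℕ) :
    CTensor d r →ₗ[ℂ] CTensor d r :=
  ∑ lam : r.Partition, if S.cTilde d lam ≠ 0 then
    ((1 / S.cTilde d lam : ℝ) : ℂ) • permActHom d r (S.E lam) else 0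

lemma SymIdempotents.solve_eq (S : SymIdempotents r) (X : CTensor d r) :
    S.solve X = S.solveHom d X := by
  rw [SymIdempotents.solve, SymIdempotents.solveHom, LinearMap.sum_apply]
  refine Finset.sum_congr rfl fun lam _ => ?_
  split_ifs
  · rw [permAct_eq]
    rfl
  · rfl

lemma SymIdempotents.slotAct_solveHom (S : SymIdempotents r)
    (M : Matrix (Fin (d + 1)) (Fin (d + 1)) ℝ) (X : CTensor d r) :
    slotAct M (S.solveHom d X) = S.solveHom d (slotAct M X) := by
  simp only [SymIdempotents.solveHom, LinearMap.sum_apply, map_sum]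
  refine Finset.sum_congr rfl fun lam _ => ?_
  split_ifs
  · rw [LinearMap.smul_apply, LinearMap.smul_apply, map_smul, ← permAct_eq, ← permAct_eq,
      slotAct_permAct]
  · simp

lemma SymIdempotents.solveHom_mem_lorentzInvariants (S : SymIdempotents r) {X : CTensor d r}
    (hX : X ∈ lorentzInvariants d r) : S.solveHom d X ∈ lorentzInvariants d r := by
  intro Λ hΛ
  have h := hX Λ hΛ
  rw [lorentzAct_eq_slotAct] at *
  rw [S.slotAct_solveHom, h]

lemma SymIdempotents.swapElement_mul (S : SymIdempotents r) (lam : r.Partition) :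
    swapElement r * S.E lam = (S.c lam : ℂ) • S.E lam := by
  rw [swapElement, S.sum_swap, Finset.sum_mul, Finset.sum_eq_single lam]
  · rw [smul_mul_assoc, (S.complete.idem lam).eq]
  · intro lam' _ hne
    rw [smul_mul_assoc, S.complete.ortho hne, smul_zero]
  · simp

/-- The operator `2 r (D - 1) + 4 ∑ (i j)` acts on the range of `E_λ` as `c̃_λ`. -/
lemma SymIdempotents.casimir_permActHom (S : SymIdempotents r) (a : CTensor d r)
    (lam : r.Partition) :
    (2 * r * d : ℂ) • permActHom d r (S.E lam) a + (4 : ℂ) • swapSum (permActHom d r (S.E lam) a)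
      = (S.cTilde d lam : ℂ) • permActHom d r (S.E lam) a := by
  rw [← permActHom_swapElement, ← Module.End.mul_apply, ← map_mul, S.swapElement_mul, map_smul,
    LinearMap.smul_apply, smul_smul, ← add_smul, SymIdempotents.cTilde]
  push_cast
  rfl

/-- The sum of transpositions is central, so it may be moved past `E_λ`. -/
lemma SymIdempotents.permActHom_casimir (S : SymIdempotents r) (a : CTensor d r)
    (lam : r.Partition) :
    permActHom d r (S.E lam) ((2 * r * d : ℂ) • a + (4 : ℂ) • swapSum a)
      = (S.cTilde d lam : ℂ) • permActHom d r (S.E lam) a := by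
  rw [← S.casimir_permActHom, map_add, map_smul, map_smul, ← permActHom_swapElement,
    ← permActHom_swapElement, ← Module.End.mul_apply, ← Module.End.mul_apply, ← map_mul,
    ← map_mul, Subalgebra.mem_center_iff.1 (swapElement_mem_center r)]

/-- Decompose `a` along the `E_λ`. Division by `c̃_λ` recovers each component with `c̃_λ ≠ 0`; what
remains satisfies the hypothesis of `slotAct_eq_of_casimir_eq_zero`. -/
lemma SymIdempotents.sub_solveHom_casimir (S : SymIdempotents r) (a : CTensor d r) :
    a - S.solveHom d ((2 * r * d : ℂ) • a + (4 : ℂ) • swapSum a)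
      ∈ lorentzInvariants d r := by
  have h : a - S.solveHom d ((2 * r * d : ℂ) • a + (4 : ℂ) • swapSum a)
      = ∑ lam : r.Partition, if S.cTilde d lam = 0 then permActHom d r (S.E lam) a else 0 := by
    have h1 : a = ∑ lam, permActHom d r (S.E lam) a := by
      rw [← LinearMap.sum_apply, ← map_sum, S.complete.complete, map_one, Module.End.one_apply]
    conv_lhs => lhs; rw [h1]
    rw [SymIdempotents.solveHom, LinearMap.sum_apply, ← Finset.sum_sub_distrib]
    refine Finset.sum_congr rfl fun lam _ => ?_
    by_cases hlam : S.cTilde d lam = 0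
    · simp [hlam]
    · rw [if_pos hlam, if_neg hlam, LinearMap.smul_apply, S.permActHom_casimir, smul_smul,
        ← Complex.ofReal_mul, one_div_mul_cancel hlam, Complex.ofReal_one, one_smul, sub_self]
  rw [h]
  refine Submodule.sum_mem _ fun lam _ => ?_
  split_ifs with hlam
  · intro Λ hΛ
    rw [lorentzAct_eq_slotAct]
    refine slotAct_eq_of_casimir_eq_zero ?_ (properLorentz.det_inv (restrictedLorentz_subset hΛ))
    rw [S.casimir_permActHom, hlam, Complex.ofReal_zero, zero_smul]
  · exact Submodule.zero_mem _

/-- The insertion of the metric in two slots, as a linear map. -/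
noncomputable def metricMulHom (j : Fin (r + 2)) (i : Fin (r + 1)) :
    CTensor d r →ₗ[ℂ] CTensor d (r + 2) where
  toFun := metricMulAt j i
  map_add' S T := by
    ext μ
    simp [metricMulAt, mul_add]
  map_smul' c T := by
    ext μ
    simp [metricMulAt, mul_left_comm]

/-- The trace over two slots, as a linear map. -/
noncomputable def traceHom (j : Fin (r + 2)) (i : Fin (r + 1)) :
    CTensor d (r + 2) →ₗ[ℂ] CTensor d r where
  toFun := traceAt j i
  map_add' S T := by
    ext μ
    simp [traceAt, mul_add, Finset.sum_add_distrib]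
  map_smul' c T := by
    ext μ
    simp only [traceAt, Pi.smul_apply, smul_eq_mul, RingHom.id_apply, Finset.mul_sum]
    exact Finset.sum_congr rfl fun _ _ => Finset.sum_congr rfl fun _ _ => by ring

lemma metricSum_sub (S T : Fin (r + 2) → Fin (r + 1) → CTensor d r) :
    metricSum S - metricSum T = metricSum fun j i => S j i - T j i := by
  simp only [metricSum, ← Finset.sum_sub_distrib]
  refine Finset.sum_congr rfl fun j _ => Finset.sum_congr rfl fun i _ => ?_
  split_ifs
  · exact ((metricMulHom j i).map_sub _ _).symm
  · simp

lemma metricSum_mem_lorentzInvariants {S : Fin (r + 2) → Fin (r + 1) → CTensor d r}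
    (hS : ∀ j i, S j i ∈ lorentzInvariants d r) : metricSum S ∈ lorentzInvariants d (r + 2) := by
  refine Submodule.sum_mem _ fun j _ => Submodule.sum_mem _ fun i _ => ?_
  split_ifs with hij
  · intro Λ hΛ
    have h := hS j i Λ hΛ
    rw [lorentzAct_eq_slotAct] at *
    rw [metricMulAt_slotAct (properLorentz.inv_transpose_mul (restrictedLorentz_subset hΛ)) j i hij, h]
  · exact Submodule.zero_mem _

lemma traceAt_mem_lorentzInvariants {T : CTensor d (r + 2)}
    (hT : T ∈ lorentzInvariants d (r + 2)) (j : Fin (r + 2)) (i : Fin (r + 1)) :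
    traceAt j i T ∈ lorentzInvariants d r := by
  intro Λ hΛ
  have h := hT Λ hΛ
  rw [lorentzAct_eq_slotAct] at *
  rw [← traceAt_slotAct (properLorentz.inv_mul_transpose (restrictedLorentz_subset hΛ)), h]

lemma metricTraceSum_sub (S T : CTensor d r) :
    metricTraceSum r S - metricTraceSum r T = metricTraceSum r (S - T) := by
  match r with
  | 0 => simp [metricTraceSum]
  | 1 => simp [metricTraceSum]
  | r + 2 =>
    simp only [metricTraceSum, metricSum_sub]
    congr 1
    ext1 j
    ext1 i
    exact ((traceHom j i).map_sub S T).symm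

lemma metricTraceSum_mem_lorentzInvariants {T : CTensor d r} (hT : T ∈ lorentzInvariants d r) :
    metricTraceSum r T ∈ lorentzInvariants d r := by
  match r with
  | 0 => exact Submodule.zero_mem _
  | 1 => exact Submodule.zero_mem _
  | r + 2 => exact metricSum_mem_lorentzInvariants fun j i => traceAt_mem_lorentzInvariants hT j i

/-- The formula for the solution, for a tensor that agrees up to invariant tensors with one whose
images under the generators are `B`. -/
theorem sub_solve_mem_lorentzInvariants (S : SymIdempotents r)
    {B : Fin (d + 1) → Fin (d + 1) → CTensor d r} {a b : CTensor d r}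
    (hB : ∀ κ ρ, B κ ρ = genAct (lorentzGen κ ρ) b) (hab : a - b ∈ lorentzInvariants d r) :
    a - S.solve (-genContract B + (4 : ℂ) • metricTraceSum r a) ∈ lorentzInvariants d r := by
  have hB' : B = fun κ ρ => genAct (lorentzGen κ ρ) b := by
    ext1 κ
    ext1 ρ
    exact hB κ ρ
  -- The Casimir identity applies to `b`, because `B` is built from `b`. Replacing `b` by `a` in the
  -- traces costs only an invariant tensor, which the solving map preserves.
  have h1 : -genContract B + (4 : ℂ) • metricTraceSum r a
      = ((2 * r * d : ℂ) • b + (4 : ℂ) • swapSum b) + (4 : ℂ) • metricTraceSum r (a - b) := by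
    rw [← neg_genContract_add_metricTraceSum, ← hB', ← metricTraceSum_sub]
    module
  rw [h1, S.solve_eq, map_add]
  have h2 := S.sub_solveHom_casimir b
  have h3 := S.solveHom_mem_lorentzInvariants (Submodule.smul_mem _ (4 : ℂ)
    (metricTraceSum_mem_lorentzInvariants hab))
  have h4 := Submodule.sub_mem _ (Submodule.add_mem _ hab h2) h3
  convert h4 using 1
  abel

/-- Since traces commute with the generators, `tr_{ij} b` stands to `tr_{ij} B` as `b` to `B`, and
the induction applies to it. The errors are invariant, and inserting metrics and solving keep them
so. -/
theorem sub_inductiveSol_mem_lorentzInvariants (S : ∀ r, SymIdempotents r) :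
    ∀ (r : ℕ) (B : Fin (d + 1) → Fin (d + 1) → CTensor d r) (b : CTensor d r),
      (∀ κ ρ, B κ ρ = genAct (lorentzGen κ ρ) b) →
        b - inductiveSol S r B ∈ lorentzInvariants d r
  -- In ranks `0` and `1` there is no pair of slots, so the trace term is absent.
  | 0, B, b, hB => by
    have h := sub_solve_mem_lorentzInvariants (S 0) hB (a := b) (by simp)
    simpa [inductiveSol, metricTraceSum] using h
  | 1, B, b, hB => by
    have h := sub_solve_mem_lorentzInvariants (S 1) hB (a := b) (by simp)
    simpa [inductiveSol, metricTraceSum] using h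
  | r + 2, B, b, hB => by
    have h := sub_solve_mem_lorentzInvariants (S (r + 2)) hB (a := b) (by simp)
    have ih : ∀ j i, traceAt j i b - inductiveSol S r (fun κ ρ => traceAt j i (B κ ρ))
        ∈ lorentzInvariants d r := fun j i =>
      sub_inductiveSol_mem_lorentzInvariants S r _ _ fun κ ρ => by
        rw [hB, traceAt_genAct (lorentzGen_skew κ ρ)]
    have h2 := (S (r + 2)).solveHom_mem_lorentzInvariants (Submodule.smul_mem _ (4 : ℂ)
      (metricSum_mem_lorentzInvariants ih))
    rw [← metricSum_sub, smul_sub] at h2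
    have h3 := Submodule.add_mem _ h h2
    rw [SymIdempotents.solve_eq] at h3
    rw [inductiveSol, SymIdempotents.solve_eq]
    convert h3 using 1
    rw [map_add, map_add, map_sub, metricTraceSum]
    abel

end InductiveFormula

/-! ### Boundary values of holomorphic functions of `σ + iε` -/

section BoundaryValues

/-- Holomorphic functions on the upper half-plane of at most polynomial growth at the real axis. -/
def ModerateGrowth (F : ℂ → ℂ) : Prop :=
  DifferentiableOn ℂ F {z | 0 < z.im} ∧
    ∃ N : ℕ, ∀ R : ℝ, ∃ C : ℝ, 0 ≤ C ∧
      ∀ z : ℂ, 0 < z.im → ‖z‖ ≤ R → ‖F z‖ ≤ C * (z.im)⁻¹ ^ N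

lemma isOpen_upperHalfSpace : IsOpen {z : ℂ | 0 < z.im} :=
  isOpen_lt continuous_const Complex.continuous_im

lemma ModerateGrowth.mul {F G : ℂ → ℂ} (hF : ModerateGrowth F) (hG : ModerateGrowth G) :
    ModerateGrowth fun z => F z * G z := by
  obtain ⟨hF0, N, hF⟩ := hF
  obtain ⟨hG0, M, hG⟩ := hG
  refine ⟨hF0.mul hG0, N + M, fun R => ?_⟩
  obtain ⟨C, hC, hFC⟩ := hF R
  obtain ⟨C', hC', hGC⟩ := hG R
  refine ⟨C * C', mul_nonneg hC hC', fun z hz hzR => ?_⟩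
  rw [norm_mul, pow_add]
  have hi : 0 ≤ (z.im)⁻¹ := (inv_pos.2 hz).le
  calc ‖F z‖ * ‖G z‖ ≤ (C * (z.im)⁻¹ ^ N) * (C' * (z.im)⁻¹ ^ M) := by
        gcongr
        · exact hFC z hz hzR
        · exact hGC z hz hzR
    _ = _ := by ring

/-- Cauchy's estimate on the disc of radius `Im z / 2` costs one more power of `1 / Im z`. -/
lemma ModerateGrowth.deriv {F : ℂ → ℂ} (hF : ModerateGrowth F) : ModerateGrowth (deriv F) := by
  obtain ⟨hF0, N, hF⟩ := hF
  refine ⟨hF0.deriv isOpen_upperHalfSpace, N + 1, fun R => ?_⟩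
  -- The disc stays in the half-plane `Im w ≥ Im z / 2` and in the ball of radius `2R`, because `Im
  -- z ≤ ‖z‖ ≤ R`.
  obtain ⟨C, hC, hFC⟩ := hF (2 * R)
  refine ⟨C * 2 ^ (N + 1), by positivity, fun z hz hzR => ?_⟩
  have him : z.im ≤ ‖z‖ := (le_abs_self _).trans (Complex.abs_im_le_norm z)
  have hball : ∀ w ∈ Metric.closedBall z (z.im / 2), z.im / 2 ≤ w.im ∧ ‖w‖ ≤ 2 * R := by
    intro w hw
    rw [Metric.mem_closedBall, dist_eq_norm] at hw
    have h1 := (Complex.abs_im_le_norm (w - z)).trans hw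
    rw [Complex.sub_im, abs_le] at h1
    have h2 := norm_le_norm_add_norm_sub' w z
    constructor <;> linarith
  have hd : DiffContOnCl ℂ F (Metric.ball z (z.im / 2)) := by
    refine DifferentiableOn.diffContOnCl (hF0.mono fun w hw => ?_)
    have := (hball w (Metric.closure_ball_subset_closedBall hw)).1
    exact lt_of_lt_of_le (by linarith) this
  have hC2 : ∀ w ∈ Metric.sphere z (z.im / 2), ‖F w‖ ≤ C * (z.im / 2)⁻¹ ^ N := by
    intro w hw
    obtain ⟨h1, h2⟩ := hball w (Metric.sphere_subset_closedBall hw)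
    have h3 : 0 < z.im / 2 := by linarith
    refine (hFC w (h3.trans_le h1) h2).trans ?_
    gcongr
    exact inv_nonneg.2 (h3.trans_le h1).le
  refine (Complex.norm_deriv_le_of_forall_mem_sphere_norm_le (by linarith) hd hC2).trans ?_
  apply le_of_eq
  rw [div_eq_mul_inv _ (z.im / 2), inv_div, div_eq_mul_inv, mul_pow]
  ring

lemma moderateGrowth_const (c : ℂ) : ModerateGrowth fun _ => c :=
  ⟨differentiableOn_const c, 0, fun _ => ⟨‖c‖, norm_nonneg c, fun z _ _ => by simp⟩⟩

lemma mem_slitPlane_of_im_pos {z : ℂ} (hz : 0 < z.im) : z ∈ Complex.slitPlane :=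
  Or.inr hz.ne'

lemma moderateGrowth_cpow (s : ℝ) : ModerateGrowth fun z => z ^ (-(s : ℂ)) := by
  refine ⟨fun z hz => ?_, ⌈s⌉₊, fun R => ⟨|R| ^ (⌈s⌉₊ - s), by positivity, fun z hz hzR => ?_⟩⟩
  · exact (differentiableAt_id.cpow_const (mem_slitPlane_of_im_pos hz)).differentiableWithinAt
  · have him : z.im ≤ ‖z‖ := (le_abs_self _).trans (Complex.abs_im_le_norm z)
    have hz0 : 0 < ‖z‖ := hz.trans_le him
    rw [← Complex.ofReal_neg, Complex.norm_cpow_real]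
    -- The exponent is rounded up to the natural number `⌈s⌉₊`; the remaining power `⌈s⌉₊ - s` is
    -- non-negative, hence bounded on bounded sets.
    have h1 : ‖z‖ ^ (-s) = ‖z‖ ^ (⌈s⌉₊ - s) * (‖z‖⁻¹) ^ ⌈s⌉₊ := by
      rw [← Real.rpow_natCast, Real.inv_rpow hz0.le, ← Real.rpow_neg hz0.le,
        ← Real.rpow_add hz0]
      ring_nf
    rw [h1]
    have h2 : 0 ≤ (⌈s⌉₊ : ℝ) - s := sub_nonneg.2 (Nat.le_ceil s)
    gcongr
    exact hzR.trans (le_abs_self R)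

lemma abs_log_le_add_inv {x : ℝ} (hx : 0 < x) : |Real.log x| ≤ x + x⁻¹ := by
  have h1 := Real.log_le_sub_one_of_pos hx
  have h2 := Real.log_le_sub_one_of_pos (inv_pos.2 hx)
  rw [Real.log_inv] at h2
  have h3 := inv_pos.2 hx
  rw [abs_le]
  constructor <;> linarith

lemma moderateGrowth_log {l : ℝ} (hl : 0 < l) :
    ModerateGrowth fun z => Complex.log (z / (l : ℂ) ^ 2) := by
  have hdiv : ∀ z : ℂ, z / (l : ℂ) ^ 2 = ((l ^ 2)⁻¹ : ℝ) * z := fun z => by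
    push_cast
    rw [div_eq_inv_mul]
  have hl2 : 0 < (l ^ 2)⁻¹ := by positivity
  refine ⟨fun z hz => ?_, 1, fun R => ⟨(l ^ 2)⁻¹ * R ^ 2 + l ^ 2 + Real.pi * |R|,
    by positivity, fun z hz hzR => ?_⟩⟩
  · refine DifferentiableAt.differentiableWithinAt ?_
    refine DifferentiableAt.clog (by fun_prop) (mem_slitPlane_of_im_pos ?_)
    rw [hdiv, Complex.im_ofReal_mul]
    exact mul_pos hl2 hz
  · have him : z.im ≤ ‖z‖ := (le_abs_self _).trans (Complex.abs_im_le_norm z)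
    have hz0 : 0 < ‖z‖ := hz.trans_le him
    have hR : 0 < R := hz0.trans_le hzR
    set w := z / (l : ℂ) ^ 2 with hw
    have hwn : ‖w‖ = (l ^ 2)⁻¹ * ‖z‖ := by
      rw [hw, hdiv, norm_mul, Complex.norm_real, Real.norm_of_nonneg hl2.le]
    have hw0 : 0 < ‖w‖ := by rw [hwn]; positivity
    have h1 : ‖Complex.log w‖ ≤ |Real.log ‖w‖| + Real.pi := by
      rw [Complex.log]
      refine (norm_add_le _ _).trans (add_le_add ?_ ?_)
      · rw [Complex.norm_real, Real.norm_eq_abs]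
      · rw [norm_mul, Complex.norm_I, mul_one, Complex.norm_real, Real.norm_eq_abs]
        exact Complex.abs_arg_le_pi w
    have h2 := abs_log_le_add_inv hw0
    rw [hwn, mul_inv, inv_inv] at h2
    have h3 : ‖z‖⁻¹ ≤ (z.im)⁻¹ := by gcongr
    -- This factor at least `1` absorbs the terms that carry no power of `1 / Im z`.
    have h4 : 1 ≤ R * (z.im)⁻¹ := by
      rw [← div_eq_mul_inv, one_le_div hz]
      exact him.trans hzR
    rw [pow_one, abs_of_pos hR]
    calc ‖Complex.log w‖ ≤ (l ^ 2)⁻¹ * ‖z‖ + l ^ 2 * ‖z‖⁻¹ + Real.pi := by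
          rw [hwn] at h1
          linarith
      _ ≤ (l ^ 2)⁻¹ * (R * (R * (z.im)⁻¹)) + l ^ 2 * (z.im)⁻¹ + Real.pi * (R * (z.im)⁻¹) := by
          have h5 : ‖z‖ ≤ R * (R * (z.im)⁻¹) := by nlinarith
          have h6 : Real.pi ≤ Real.pi * (R * (z.im)⁻¹) := by nlinarith [Real.pi_pos]
          gcongr
      _ = _ := by ring

/-- A bound on the increments of a function from a power bound on its derivative. -/
lemma norm_sub_le_of_deriv_le_rpow {f f' : ℝ → ℂ} {s C : ℝ} (hs : s ≠ 1)
    (hf : ∀ x, 0 < x → HasDerivAt f (f' x) x)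
    (hb : ∀ x, 0 < x → x ≤ 1 → ‖f' x‖ ≤ C * x ^ (-s)) {a b : ℝ} (ha : 0 < a) (hab : a ≤ b)
    (hb1 : b ≤ 1) : ‖f b - f a‖ ≤ C / (1 - s) * (b ^ (1 - s) - a ^ (1 - s)) := by
  have hs' : 1 - s ≠ 0 := sub_ne_zero.2 hs.symm
  have hB : ∀ x, 0 < x → HasDerivAt (fun x : ℝ => C / (1 - s) * (x ^ (1 - s) - a ^ (1 - s)))
      (C * x ^ (-s)) x := by
    intro x hx
    have h := ((Real.hasDerivAt_rpow_const (p := 1 - s) (Or.inl hx.ne')).sub_const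
      (a ^ (1 - s))).const_mul (C / (1 - s))
    refine h.congr_deriv ?_
    rw [show 1 - s - 1 = -s by ring]
    field_simp
  have key := image_norm_le_of_norm_deriv_right_le_deriv_boundary' (a := a) (b := b)
    (f := fun x => f x - f a) (f' := f')
    (fun x hx => ((hf x (ha.trans_le hx.1)).sub_const _).continuousAt.continuousWithinAt)
    (fun x hx => ((hf x (ha.trans_le hx.1)).sub_const _).hasDerivWithinAt)
    (B := fun x : ℝ => C / (1 - s) * (x ^ (1 - s) - a ^ (1 - s))) (B' := fun x => C * x ^ (-s))
    (by simp) (fun x hx => (hB x (ha.trans_le hx.1)).continuousAt.continuousWithinAt)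
    (fun x hx => (hB x (ha.trans_le hx.1)).hasDerivWithinAt)
    (fun x hx => hb x (ha.trans_le hx.1) (hx.2.le.trans hb1))
  exact key ⟨hab, le_rfl⟩

/-- A family of functions on `(0, ∞)`, closed under derivatives and of polynomial growth at `0` of
uniform order, has limits at `0`. -/
lemma exists_tendsto_of_deriv_closed {X : Type*} (I : X → ℝ → ℂ) (T : X → X) (c : ℂ)
    (hI : ∀ g x, 0 < x → HasDerivAt (I g) (c * I (T g) x) x) (N : ℕ)
    (hN : ∀ g, ∃ C, 0 ≤ C ∧ ∀ x, 0 < x → x ≤ 1 → ‖I g x‖ ≤ C * (x⁻¹) ^ N) (g : X) :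
    ∃ L, Tendsto (I g) (𝓝[>] 0) (𝓝 L) := by
  -- Each integration lowers the order of growth by one. Half-integer exponents avoid `x⁻¹`, hence
  -- logarithms.
  have hbound : ∀ n : ℕ, n ≤ N → ∀ g, ∃ C, 0 ≤ C ∧ ∀ x, 0 < x → x ≤ 1 →
      ‖I g x‖ ≤ C * x ^ (-((n : ℝ) + 1 / 2)) := by
    intro n hn
    induction hn using Nat.decreasingInduction with
    | self =>
      intro g
      obtain ⟨C, hC, h⟩ := hN g
      refine ⟨C, hC, fun x hx hx1 => (h x hx hx1).trans ?_⟩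
      gcongr
      rw [← Real.rpow_natCast, Real.inv_rpow hx.le, ← Real.rpow_neg hx.le]
      exact Real.rpow_le_rpow_of_exponent_ge hx hx1 (by linarith)
    | of_succ n _ ih =>
      intro g
      obtain ⟨C, hC, h⟩ := ih (T g)
      have hs : ((n + 1 : ℕ) : ℝ) + 1 / 2 ≠ 1 := by
        push_cast
        intro h
        have := n.cast_nonneg (α := ℝ)
        linarith
      have h1 := fun {a b : ℝ} => norm_sub_le_of_deriv_le_rpow (f := I g) (s := ((n + 1 : ℕ) : ℝ) + 1 / 2)
        (C := ‖c‖ * C) hs (hI g) (fun x hx hx1 => by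
          rw [norm_mul, mul_assoc]
          exact mul_le_mul_of_nonneg_left (h x hx hx1) (norm_nonneg c)) (a := a) (b := b)
      have hn0 : (0 : ℝ) < (n : ℝ) + 1 / 2 := by positivity
      refine ⟨‖I g 1‖ + ‖c‖ * C / ((n : ℝ) + 1 / 2), by positivity, fun x hx hx1 => ?_⟩
      have h2 := h1 hx hx1 le_rfl
      have e1 : 1 - (((n + 1 : ℕ) : ℝ) + 1 / 2) = -((n : ℝ) + 1 / 2) := by push_cast; ring
      rw [e1, Real.one_rpow] at h2
      set p := x ^ (-((n : ℝ) + 1 / 2)) with hp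
      have hp1 : 1 ≤ p := Real.one_le_rpow_of_pos_of_le_one_of_nonpos hx hx1 (by linarith)
      have h3 : ‖I g x‖ ≤ ‖I g 1‖ + ‖I g 1 - I g x‖ := by
        have := norm_sub_norm_le (I g x) (I g 1)
        rw [norm_sub_rev] at this
        linarith
      have h4 : ‖c‖ * C / -((n : ℝ) + 1 / 2) * (1 - p)
          = ‖c‖ * C / ((n : ℝ) + 1 / 2) * p - ‖c‖ * C / ((n : ℝ) + 1 / 2) := by
        rw [div_neg]; ring
      rw [h4] at h2
      have h5 : 0 ≤ ‖c‖ * C / ((n : ℝ) + 1 / 2) := by positivity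
      have h6 : ‖I g 1‖ ≤ ‖I g 1‖ * p := le_mul_of_one_le_right (norm_nonneg _) hp1
      rw [add_mul]
      linarith
  -- The derivative is now `O(x^{-1/2})`, which is integrable at `0`, so the increments satisfy the
  -- Cauchy criterion.
  obtain ⟨C, hC, h⟩ := hbound 0 (Nat.zero_le N) (T g)
  have h1 := fun {a b : ℝ} => norm_sub_le_of_deriv_le_rpow (f := I g) (s := 1 / 2)
    (C := ‖c‖ * C) (by norm_num) (hI g) (fun x hx hx1 => by
      rw [norm_mul, mul_assoc]
      have := h x hx hx1
      rw [Nat.cast_zero, zero_add] at this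
      exact mul_le_mul_of_nonneg_left this (norm_nonneg c)) (a := a) (b := b)
  have h2 : Tendsto (fun x : ℝ => ‖c‖ * C / (1 - 1 / 2) * x ^ (1 - 1 / 2 : ℝ)) (𝓝 0) (𝓝 0) := by
    have : ContinuousAt (fun x : ℝ => ‖c‖ * C / (1 - 1 / 2) * x ^ (1 - 1 / 2 : ℝ)) 0 :=
      continuousAt_const.mul (Real.continuousAt_rpow_const _ _ (Or.inr (by norm_num)))
    have h0 := this.tendsto
    rwa [Real.zero_rpow (by norm_num), mul_zero] at h0
  rw [← cauchy_map_iff_exists_tendsto, Metric.cauchy_iff]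
  refine ⟨inferInstance, fun e he => ?_⟩
  have h3 := (h2.eventually (gt_mem_nhds he)).filter_mono (nhdsWithin_le_nhds (s := Set.Ioi 0))
  have h4 : ∀ᶠ x : ℝ in 𝓝[>] 0, x ≤ 1 :=
    nhdsWithin_le_nhds (Iic_mem_nhds zero_lt_one)
  refine ⟨I g '' {x | 0 < x ∧ x ≤ 1 ∧ ‖c‖ * C / (1 - 1 / 2) * x ^ (1 - 1 / 2 : ℝ) < e},
    image_mem_map ?_, ?_⟩
  · filter_upwards [self_mem_nhdsWithin, h3, h4] with x hx hx3 hx4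
    exact ⟨hx, hx4, hx3⟩
  · have hle : ∀ a b : ℝ, 0 < a → a ≤ b → b ≤ 1 →
        ‖c‖ * C / (1 - 1 / 2) * b ^ (1 - 1 / 2 : ℝ) < e → ‖I g b - I g a‖ < e := by
      intro a b ha hab hb hbe
      refine (h1 ha hab hb).trans_lt (lt_of_le_of_lt ?_ hbe)
      have : 0 ≤ a ^ (1 - 1 / 2 : ℝ) := Real.rpow_nonneg ha.le _
      have h0 : 0 ≤ ‖c‖ * C / (1 - 1 / 2) := by
        have := norm_nonneg c
        norm_num
        positivity
      nlinarith
    rintro _ ⟨a, ⟨ha, ha1, hae⟩, rfl⟩ _ ⟨b, ⟨hb, hb1, hbe⟩, rfl⟩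
    rw [dist_eq_norm]
    rcases le_total a b with hab | hab
    · rw [norm_sub_rev]
      exact hle a b ha hab hb1 hbe
    · exact hle b a hb hab ha1 hae

end BoundaryValues

/-! ### Limits of oscillatory integrals away from the origin -/

section LightCone

variable {d : ℕ}

/-- The diagonal entries of the Minkowski metric. -/
def metricSign (μ : Fin (d + 1)) : ℝ := if μ = 0 then -1 else 1

lemma metricSign_mul_self (μ : Fin (d + 1)) : metricSign μ * metricSign μ = 1 := by
  unfold metricSign
  split_ifs <;> norm_num

lemma sqDist_eq (y : Spacetime d) : sqDist y = ∑ μ, metricSign μ * y μ ^ 2 := by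
  simp only [sqDist, minkowski_apply, ite_mul, zero_mul, Finset.sum_ite_eq, Finset.mem_univ,
    if_true, metricSign]
  refine Finset.sum_congr rfl fun μ _ => ?_
  split_ifs <;> ring

lemma hasFDerivAt_sqDist (y : Spacetime d) :
    HasFDerivAt sqDist (∑ μ, (2 * metricSign μ * y μ) •
      (ContinuousLinearMap.proj μ : Spacetime d →L[ℝ] ℝ)) y := by
  have h : (sqDist : Spacetime d → ℝ) = fun y => ∑ μ, metricSign μ * y μ ^ 2 := by
    ext1 y
    exact sqDist_eq y
  rw [h]
  refine HasFDerivAt.fun_sum fun μ _ => ?_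
  have h1 : HasFDerivAt (fun y : Spacetime d => y μ)
      (ContinuousLinearMap.proj μ : Spacetime d →L[ℝ] ℝ) y := hasFDerivAt_apply μ y
  refine ((h1.pow 2).const_mul (metricSign μ)).congr_fderiv ?_
  rw [smul_smul]
  congr 1
  ring

lemma contDiff_sqDist : ContDiff ℝ ∞ (sqDist : Spacetime d → ℝ) := by
  have h : (sqDist : Spacetime d → ℝ) = fun y => ∑ μ, metricSign μ * y μ ^ 2 := by
    ext1 y
    exact sqDist_eq y
  rw [h]
  fun_prop

/-- The point `σ(y) + iε` of the complex plane. -/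
noncomputable def conePoint (ε : ℝ) (y : Spacetime d) : ℂ := (sqDist y : ℂ) + Complex.I * (ε : ℂ)

lemma conePoint_im (ε : ℝ) (y : Spacetime d) : (conePoint ε y).im = ε := by
  simp [conePoint]

lemma norm_conePoint_le (ε : ℝ) (y : Spacetime d) : ‖conePoint ε y‖ ≤ |sqDist y| + |ε| := by
  refine (norm_add_le _ _).trans_eq ?_
  rw [norm_mul, Complex.norm_I, one_mul, Complex.norm_real, Complex.norm_real, Real.norm_eq_abs,
    Real.norm_eq_abs]

lemma contDiff_conePoint (ε : ℝ) : ContDiff ℝ ∞ (conePoint ε : Spacetime d → ℂ) :=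
  (Complex.ofRealCLM.contDiff.comp contDiff_sqDist).add contDiff_const

lemma hasFDerivAt_conePoint (ε : ℝ) (y : Spacetime d) :
    HasFDerivAt (conePoint ε) (Complex.ofRealCLM.comp (fderiv ℝ sqDist y)) y :=
  (Complex.ofRealCLM.hasFDerivAt.comp y
    (hasFDerivAt_sqDist y).differentiableAt.hasFDerivAt).add_const _

lemma fderiv_sqDist_single (y : Spacetime d) (μ : Fin (d + 1)) :
    fderiv ℝ sqDist y (Pi.single μ 1) = 2 * metricSign μ * y μ := by
  rw [(hasFDerivAt_sqDist y).fderiv]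
  simp [Pi.single_apply]

lemma ModerateGrowth.differentiableAt {F : ℂ → ℂ} (hF : ModerateGrowth F) {z : ℂ}
    (hz : 0 < z.im) : DifferentiableAt ℂ F z :=
  hF.1.differentiableAt (isOpen_upperHalfSpace.mem_nhds hz)

lemma ModerateGrowth.contDiff_conePoint {F : ℂ → ℂ} (hF : ModerateGrowth F) {ε : ℝ} (hε : 0 < ε) :
    ContDiff ℝ ∞ fun y : Spacetime d => F (conePoint ε y) := by
  have h : ContDiffOn ℝ ∞ F {z | 0 < z.im} :=
    (hF.1.contDiffOn isOpen_upperHalfSpace).restrict_scalars ℝ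
  refine h.comp_contDiff (_root_.contDiff_conePoint ε) fun y => ?_
  simpa [conePoint_im] using hε

lemma ModerateGrowth.fderiv_conePoint {F : ℂ → ℂ} (hF : ModerateGrowth F) {ε : ℝ} (hε : 0 < ε)
    (y : Spacetime d) (v : Spacetime d) :
    fderiv ℝ (fun y : Spacetime d => F (conePoint ε y)) y v
      = (fderiv ℝ sqDist y v : ℂ) * _root_.deriv F (conePoint ε y) := by
  have h1 := (hF.differentiableAt (z := conePoint ε y) (by rwa [conePoint_im])).hasDerivAt
  have h2 := (h1.hasFDerivAt.restrictScalars ℝ).comp y (hasFDerivAt_conePoint ε y)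
  have h3 := h2.fderiv
  simp only [Function.comp_def] at h3
  rw [h3]
  simp

lemma ModerateGrowth.hasDerivAt_conePoint {F : ℂ → ℂ} (hF : ModerateGrowth F) {ε : ℝ}
    (hε : 0 < ε) (y : Spacetime d) :
    HasDerivAt (fun ε : ℝ => F (conePoint ε y)) (Complex.I * _root_.deriv F (conePoint ε y)) ε := by
  have h1 := (hF.differentiableAt (z := conePoint ε y) (by rwa [conePoint_im])).hasDerivAt
  have h2 : HasDerivAt (fun ε : ℝ => conePoint ε y) Complex.I ε := by
    have := ((Complex.ofRealCLM.hasDerivAt (x := ε)).const_mul Complex.I).const_add (sqDist y : ℂ)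
    simpa [conePoint] using this
  have h3 := h1.comp ε h2
  rwa [mul_comm] at h3

/-- Complex test functions supported away from the origin. -/
structure IsTestOff (g : Spacetime d → ℂ) : Prop where
  smooth : ContDiff ℝ ∞ g
  compact : HasCompactSupport g
  zero_near : g =ᶠ[𝓝 0] 0

lemma IsTestOff.mul_smooth {g h : Spacetime d → ℂ} (hg : IsTestOff g) (hh : ContDiff ℝ ∞ h) :
    IsTestOff fun y => h y * g y where
  smooth := hh.mul hg.smooth
  compact := hg.compact.mul_left
  zero_near := by
    filter_upwards [hg.zero_near] with y hy
    simp [hy]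

lemma contDiff_fderiv_apply {E : Type*} [NormedAddCommGroup E] [NormedSpace ℝ E] {f : E → ℂ}
    (hf : ContDiff ℝ ∞ f) (v : E) : ContDiff ℝ ∞ fun y => fderiv ℝ f y v :=
  (hf.fderiv_right (m := ∞) le_rfl).clm_apply contDiff_const

lemma IsTestOff.fderiv_apply {g : Spacetime d → ℂ} (hg : IsTestOff g) (v : Spacetime d) :
    IsTestOff fun y => fderiv ℝ g y v where
  smooth := contDiff_fderiv_apply hg.smooth v
  compact := hg.compact.fderiv_apply ℝ v
  zero_near := by
    filter_upwards [hg.zero_near.fderiv (𝕜 := ℝ)] with y hy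
    rw [hy]
    simp

lemma IsTestOff.neg {g : Spacetime d → ℂ} (hg : IsTestOff g) : IsTestOff fun y => -g y where
  smooth := hg.smooth.neg
  compact := hg.compact.neg
  zero_near := by
    filter_upwards [hg.zero_near] with y hy
    simp [hy]

lemma IsTestOff.sum {ι : Type*} (s : Finset ι) {g : ι → Spacetime d → ℂ}
    (hg : ∀ i ∈ s, IsTestOff (g i)) : IsTestOff fun y => ∑ i ∈ s, g i y := by
  classical
  induction s using Finset.induction_on with
  | empty =>
    simp only [Finset.sum_empty]
    exact ⟨contDiff_const, HasCompactSupport.zero, EventuallyEq.rfl⟩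
  | insert i s his ih =>
    have h1 := hg i (Finset.mem_insert_self i s)
    have h2 := ih fun j hj => hg j (Finset.mem_insert_of_mem hj)
    simp only [Finset.sum_insert his]
    refine ⟨h1.smooth.add h2.smooth, h1.compact.add h2.compact, ?_⟩
    filter_upwards [h1.zero_near, h2.zero_near] with y hy1 hy2
    simp [hy1, hy2]

/-- The components of a vector field `X` with `X σ = 1` away from the origin. -/
noncomputable def coneField (μ : Fin (d + 1)) (y : Spacetime d) : ℝ :=
  metricSign μ * y μ / (2 * ∑ ν, y ν ^ 2)

lemma sum_sq_pos {y : Spacetime d} (hy : y ≠ 0) : 0 < ∑ ν, y ν ^ 2 := by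
  obtain ⟨ν, hν⟩ := Function.ne_iff.1 hy
  exact Finset.sum_pos' (fun _ _ => sq_nonneg _) ⟨ν, Finset.mem_univ ν, sq_pos_of_ne_zero hν⟩

/-- The field is the Euclidean gradient of `σ` divided by its squared length `4|y|²`, which is
nonzero even on the light cone away from the origin. -/
lemma sum_coneField {y : Spacetime d} (hy : y ≠ 0) :
    ∑ μ, coneField μ y * (2 * metricSign μ * y μ) = 1 := by
  have h := sum_sq_pos hy
  have h1 : ∀ μ, coneField μ y * (2 * metricSign μ * y μ) = y μ ^ 2 / ∑ ν, y ν ^ 2 := by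
    intro μ
    rw [coneField, div_mul_eq_mul_div, div_eq_div_iff (by positivity) h.ne']
    linear_combination (2 * y μ ^ 2 * ∑ ν, y ν ^ 2) * metricSign_mul_self μ
  simp only [h1]
  rw [← Finset.sum_div, div_self h.ne']

/-- The field is singular only at the origin, near which `g` vanishes. -/
lemma IsTestOff.coneField_mul {g : Spacetime d → ℂ} (hg : IsTestOff g) (μ : Fin (d + 1)) :
    IsTestOff fun y => (coneField μ y : ℂ) * g y where
  smooth := by
    rw [contDiff_iff_contDiffAt]
    intro y
    by_cases hy : y = 0
    · subst hy
      have h : (fun y => (coneField μ y : ℂ) * g y) =ᶠ[𝓝 0] fun _ => 0 := by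
        filter_upwards [hg.zero_near] with y hy
        simp [hy]
      exact contDiffAt_const.congr_of_eventuallyEq h
    · refine ContDiffAt.mul ?_ hg.smooth.contDiffAt
      refine Complex.ofRealCLM.contDiff.contDiffAt.comp y ?_
      have h := sum_sq_pos hy
      change ContDiffAt ℝ ∞ (fun y : Spacetime d => metricSign μ * y μ / (2 * ∑ ν, y ν ^ 2)) y
      refine ContDiffAt.div (by fun_prop) (by fun_prop) (by positivity)
  compact := hg.compact.mul_left
  zero_near := by
    filter_upwards [hg.zero_near] with y hy
    simp [hy]

/-- The formal adjoint of the vector field `X` on test functions. -/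
noncomputable def coneTranspose (g : Spacetime d → ℂ) (y : Spacetime d) : ℂ :=
  ∑ μ, -fderiv ℝ (fun y => (coneField μ y : ℂ) * g y) y (Pi.single μ 1)

lemma IsTestOff.coneTranspose {g : Spacetime d → ℂ} (hg : IsTestOff g) :
    IsTestOff (coneTranspose g) :=
  IsTestOff.sum _ fun μ _ => ((hg.coneField_mul μ).fderiv_apply _).neg

/-- The regularized pairing of a test function with a function of `σ + i0`. -/
noncomputable def coneIntegral (F : ℂ → ℂ) (g : Spacetime d → ℂ) (ε : ℝ) : ℂ :=
  ∫ y, g y * F (conePoint ε y)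

lemma integrable_mul_of_compact {g h : Spacetime d → ℂ} (hg : Continuous g)
    (hgc : HasCompactSupport g) (hh : Continuous h) : Integrable fun y => g y * h y :=
  (hg.mul hh).integrable_of_hasCompactSupport hgc.mul_right

lemma integral_mul_fderiv_of_compact {g h : Spacetime d → ℂ} (hg : ContDiff ℝ ∞ g)
    (hgc : HasCompactSupport g) (hh : ContDiff ℝ ∞ h) (v : Spacetime d) :
    ∫ y, g y * fderiv ℝ h y v = -∫ y, fderiv ℝ g y v * h y :=
  integral_mul_fderiv_eq_neg_fderiv_mul_of_integrable
    (integrable_mul_of_compact (contDiff_fderiv_apply hg v).continuous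
      (hgc.fderiv_apply ℝ v) hh.continuous)
    (integrable_mul_of_compact hg.continuous hgc (contDiff_fderiv_apply hh v).continuous)
    (integrable_mul_of_compact hg.continuous hgc hh.continuous)
    (fun _ _ => (hg.differentiable (by simp)).differentiableAt)
    (fun _ _ => (hh.differentiable (by simp)).differentiableAt)

/-- On the support of `g`, `F'(σ + iε) = X(F(σ + iε))` because `Xσ = 1`; integration by parts moves
`X` onto `g`. -/
lemma coneIntegral_deriv {F : ℂ → ℂ} (hF : ModerateGrowth F) {g : Spacetime d → ℂ}
    (hg : IsTestOff g) {ε : ℝ} (hε : 0 < ε) :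
    coneIntegral (deriv F) g ε = coneIntegral F (coneTranspose g) ε := by
  have hFs := hF.contDiff_conePoint (d := d) hε
  have h1 : ∀ y, g y * deriv F (conePoint ε y) = ∑ μ, ((coneField μ y : ℂ) * g y)
      * fderiv ℝ (fun y : Spacetime d => F (conePoint ε y)) y (Pi.single μ 1) := by
    intro y
    by_cases hy : y = 0
    · have h0 : g y = 0 := by
        rw [hy]
        exact hg.zero_near.self_of_nhds
      simp [h0]
    · have h2 := sum_coneField hy
      have h3 : ∑ μ, (coneField μ y : ℂ) * (fderiv ℝ sqDist y (Pi.single μ 1) : ℝ) = 1 := by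
        simp only [fderiv_sqDist_single]
        exact_mod_cast h2
      simp only [hF.fderiv_conePoint hε]
      rw [← one_mul (g y * _), ← h3, Finset.sum_mul]
      exact Finset.sum_congr rfl fun μ _ => by ring
  rw [coneIntegral, coneIntegral]
  simp only [h1, coneTranspose, Finset.sum_mul]
  rw [integral_finsetSum, integral_finsetSum]
  · refine Finset.sum_congr rfl fun μ _ => ?_
    have hm := hg.coneField_mul μ
    rw [integral_mul_fderiv_of_compact hm.smooth hm.compact hFs, ← integral_neg]
    simp only [neg_mul]
  · intro μ _
    have hm := ((hg.coneField_mul μ).fderiv_apply (Pi.single μ 1)).neg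
    exact integrable_mul_of_compact hm.smooth.continuous hm.compact hFs.continuous
  · intro μ _
    have hm := hg.coneField_mul μ
    exact integrable_mul_of_compact hm.smooth.continuous hm.compact
      (contDiff_fderiv_apply hFs _).continuous

lemma exists_abs_sqDist_le {g : Spacetime d → ℂ} (hg : HasCompactSupport g) :
    ∃ M, 0 ≤ M ∧ ∀ y, g y ≠ 0 → |sqDist y| ≤ M := by
  obtain ⟨M, hM⟩ := hg.isCompact.exists_bound_of_continuousOn
    (contDiff_sqDist (d := d)).continuous.continuousOn
  exact ⟨|M|, abs_nonneg M, fun y hy => (hM y (subset_tsupport g hy)).trans (le_abs_self M)⟩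

/-- The exponent `N` precedes `g`: the repeated integration in `ε` changes the test function but
needs one order of growth for all of them. -/
lemma ModerateGrowth.exists_bound {F : ℂ → ℂ} (hF : ModerateGrowth F) :
    ∃ N : ℕ, ∀ g : Spacetime d → ℂ, HasCompactSupport g → ∀ B : ℝ, ∃ C, 0 ≤ C ∧
      ∀ ε, 0 < ε → ε ≤ B → ∀ y, ‖g y * F (conePoint ε y)‖ ≤ ‖g y‖ * (C * ε⁻¹ ^ N) := by
  obtain ⟨_, N, hN⟩ := hF
  refine ⟨N, fun g hg B => ?_⟩
  obtain ⟨M, hM0, hM⟩ := exists_abs_sqDist_le hg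
  obtain ⟨C, hC, h⟩ := hN (M + B)
  refine ⟨C, hC, fun ε hε hεB y => ?_⟩
  by_cases hy : g y = 0
  · simp [hy]
  · rw [norm_mul]
    have := h (conePoint ε y) (by rwa [conePoint_im]) ((norm_conePoint_le ε y).trans
      (add_le_add (hM y hy) (by rwa [abs_of_pos hε])))
    rw [conePoint_im] at this
    gcongr

lemma hasDerivAt_coneIntegral {F : ℂ → ℂ} (hF : ModerateGrowth F) {g : Spacetime d → ℂ}
    (hg : IsTestOff g) {ε : ℝ} (hε : 0 < ε) :
    HasDerivAt (coneIntegral F g) (Complex.I * coneIntegral (deriv F) g ε) ε := by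
  obtain ⟨N, hN⟩ := hF.deriv.exists_bound (d := d)
  obtain ⟨C, hC, hb⟩ := hN g hg.compact (2 * ε)
  have hcont : ∀ ε, 0 < ε → Integrable fun y : Spacetime d => g y * F (conePoint ε y) :=
    fun ε hε => integrable_mul_of_compact hg.smooth.continuous hg.compact
      (hF.contDiff_conePoint hε).continuous
  have hcont' := integrable_mul_of_compact hg.smooth.continuous hg.compact
    (hF.deriv.contDiff_conePoint (d := d) hε).continuous
  have key := hasDerivAt_integral_of_dominated_loc_of_deriv_le (μ := volume) (x₀ := ε)
    (F := fun ε y => g y * F (conePoint ε y))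
    (F' := fun ε y => Complex.I * (g y * deriv F (conePoint ε y)))
    -- This neighbourhood stays away from `0`, so the growth bound at `ε / 2` dominates throughout.
    (s := Set.Ioo (ε / 2) (2 * ε)) (bound := fun y : Spacetime d => ‖g y‖ * (C * (ε / 2)⁻¹ ^ N))
    (Ioo_mem_nhds (by linarith) (by linarith))
    (by
      filter_upwards [Ioi_mem_nhds hε] with x hx
      exact (hcont x hx).aestronglyMeasurable)
    (hcont ε hε) (hcont'.const_mul _).aestronglyMeasurable
    (Eventually.of_forall fun y x hx => by
      have hx0 : 0 < x := by linarith [hx.1]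
      rw [norm_mul, Complex.norm_I, one_mul]
      refine (hb x hx0 hx.2.le y).trans ?_
      have := hx.1.le
      gcongr)
    ((hg.smooth.continuous.norm.integrable_of_hasCompactSupport hg.compact.norm).mul_const _)
    (Eventually.of_forall fun y x hx => by
      have hx0 : 0 < x := by linarith [hx.1]
      have h := (hF.hasDerivAt_conePoint hx0 y).const_mul (g y)
      rwa [mul_left_comm] at h)
  have h := key.2
  rwa [integral_const_mul] at h

/-- Functions of `σ + iε` have distributional limits away from the origin. -/
theorem exists_tendsto_coneIntegral {F : ℂ → ℂ} (hF : ModerateGrowth F) {g : Spacetime d → ℂ}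
    (hg : IsTestOff g) : ∃ L, Tendsto (coneIntegral F g) (𝓝[>] 0) (𝓝 L) := by
  obtain ⟨N, hN⟩ := hF.exists_bound (d := d)
  -- The family is indexed by test functions; differentiation in `ε` replaces `g` by its image under
  -- the adjoint of `X` and multiplies by `i`.
  refine exists_tendsto_of_deriv_closed
    (X := {g : Spacetime d → ℂ // IsTestOff g}) (fun g => coneIntegral F g.1)
    (fun g => ⟨_, g.2.coneTranspose⟩) Complex.I (fun g x hx => ?_) N (fun g => ?_) ⟨g, hg⟩
  · rw [← coneIntegral_deriv hF g.2 hx]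
    exact hasDerivAt_coneIntegral hF g.2 hx
  · obtain ⟨C, hC, hb⟩ := hN g.1 g.2.compact 1
    have hint : Integrable fun y => ‖g.1 y‖ :=
      g.2.smooth.continuous.norm.integrable_of_hasCompactSupport g.2.compact.norm
    have h0 : 0 ≤ ∫ y, ‖g.1 y‖ := integral_nonneg fun _ => norm_nonneg _
    refine ⟨(∫ y, ‖g.1 y‖) * C, mul_nonneg h0 hC, fun x hx hx1 => ?_⟩
    refine (norm_integral_le_of_norm_le (hint.mul_const _)
      (Eventually.of_forall fun y => hb x hx hx1 y)).trans_eq ?_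
    rw [integral_mul_const]
    ring

end LightCone

/-! ### Regularized functions of Hadamard type -/

section ConeFamily

variable {d : ℕ}

/-- The families of functions generated by `g(y) F(σ + iε)` with `g` smooth and `F` holomorphic
of moderate growth. -/
inductive IsConeFamily : (ℝ → Spacetime d → ℂ) → Prop
  | cone {g : Spacetime d → ℂ} {F : ℂ → ℂ} (hg : ContDiff ℝ ∞ g) (hF : ModerateGrowth F) :
      IsConeFamily fun ε y => g y * F (conePoint ε y)
  | add {Φ Ψ : ℝ → Spacetime d → ℂ} : IsConeFamily Φ → IsConeFamily Ψ →
      IsConeFamily fun ε y => Φ ε y + Ψ ε y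
  | congr {Φ Ψ : ℝ → Spacetime d → ℂ} : IsConeFamily Φ → (∀ ε, 0 < ε → ∀ y, Φ ε y = Ψ ε y) →
      IsConeFamily Ψ

lemma IsConeFamily.contDiff {Φ : ℝ → Spacetime d → ℂ} (h : IsConeFamily Φ) {ε : ℝ} (hε : 0 < ε) :
    ContDiff ℝ ∞ (Φ ε) := by
  induction h with
  | cone hg hF => exact hg.mul (hF.contDiff_conePoint hε)
  | add _ _ h1 h2 => exact h1.add h2
  | congr _ h1 h2 => rwa [← funext (h1 ε hε)]

lemma IsConeFamily.mul {Φ Ψ : ℝ → Spacetime d → ℂ} (h : IsConeFamily Φ) (h' : IsConeFamily Ψ) :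
    IsConeFamily fun ε y => Φ ε y * Ψ ε y := by
  induction h with
  | @cone g F hg hF =>
    induction h' with
    | @cone g' F' hg' hF' =>
      refine (IsConeFamily.cone (hg.mul hg') (hF.mul hF')).congr fun ε _ y => ?_
      ring
    | add _ _ h1 h2 => exact (h1.add h2).congr fun ε _ y => by ring
    | congr _ h1 h2 => exact h2.congr fun ε hε y => by rw [h1 ε hε]
  | add _ _ h1 h2 => exact (h1.add h2).congr fun ε _ y => by ring
  | congr _ h1 h2 => exact h2.congr fun ε hε y => by rw [h1 ε hε]

/-- The chain rule gives a smooth factor `∂_v σ` times `F'(σ + iε)`, and `F'` again has moderate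
growth. -/
lemma IsConeFamily.fderiv_apply {Φ : ℝ → Spacetime d → ℂ} (h : IsConeFamily Φ) (v : Spacetime d) :
    IsConeFamily fun ε y => fderiv ℝ (Φ ε) y v := by
  induction h with
  | @cone g F hg hF =>
    have hσ : ContDiff ℝ ∞ fun y : Spacetime d => g y * (fderiv ℝ sqDist y v : ℝ) :=
      hg.mul (Complex.ofRealCLM.contDiff.comp
        (((contDiff_sqDist (d := d)).fderiv_right (m := ∞) le_rfl).clm_apply contDiff_const))
    refine ((IsConeFamily.cone (contDiff_fderiv_apply hg v) hF).add
      (IsConeFamily.cone hσ hF.deriv)).congr fun ε hε y => ?_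
    rw [fderiv_fun_mul ((hg.differentiable (by simp)) y)
      (((hF.contDiff_conePoint hε).differentiable (by simp)) y), add_apply,
      smul_apply, smul_apply, hF.fderiv_conePoint hε,
      smul_eq_mul, smul_eq_mul]
    ring
  | add h1 h2 ih1 ih2 =>
    refine (ih1.add ih2).congr fun ε hε y => ?_
    rw [fderiv_fun_add ((h1.contDiff hε).differentiable (by simp) y)
      ((h2.contDiff hε).differentiable (by simp) y)]
    rfl
  | congr _ h1 h2 => exact h2.congr fun ε hε y => by rw [funext (h1 ε hε)]

lemma IsConeFamily.exists_tendsto {Φ : ℝ → Spacetime d → ℂ} (h : IsConeFamily Φ)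
    {g : Spacetime d → ℂ} (hg : IsTestOff g) :
    ∃ L, Tendsto (fun ε => ∫ y, g y * Φ ε y) (𝓝[>] 0) (𝓝 L) := by
  induction h with
  | @cone g' F hg' hF =>
    obtain ⟨L, hL⟩ := exists_tendsto_coneIntegral hF (hg.mul_smooth hg')
    refine ⟨L, hL.congr fun ε => integral_congr_ae (Eventually.of_forall fun y => ?_)⟩
    change g' y * g y * _ = g y * (g' y * _)
    ring
  | add h1 h2 ih1 ih2 =>
    obtain ⟨L1, hL1⟩ := ih1
    obtain ⟨L2, hL2⟩ := ih2
    refine ⟨L1 + L2, (hL1.add hL2).congr' ?_⟩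
    filter_upwards [self_mem_nhdsWithin] with ε hε
    rw [← integral_add]
    · exact integral_congr_ae (Eventually.of_forall fun y => (mul_add _ _ _).symm)
    · exact integrable_mul_of_compact hg.smooth.continuous hg.compact (h1.contDiff hε).continuous
    · exact integrable_mul_of_compact hg.smooth.continuous hg.compact (h2.contDiff hε).continuous
  | congr _ h1 ih =>
    obtain ⟨L, hL⟩ := ih
    refine ⟨L, hL.congr' ?_⟩
    filter_upwards [self_mem_nhdsWithin] with ε hε
    rw [funext (h1 ε hε)]

lemma FeynmanParametrix.isConeFamily_reg {m2 : ℝ} (H : FeynmanParametrix d m2) :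
    IsConeFamily H.reg := by
  have hU : ContDiff ℝ ∞ fun y : Spacetime d => H.U (sqDist y) := H.smooth_U.comp contDiff_sqDist
  have hV : ContDiff ℝ ∞ fun y : Spacetime d => H.V (sqDist y) := H.smooth_V.comp contDiff_sqDist
  have hW : ContDiff ℝ ∞ fun y : Spacetime d => H.W (sqDist y) := H.smooth_W.comp contDiff_sqDist
  refine (((IsConeFamily.cone hU (moderateGrowth_cpow (((d : ℝ) + 1) / 2 - 1))).add
    (IsConeFamily.cone hV (moderateGrowth_log H.l_pos))).add
    (IsConeFamily.cone hW (moderateGrowth_const 1))).congr fun ε hε y => ?_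
  simp only [FeynmanParametrix.reg, hadamardForm, conePoint, Complex.cpow_neg, mul_one,
    div_eq_mul_inv]
  push_cast
  rfl

lemma FeynmanParametrix.contDiff_reg {m2 : ℝ} (H : FeynmanParametrix d m2) {ε : ℝ} (hε : 0 < ε) :
    ContDiff ℝ ∞ (H.reg ε) := H.isConeFamily_reg.contDiff hε

/-! ### Iterated partial derivatives -/

lemma partials_zero (μ : Fin 0 → Fin (d + 1)) (f : Spacetime d → ℂ) : partials μ f = f := by
  ext y
  rw [partials, iteratedFDeriv_zero_apply]

lemma partials_succ {p : ℕ} (μ : Fin (p + 1) → Fin (d + 1)) {f : Spacetime d → ℂ}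
    (hf : ContDiff ℝ ∞ f) (y : Spacetime d) :
    partials μ f y = fderiv ℝ (partials (Fin.tail μ) f) y (Pi.single (μ 0) 1) := by
  rw [partials, DifferentiableAt.iteratedFDeriv_succ_apply_left']
  · rfl
  · exact (hf.differentiable_iteratedFDeriv (m := p) (by exact_mod_cast ENat.natCast_lt_top p)) y

lemma contDiff_partials {p : ℕ} (μ : Fin p → Fin (d + 1)) {f : Spacetime d → ℂ}
    (hf : ContDiff ℝ ∞ f) : ContDiff ℝ ∞ (partials μ f) := by
  induction p with
  | zero => rwa [partials_zero]
  | succ p ih =>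
    have h : partials μ f = fun y => fderiv ℝ (partials (Fin.tail μ) f) y (Pi.single (μ 0) 1) :=
      funext (partials_succ μ hf)
    rw [h]
    exact contDiff_fderiv_apply (ih _) _

lemma IsConeFamily.partials {p : ℕ} (μ : Fin p → Fin (d + 1)) {Φ : ℝ → Spacetime d → ℂ}
    (h : IsConeFamily Φ) : IsConeFamily fun ε => partials μ (Φ ε) := by
  induction p with
  | zero => simpa only [partials_zero] using h
  | succ p ih =>
    exact ((ih (Fin.tail μ)).fderiv_apply (Pi.single (μ 0) 1)).congr fun ε hε y =>
      (partials_succ μ (h.contDiff hε) y).symm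

lemma partials_comp_mulVec {p : ℕ} (M : Matrix (Fin (d + 1)) (Fin (d + 1)) ℝ)
    {f : Spacetime d → ℂ} (hf : ContDiff ℝ ∞ f) (μ : Fin p → Fin (d + 1)) (y : Spacetime d) :
    partials μ (fun y => f (M.mulVec y)) y =
      ∑ α : Fin p → Fin (d + 1), (∏ k, ((M (α k) (μ k) : ℝ) : ℂ)) * partials α f (M.mulVec y) := by
  have h := (M.mulVecLin.toContinuousLinearMap).iteratedFDeriv_comp_right (i := p) hf y
    (by exact_mod_cast le_top)
  have h1 : ∀ ν, M.mulVec (Pi.single ν 1) = ∑ α, M α ν • (Pi.single α 1 : Spacetime d) := by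
    intro ν
    ext β
    simp [Pi.single_apply, Finset.sum_apply]
  change iteratedFDeriv ℝ p (f ∘ M.mulVecLin.toContinuousLinearMap) y _ = _
  rw [h, ContinuousMultilinearMap.compContinuousLinearMap_apply]
  change iteratedFDeriv ℝ p f (M.mulVec y) (fun k => M.mulVec (Pi.single (μ k) 1)) = _
  simp only [h1]
  rw [ContinuousMultilinearMap.map_sum]
  refine Finset.sum_congr rfl fun α _ => ?_
  rw [ContinuousMultilinearMap.map_smul_univ, Complex.real_smul, Complex.ofReal_prod]
  rfl

end ConeFamily

/-! ### Lorentz covariance of the regularized pairings -/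

section Covariance

variable {d p q : ℕ} {m2 : ℝ}

lemma sqDist_eq_dotProduct (y : Spacetime d) : sqDist y = y ⬝ᵥ (minkowski d).mulVec y := by
  simp only [sqDist, dotProduct, Matrix.mulVec, Finset.mul_sum]
  exact Finset.sum_congr rfl fun _ _ => Finset.sum_congr rfl fun _ _ => by ring

lemma sqDist_mulVec {M : Matrix (Fin (d + 1)) (Fin (d + 1)) ℝ}
    (hM : M.transpose * minkowski d * M = minkowski d) (y : Spacetime d) :
    sqDist (M.mulVec y) = sqDist y := by
  rw [sqDist_eq_dotProduct, sqDist_eq_dotProduct]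
  conv_rhs => rw [← hM]
  rw [← Matrix.mulVec_mulVec, ← Matrix.mulVec_mulVec, Matrix.dotProduct_mulVec y,
    Matrix.vecMul_transpose]

lemma FeynmanParametrix.reg_eq_of_sqDist_eq (H : FeynmanParametrix d m2) (ε : ℝ)
    {x y : Spacetime d} (h : sqDist x = sqDist y) : H.reg ε x = H.reg ε y := by
  rw [FeynmanParametrix.reg, FeynmanParametrix.reg, hadamardForm, hadamardForm, h]

/-- The tensor `∂_{γ₁} f(y) ∂_{γ₂} f(y)`. -/
noncomputable def pairKernel (p q : ℕ) (f : Spacetime d → ℂ) (y : Spacetime d) :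
    CTensor d (p + q) :=
  fun μ => partials (firstIdx μ) f y * partials (secondIdx μ) f y

lemma contDiff_pairKernel {f : Spacetime d → ℂ} (hf : ContDiff ℝ ∞ f)
    (μ : Fin (p + q) → Fin (d + 1)) : ContDiff ℝ ∞ fun y => pairKernel p q f y μ :=
  (contDiff_partials _ hf).mul (contDiff_partials _ hf)

/-- Differentiate `f ∘ M = f`: each derivative contributes one factor of `M`, and the indices of
both derivatives together form the slots. -/
lemma pairKernel_eq_slotAct {f : Spacetime d → ℂ} (hf : ContDiff ℝ ∞ f)
    {M : Matrix (Fin (d + 1)) (Fin (d + 1)) ℝ} (hM : ∀ y, f (M.mulVec y) = f y)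
    (y : Spacetime d) :
    pairKernel p q f y = slotAct M (pairKernel p q f (M.mulVec y)) := by
  ext μ
  have h : (fun y => f (M.mulVec y)) = f := funext hM
  rw [slotAct_apply, pairKernel, ← (Fin.appendEquiv p q).sum_comp, Fintype.sum_prod_type]
  conv_lhs => rw [← h]
  rw [partials_comp_mulVec M hf, partials_comp_mulVec M hf, Finset.sum_mul_sum]
  refine Finset.sum_congr rfl fun α _ => Finset.sum_congr rfl fun β _ => ?_
  have h1 : firstIdx (Fin.append α β) = α := funext fun k => Fin.append_left α β k
  have h2 : secondIdx (Fin.append α β) = β := funext fun k => Fin.append_right α β k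
  change _ = (∏ k, ((M (Fin.append α β k) (μ k) : ℝ) : ℂ))
    * pairKernel p q f (M.mulVec y) (Fin.append α β)
  rw [Fin.prod_univ_add, pairKernel, h1, h2]
  simp only [Fin.append_left, Fin.append_right, firstIdx, secondIdx]
  ring

lemma pairReg_apply (H : FeynmanParametrix d m2) (f : Spacetime d → ℝ) (ε : ℝ)
    (μ : Fin (p + q) → Fin (d + 1)) :
    pairReg H p q f ε μ = Complex.I * (-1) ^ (1 + p + q) *
      ∫ y, (f y : ℂ) * pairKernel p q (H.reg ε) y μ := by
  simp only [pairReg, pairKernel, mul_assoc]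

lemma integral_comp_mulVec {M : Matrix (Fin (d + 1)) (Fin (d + 1)) ℝ} (hM : M.det = 1)
    {f : Spacetime d → ℂ} (hf : Continuous f) : ∫ y, f (M.mulVec y) = ∫ y, f y := by
  have h := Real.map_matrix_volume_pi_eq_smul_volume_pi (M := M) (by rw [hM]; exact one_ne_zero)
  rw [hM] at h
  simp only [inv_one, abs_one, ENNReal.ofReal_one, one_smul] at h
  conv_rhs => rw [← h]
  rw [integral_map]
  · rfl
  · exact (LinearMap.continuous_of_finiteDimensional _).aemeasurable
  · exact hf.aestronglyMeasurable

lemma continuous_mulVec (M : Matrix (Fin (d + 1)) (Fin (d + 1)) ℝ) :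
    Continuous fun y : Spacetime d => M.mulVec y :=
  LinearMap.continuous_of_finiteDimensional M.mulVecLin

lemma contDiff_mulVec (M : Matrix (Fin (d + 1)) (Fin (d + 1)) ℝ) :
    ContDiff ℝ ∞ fun y : Spacetime d => M.mulVec y :=
  M.mulVecLin.toContinuousLinearMap.contDiff

/-- Lorentz invariance of `H_ε` transfers the substitution `y ↦ My`, of unit Jacobian, from the test
function to the slots of the kernel. -/
lemma pairReg_comp_mulVec (H : FeynmanParametrix d m2)
    {M : Matrix (Fin (d + 1)) (Fin (d + 1)) ℝ} (hM : M.transpose * minkowski d * M = minkowski d)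
    (hdet : M.det = 1) {f : Spacetime d → ℝ} (hf : Continuous f) (hfc : HasCompactSupport f)
    {ε : ℝ} (hε : 0 < ε) :
    pairReg H p q (fun y => f (M.mulVec y)) ε = slotAct M (pairReg H p q f ε) := by
  ext μ
  have hr := H.contDiff_reg hε
  have hfC : Continuous fun y => (f y : ℂ) := Complex.continuous_ofReal.comp hf
  have hfCc : HasCompactSupport fun y => (f y : ℂ) := hfc.comp_left Complex.ofReal_zero
  have hinv : ∀ y, H.reg ε (M.mulVec y) = H.reg ε y := fun y =>
    H.reg_eq_of_sqDist_eq ε (sqDist_mulVec hM y)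
  rw [slotAct_apply]
  simp only [pairReg_apply]
  have h1 : ∀ y, (f (M.mulVec y) : ℂ) * pairKernel p q (H.reg ε) y μ =
      (fun y => (f y : ℂ) * slotAct M (pairKernel p q (H.reg ε) y) μ) (M.mulVec y) := by
    intro y
    rw [pairKernel_eq_slotAct hr hinv y]
  have h2 : Continuous fun y => (f y : ℂ) * slotAct M (pairKernel p q (H.reg ε) y) μ := by
    simp only [slotAct_apply]
    exact hfC.mul (continuous_finsetSum _ fun α _ =>
      continuous_const.mul (contDiff_pairKernel hr α).continuous)
  simp only [h1]
  rw [integral_comp_mulVec hdet h2]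
  simp only [slotAct_apply, Finset.mul_sum]
  rw [integral_finsetSum]
  · rw [Finset.mul_sum]
    refine Finset.sum_congr rfl fun α _ => ?_
    simp only [← integral_const_mul]
    refine integral_congr_ae (Eventually.of_forall fun y => ?_)
    dsimp only
    ring
  · intro α _
    exact integrable_mul_of_compact hfC hfCc
      (continuous_const.mul (contDiff_pairKernel hr α).continuous)

lemma Cutoff.contDiff_apply (c : Cutoff d) (z : Spacetime d) : ContDiff ℝ ∞ fun y => c.χ y z :=
  c.smooth.comp (contDiff_id.prodMk contDiff_const)

lemma pairReg_sub (H : FeynmanParametrix d m2) {f g : Spacetime d → ℝ} (hf : Continuous f)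
    (hfc : HasCompactSupport f) (hg : Continuous g) (hgc : HasCompactSupport g)
    {ε : ℝ} (hε : 0 < ε) :
    pairReg H p q (fun y => f y - g y) ε = pairReg H p q f ε - pairReg H p q g ε := by
  ext μ
  have hK := (contDiff_pairKernel (p := p) (q := q) (H.contDiff_reg hε) μ).continuous
  simp only [Pi.sub_apply, pairReg_apply]
  rw [← mul_sub, ← integral_sub]
  · simp only [Complex.ofReal_sub, sub_mul]
  · exact integrable_mul_of_compact (Complex.continuous_ofReal.comp hf)
      (hfc.comp_left Complex.ofReal_zero) hK
  · exact integrable_mul_of_compact (Complex.continuous_ofReal.comp hg)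
      (hgc.comp_left Complex.ofReal_zero) hK

lemma hasCompactSupport_comp_mulVec {M : Matrix (Fin (d + 1)) (Fin (d + 1)) ℝ}
    (hM : IsUnit M.det) {f : Spacetime d → ℝ} (hf : HasCompactSupport f) :
    HasCompactSupport fun y => f (M.mulVec y) := by
  have h1 : Function.LeftInverse M⁻¹.mulVec M.mulVec := fun y => by
    rw [Matrix.mulVec_mulVec, Matrix.nonsing_inv_mul _ hM, Matrix.one_mulVec]
  have h2 : Function.RightInverse M⁻¹.mulVec M.mulVec := fun y => by
    rw [Matrix.mulVec_mulVec, Matrix.mul_nonsing_inv _ hM, Matrix.one_mulVec]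
  exact hf.comp_homeomorph
    ⟨⟨M.mulVec, M⁻¹.mulVec, h1, h2⟩, continuous_mulVec M, continuous_mulVec M⁻¹⟩

lemma pairReg_comp_mulVec_sub (H : FeynmanParametrix d m2)
    {M : Matrix (Fin (d + 1)) (Fin (d + 1)) ℝ} (hM : M.transpose * minkowski d * M = minkowski d)
    (hdet : M.det = 1) {f : Spacetime d → ℝ} (hf : Continuous f) (hfc : HasCompactSupport f)
    {ε : ℝ} (hε : 0 < ε) :
    pairReg H p q (fun y => f (M.mulVec y) - f y) ε
      = slotAct M (pairReg H p q f ε) - pairReg H p q f ε := by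
  have hu : IsUnit M.det := by
    rw [hdet]
    exact isUnit_one
  have h1 : Continuous fun y => f (M.mulVec y) := hf.comp (continuous_mulVec M)
  rw [← pairReg_comp_mulVec H hM hdet hf hfc hε]
  exact pairReg_sub H h1 (hasCompactSupport_comp_mulVec hu hfc) hf hfc hε

/-- The regularized tensor `Q` is a coboundary. -/
lemma pairReg_cutoffDiff (H : FeynmanParametrix d m2) (c : Cutoff d)
    {Λ : Matrix (Fin (d + 1)) (Fin (d + 1)) ℝ} (hΛ : Λ ∈ properLorentz d) {ε : ℝ} (hε : 0 < ε) :
    pairReg H p q (cutoffDiff c Λ) ε = slotAct Λ⁻¹ (pairReg H p q (fun y => c.χ y 0) ε)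
      - pairReg H p q (fun y => c.χ y 0) ε :=
  pairReg_comp_mulVec_sub H (properLorentz.inv_transpose_mul hΛ) (properLorentz.det_inv hΛ)
    (c.contDiff_apply 0).continuous (c.compact 0) hε

/-! ### Infinitesimal covariance -/

lemma partials_cons (ν : Fin (d + 1)) (μ : Fin p → Fin (d + 1)) {f : Spacetime d → ℂ}
    (hf : ContDiff ℝ ∞ f) (y : Spacetime d) :
    partials (Fin.cons ν μ : Fin (p + 1) → Fin (d + 1)) f y
      = fderiv ℝ (partials μ f) y (Pi.single ν 1) := by
  rw [partials_succ _ hf, Fin.tail_cons, Fin.cons_zero]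

lemma fderiv_apply_eq_sum {f : Spacetime d → ℂ} (y v : Spacetime d) :
    fderiv ℝ f y v = ∑ α, (v α : ℂ) * fderiv ℝ f y (Pi.single α 1) := by
  have h : v = ∑ α, v α • (Pi.single α 1 : Spacetime d) := by
    ext β
    simp [Pi.single_apply, Finset.sum_apply]
  conv_lhs => rw [h]
  rw [map_sum]
  simp

/-- Commuting `∂_ν` past the field `l y` yields one term in which `l` acts on the index `ν`;
induction on the number of derivatives collects these terms. -/
lemma fderiv_partials_mulVec {f : Spacetime d → ℂ} (hf : ContDiff ℝ ∞ f)
    {l : Matrix (Fin (d + 1)) (Fin (d + 1)) ℝ} (hl : ∀ y, fderiv ℝ f y (l.mulVec y) = 0)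
    (μ : Fin p → Fin (d + 1)) (y : Spacetime d) :
    fderiv ℝ (partials μ f) y (l.mulVec y)
      = -∑ k, ∑ α, (l α (μ k) : ℂ) * partials (Function.update μ k α) f y := by
  induction p generalizing y with
  | zero => simp [partials_zero, hl]
  | succ p ih =>
    obtain ⟨ν, μ, rfl⟩ : ∃ ν μ', μ = Fin.cons ν μ' := ⟨μ 0, Fin.tail μ, (Fin.cons_self_tail μ).symm⟩
    have hg := contDiff_partials μ hf
    have hg' : ContDiff ℝ ∞ (fderiv ℝ (partials μ f)) := hg.fderiv_right (m := ∞) le_rfl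
    have hgd : DifferentiableAt ℝ (fderiv ℝ (partials μ f)) y := hg'.differentiable (by simp) y
    have hsymm : fderiv ℝ (fderiv ℝ (partials μ f)) y (l.mulVec y) (Pi.single ν 1)
        = fderiv ℝ (fderiv ℝ (partials μ f)) y (Pi.single ν 1) (l.mulVec y) :=
      (hg.contDiffAt.isSymmSndFDerivAt (by
        rw [minSmoothness_of_isRCLikeNormedField]
        exact WithTop.coe_le_coe.2 le_top)).eq _ _
    have h1 : fderiv ℝ (partials (Fin.cons ν μ : Fin (p + 1) → Fin (d + 1)) f) y (l.mulVec y)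
        = fderiv ℝ (fderiv ℝ (partials μ f)) y (l.mulVec y) (Pi.single ν 1) := by
      rw [funext (partials_cons ν μ hf), fderiv_clm_apply hgd (differentiableAt_const _)]
      simp
    -- Here the induction hypothesis will be differentiated along `ν`; the second term, from the
    -- derivative of `l y`, is the contribution of the new slot.
    have h2 : fderiv ℝ (fun y => fderiv ℝ (partials μ f) y (l.mulVec y)) y (Pi.single ν 1)
        = fderiv ℝ (fderiv ℝ (partials μ f)) y (Pi.single ν 1) (l.mulVec y)
          + fderiv ℝ (partials μ f) y (l.mulVec (Pi.single ν 1)) := by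
      have hL : HasFDerivAt (fun y : Spacetime d => l.mulVec y)
          l.mulVecLin.toContinuousLinearMap y := l.mulVecLin.toContinuousLinearMap.hasFDerivAt
      rw [fderiv_clm_apply hgd hL.differentiableAt, hL.fderiv]
      exact add_comm _ _
    have h3 : fderiv ℝ (fun y => -∑ k, ∑ α, (l α (μ k) : ℂ)
          * partials (Function.update μ k α) f y) y (Pi.single ν 1)
        = -∑ k, ∑ α, (l α (μ k) : ℂ) * partials
          (Fin.cons ν (Function.update μ k α) : Fin (p + 1) → Fin (d + 1)) f y := by
      have hd : ∀ k α, HasFDerivAt (fun y => (l α (μ k) : ℂ)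
          * partials (Function.update μ k α) f y)
          ((l α (μ k) : ℂ) • fderiv ℝ (partials (Function.update μ k α) f) y) y := fun k α =>
        ((contDiff_partials _ hf).differentiable (by simp) y).hasFDerivAt.const_mul _
      have h := (HasFDerivAt.fun_sum (u := Finset.univ) fun k _ =>
        HasFDerivAt.fun_sum (u := Finset.univ) fun α _ => hd k α).neg
      have h' := h.fderiv
      simp only [Pi.neg_def] at h'
      rw [h']
      simp only [partials_cons _ _ hf, neg_apply, sum_apply, smul_apply, smul_eq_mul]
    rw [funext (ih μ), h3] at h2
    have h4 : fderiv ℝ (partials μ f) y (l.mulVec (Pi.single ν 1)) = ∑ α, (l α ν : ℂ)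
        * partials (Fin.cons α μ : Fin (p + 1) → Fin (d + 1)) f y := by
      rw [fderiv_apply_eq_sum]
      simp only [partials_cons _ _ hf, Matrix.mulVec_single_one, Matrix.col_apply]
    rw [h1, hsymm, Fin.sum_univ_succ]
    simp only [Fin.cons_zero, Fin.cons_succ, Fin.update_cons_zero, ← Fin.cons_update]
    rw [← h4]
    linear_combination -h2

lemma firstIdx_update_castAdd (μ : Fin (p + q) → Fin (d + 1)) (k : Fin p) (α : Fin (d + 1)) :
    firstIdx (Function.update μ (Fin.castAdd q k) α) = Function.update (firstIdx μ) k α := by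
  ext j
  simp [firstIdx, Function.update_apply, Fin.ext_iff]

lemma secondIdx_update_castAdd (μ : Fin (p + q) → Fin (d + 1)) (k : Fin p) (α : Fin (d + 1)) :
    secondIdx (Function.update μ (Fin.castAdd q k) α) = secondIdx μ := by
  ext j
  have : Fin.natAdd p j ≠ Fin.castAdd q k := fun h => by
    have := congrArg Fin.val h
    simp at this
    omega
  simp [secondIdx, this]

lemma firstIdx_update_natAdd (μ : Fin (p + q) → Fin (d + 1)) (k : Fin q) (α : Fin (d + 1)) :
    firstIdx (Function.update μ (Fin.natAdd p k) α) = firstIdx μ := by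
  ext j
  have : Fin.castAdd q j ≠ Fin.natAdd p k := fun h => by
    have := congrArg Fin.val h
    simp at this
    omega
  simp [firstIdx, this]

lemma secondIdx_update_natAdd (μ : Fin (p + q) → Fin (d + 1)) (k : Fin q) (α : Fin (d + 1)) :
    secondIdx (Function.update μ (Fin.natAdd p k) α) = Function.update (secondIdx μ) k α := by
  ext j
  simp [secondIdx, Function.update_apply, Fin.ext_iff]

lemma fderiv_pairKernel_mulVec {f : Spacetime d → ℂ} (hf : ContDiff ℝ ∞ f)
    {l : Matrix (Fin (d + 1)) (Fin (d + 1)) ℝ} (hl : ∀ y, fderiv ℝ f y (l.mulVec y) = 0)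
    (μ : Fin (p + q) → Fin (d + 1)) (y : Spacetime d) :
    fderiv ℝ (fun y => pairKernel p q f y μ) y (l.mulVec y)
      = -genAct l (pairKernel p q f y) μ := by
  have h1 := (contDiff_partials (firstIdx μ) hf).differentiable (by simp) y
  have h2 := (contDiff_partials (secondIdx μ) hf).differentiable (by simp) y
  simp only [pairKernel]
  rw [fderiv_fun_mul h1 h2, add_apply, smul_apply, smul_apply, fderiv_partials_mulVec hf hl,
    fderiv_partials_mulVec hf hl, genAct, Fin.sum_univ_add]
  simp only [pairKernel, firstIdx_update_castAdd, secondIdx_update_castAdd, firstIdx_update_natAdd,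
    secondIdx_update_natAdd, smul_eq_mul, mul_neg, Finset.mul_sum, neg_add]
  rw [add_comm]
  congr 2
  refine Finset.sum_congr rfl fun k _ => Finset.sum_congr rfl fun α _ => ?_
  simp only [firstIdx]
  ring
  refine Finset.sum_congr rfl fun k _ => Finset.sum_congr rfl fun α _ => ?_
  simp only [secondIdx]
  ring

end Covariance

section InfinitesimalPairing

variable {d p q : ℕ} {m2 : ℝ}

lemma lorentzGen_mulVec (κ ρ : Fin (d + 1)) (y : Spacetime d) (μ : Fin (d + 1)) :
    (lorentzGen κ ρ).mulVec y μ = minkowski d μ κ * y ρ - minkowski d μ ρ * y κ := by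
  simp [Matrix.mulVec, dotProduct, lorentzGen, sub_mul, Finset.sum_sub_distrib]

lemma fderiv_sqDist_lorentzGen (κ ρ : Fin (d + 1)) (y : Spacetime d) :
    fderiv ℝ sqDist y ((lorentzGen κ ρ).mulVec y) = 0 := by
  rw [(hasFDerivAt_sqDist y).fderiv]
  simp only [sum_apply, smul_apply, ContinuousLinearMap.proj_apply, lorentzGen_mulVec,
    minkowski_apply, smul_eq_mul, mul_sub, Finset.sum_sub_distrib, ite_mul, zero_mul, mul_ite,
    mul_zero, Finset.sum_ite_eq', Finset.mem_univ, if_true, metricSign]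
  split_ifs <;> ring

/-- The generators are tangent to the level sets of `σ`, and `H_ε` depends on `y` through `σ` alone.
-/
lemma FeynmanParametrix.fderiv_reg_lorentzGen (H : FeynmanParametrix d m2) {ε : ℝ} (hε : 0 < ε)
    (κ ρ : Fin (d + 1)) (y : Spacetime d) :
    fderiv ℝ (H.reg ε) y ((lorentzGen κ ρ).mulVec y) = 0 := by
  have hσ := fderiv_sqDist_lorentzGen κ ρ y
  have hprod : ∀ {G : ℝ → ℂ} {F : ℂ → ℂ}, ContDiff ℝ ∞ G → ModerateGrowth F →
      DifferentiableAt ℝ (fun y => G (sqDist y) * F (conePoint ε y)) y ∧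
      fderiv ℝ (fun y => G (sqDist y) * F (conePoint ε y)) y ((lorentzGen κ ρ).mulVec y) = 0 := by
    intro G F hG hF
    have hF' := (hF.contDiff_conePoint (d := d) hε).differentiable (by simp) y
    have hG' := (((hG.differentiable (by simp)) (sqDist y)).hasFDerivAt).comp y
      ((contDiff_sqDist (d := d)).differentiable (by simp) y).hasFDerivAt
    simp only [Function.comp_def] at hG'
    refine ⟨hG'.differentiableAt.mul hF', ?_⟩
    rw [fderiv_fun_mul hG'.differentiableAt hF', add_apply, smul_apply, smul_apply,
      hF.fderiv_conePoint hε, hG'.fderiv]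
    simp [hσ]
  have h1 := hprod H.smooth_U (moderateGrowth_cpow (((d : ℝ) + 1) / 2 - 1))
  have h2 := hprod H.smooth_V (moderateGrowth_log H.l_pos)
  have h3 := hprod H.smooth_W (moderateGrowth_const 1)
  have h : H.reg ε = fun y => (H.U (sqDist y)
      * conePoint ε y ^ (-((((d : ℝ) + 1) / 2 - 1 : ℝ) : ℂ))
      + H.V (sqDist y) * Complex.log (conePoint ε y / (H.l : ℂ) ^ 2)) + H.W (sqDist y) * 1 := by
    ext y
    simp only [FeynmanParametrix.reg, hadamardForm, conePoint, Complex.cpow_neg, mul_one,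
      div_eq_mul_inv]
    push_cast
    rfl
  rw [h, fderiv_fun_add (h1.1.fun_add h2.1) h3.1, fderiv_fun_add h1.1 h2.1, add_apply, add_apply,
    h1.2, h2.2, h3.2]
  simp

/-- Integration by parts against a divergence-free linear vector field. -/
lemma integral_linear_field_mul {f g : Spacetime d → ℂ} (hf : ContDiff ℝ ∞ f)
    (hfc : HasCompactSupport f) (hg : ContDiff ℝ ∞ g)
    {l : Matrix (Fin (d + 1)) (Fin (d + 1)) ℝ} (hl : ∑ σ, l σ σ = 0) :
    ∫ y, fderiv ℝ f y (l.mulVec y) * g y = -∫ y, f y * fderiv ℝ g y (l.mulVec y) := by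
  have hl1 : ∀ σ, ContDiff ℝ ∞ fun y : Spacetime d => (l.mulVec y σ : ℂ) := fun σ =>
    Complex.ofRealCLM.contDiff.comp
      ((ContinuousLinearMap.proj (R := ℝ) (φ := fun _ : Fin (d + 1) => ℝ) σ).contDiff.comp
        (contDiff_mulVec l))
  have hh : ∀ σ, ContDiff ℝ ∞ fun y : Spacetime d => (l.mulVec y σ : ℂ) * g y := fun σ =>
    (hl1 σ).mul hg
  have hd : ∀ σ y, fderiv ℝ (fun y : Spacetime d => (l.mulVec y σ : ℂ) * g y) y (Pi.single σ 1)
      = (l σ σ : ℂ) * g y + (l.mulVec y σ : ℂ) * fderiv ℝ g y (Pi.single σ 1) := by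
    intro σ y
    have hL : HasFDerivAt (fun y : Spacetime d => (l.mulVec y σ : ℂ))
        (Complex.ofRealCLM.comp
          ((ContinuousLinearMap.proj (R := ℝ) (φ := fun _ : Fin (d + 1) => ℝ) σ).comp
            l.mulVecLin.toContinuousLinearMap)) y :=
      ContinuousLinearMap.hasFDerivAt (Complex.ofRealCLM.comp
          ((ContinuousLinearMap.proj (R := ℝ) (φ := fun _ : Fin (d + 1) => ℝ) σ).comp
            l.mulVecLin.toContinuousLinearMap))
    have h1 : (Complex.ofRealCLM.comp
        ((ContinuousLinearMap.proj (R := ℝ) (φ := fun _ : Fin (d + 1) => ℝ) σ).comp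
          l.mulVecLin.toContinuousLinearMap)) (Pi.single σ 1) = (l σ σ : ℂ) := by
      change ((l.mulVec (Pi.single σ 1) σ : ℝ) : ℂ) = _
      rw [Matrix.mulVec_single_one, Matrix.col_apply]
    rw [fderiv_fun_mul hL.differentiableAt (hg.differentiable (by simp) y), add_apply, smul_apply,
      smul_apply, hL.fderiv, h1, smul_eq_mul, smul_eq_mul]
    ring
  have hsum : ∀ y, fderiv ℝ f y (l.mulVec y) * g y = ∑ σ, fderiv ℝ f y (Pi.single σ 1)
      * ((l.mulVec y σ : ℂ) * g y) := by
    intro y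
    rw [fderiv_apply_eq_sum, Finset.sum_mul]
    exact Finset.sum_congr rfl fun σ _ => by ring
  have hparts : ∀ σ, ∫ y, fderiv ℝ f y (Pi.single σ 1) * ((l.mulVec y σ : ℂ) * g y)
      = -∫ y, f y * ((l σ σ : ℂ) * g y + (l.mulVec y σ : ℂ) * fderiv ℝ g y (Pi.single σ 1)) := by
    intro σ
    simp only [← hd]
    rw [integral_mul_fderiv_of_compact hf hfc (hh σ), neg_neg]
  simp only [hsum]
  rw [integral_finsetSum]
  · simp only [hparts]
    rw [Finset.sum_neg_distrib, ← integral_finsetSum]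
    · congr 1
      refine integral_congr_ae (Eventually.of_forall fun y => ?_)
      dsimp only
      rw [← Finset.mul_sum, Finset.sum_add_distrib, ← Finset.sum_mul, fderiv_apply_eq_sum]
      have : ∑ σ, (l σ σ : ℂ) = 0 := by exact_mod_cast congrArg Complex.ofReal hl
      rw [this, zero_mul, zero_add]
    · intro σ _
      exact integrable_mul_of_compact hf.continuous hfc
        ((contDiff_const.mul hg).add ((hl1 σ).mul (contDiff_fderiv_apply hg _))).continuous
  · intro σ _
    exact integrable_mul_of_compact (contDiff_fderiv_apply hf _).continuous
      (hfc.fderiv_apply ℝ _) (hh σ).continuous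

lemma fderiv_ofReal_comp {f : Spacetime d → ℝ} (hf : ContDiff ℝ ∞ f) (y v : Spacetime d) :
    fderiv ℝ (fun y => (f y : ℂ)) y v = (fderiv ℝ f y v : ℂ) := by
  have h := (Complex.ofRealCLM.hasFDerivAt (x := f y)).comp y
    (hf.differentiable (by simp) y).hasFDerivAt
  simp only [Function.comp_def, Complex.ofRealCLM_apply] at h
  rw [h.fderiv]
  simp

lemma contDiff_ofReal_comp {f : Spacetime d → ℝ} (hf : ContDiff ℝ ∞ f) :
    ContDiff ℝ ∞ fun y => (f y : ℂ) := Complex.ofRealCLM.contDiff.comp hf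

/-- The minus sign of the integration by parts cancels the one in the infinitesimal covariance of
the kernel. -/
lemma pairReg_fderiv_lorentzGen (H : FeynmanParametrix d m2) {f : Spacetime d → ℝ}
    (hf : ContDiff ℝ ∞ f) (hfc : HasCompactSupport f) (κ ρ : Fin (d + 1)) {ε : ℝ} (hε : 0 < ε) :
    pairReg H p q (fun y => fderiv ℝ f y ((lorentzGen κ ρ).mulVec y)) ε
      = genAct (lorentzGen κ ρ) (pairReg H p q f ε) := by
  ext μ
  have hr := H.contDiff_reg hε
  have hfC := contDiff_ofReal_comp hf
  have hfCc : HasCompactSupport fun y => (f y : ℂ) := hfc.comp_left Complex.ofReal_zero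
  rw [pairReg_apply]
  simp only [← fderiv_ofReal_comp hf]
  rw [integral_linear_field_mul hfC hfCc (contDiff_pairKernel hr μ) (lorentzGen_trace κ ρ)]
  simp only [fderiv_pairKernel_mulVec hr (H.fderiv_reg_lorentzGen hε κ ρ), mul_neg, genAct,
    pairReg_apply]
  rw [integral_neg, mul_neg, neg_neg]
  have hint : ∀ k α, Integrable fun y => (lorentzGen κ ρ α (μ k) : ℂ)
      * ((f y : ℂ) * pairKernel p q (H.reg ε) y (Function.update μ k α)) := fun k α =>
    (integrable_mul_of_compact hfC.continuous hfCc
      (contDiff_pairKernel hr _).continuous).const_mul _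
  have h1 : ∀ y, (f y : ℂ) * ∑ k, ∑ α, (lorentzGen κ ρ α (μ k) : ℂ)
      * pairKernel p q (H.reg ε) y (Function.update μ k α)
      = ∑ k, ∑ α, (lorentzGen κ ρ α (μ k) : ℂ)
        * ((f y : ℂ) * pairKernel p q (H.reg ε) y (Function.update μ k α)) := by
    intro y
    simp only [Finset.mul_sum]
    exact Finset.sum_congr rfl fun _ _ => Finset.sum_congr rfl fun _ _ => by ring
  simp only [h1]
  rw [integral_finsetSum _ fun k _ => integrable_finsetSum _ fun α _ => hint k α, Finset.mul_sum]
  refine Finset.sum_congr rfl fun k _ => ?_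
  rw [integral_finsetSum _ fun α _ => hint k α, Finset.mul_sum]
  refine Finset.sum_congr rfl fun α _ => ?_
  rw [integral_const_mul]
  ring

lemma cutoffGen_eq (c : Cutoff d) (κ ρ : Fin (d + 1)) :
    cutoffGen c κ ρ = fun y => fderiv ℝ (fun y => c.χ y 0) y ((lorentzGen κ ρ).mulVec y) := by
  ext y
  have h : (lorentzGen κ ρ).mulVec y = ∑ σ, (lorentzGen κ ρ).mulVec y σ
      • (Pi.single σ 1 : Spacetime d) := by
    ext β
    simp [Pi.single_apply, Finset.sum_apply]
  rw [h, map_sum, cutoffGen]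
  refine Finset.sum_congr rfl fun σ _ => ?_
  rw [map_smul, smul_eq_mul, Matrix.mulVec, dotProduct, Finset.sum_mul]

/-- The regularized tensor `B^{κρ}` is the infinitesimal coboundary. -/
lemma pairReg_cutoffGen (H : FeynmanParametrix d m2) (c : Cutoff d) (κ ρ : Fin (d + 1))
    {ε : ℝ} (hε : 0 < ε) :
    pairReg H p q (cutoffGen c κ ρ) ε
      = genAct (lorentzGen κ ρ) (pairReg H p q (fun y => c.χ y 0) ε) := by
  rw [cutoffGen_eq]
  exact pairReg_fderiv_lorentzGen H (c.contDiff_apply 0) (c.compact 0) κ ρ hε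

/-! ### Existence of the limits -/

lemma exists_tendsto_pairReg (H : FeynmanParametrix d m2) {f : Spacetime d → ℝ}
    (hf : IsTestOff fun y => (f y : ℂ)) (μ : Fin (p + q) → Fin (d + 1)) :
    ∃ L, Tendsto (fun ε => pairReg H p q f ε μ) (𝓝[>] 0) (𝓝 L) := by
  have h : IsConeFamily fun ε y => pairKernel p q (H.reg ε) y μ :=
    (H.isConeFamily_reg.partials (firstIdx μ)).mul (H.isConeFamily_reg.partials (secondIdx μ))
  obtain ⟨L, hL⟩ := h.exists_tendsto hf
  simp only [pairReg_apply]
  exact ⟨_, hL.const_mul _⟩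

lemma tendsto_pairing (H : FeynmanParametrix d m2) {f : Spacetime d → ℝ}
    (hf : IsTestOff fun y => (f y : ℂ)) (μ : Fin (p + q) → Fin (d + 1)) :
    Tendsto (fun ε => pairReg H p q f ε μ) (𝓝[>] 0) (𝓝 (pairing H p q f μ)) :=
  tendsto_nhds_limUnder (exists_tendsto_pairReg H hf μ)

/-- Both cutoffs equal `1` near the origin, since `Λ⁻¹` fixes it, and so their difference vanishes
there. -/
lemma isTestOff_cutoffDiff (c : Cutoff d) {Λ : Matrix (Fin (d + 1)) (Fin (d + 1)) ℝ}
    (hΛ : Λ ∈ properLorentz d) : IsTestOff fun y => (cutoffDiff c Λ y : ℂ) := by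
  have hu : IsUnit Λ⁻¹.det := by
    rw [properLorentz.det_inv hΛ]
    exact isUnit_one
  have hs : ContDiff ℝ ∞ fun y : Spacetime d => c.χ (Λ⁻¹.mulVec y) 0 :=
    (c.contDiff_apply 0).comp (contDiff_mulVec Λ⁻¹)
  have hc := hasCompactSupport_comp_mulVec hu (c.compact 0)
  refine ⟨contDiff_ofReal_comp (hs.sub (c.contDiff_apply 0)),
    (hc.sub (c.compact 0)).comp_left Complex.ofReal_zero, ?_⟩
  have h1 : Tendsto (fun y : Spacetime d => Λ⁻¹.mulVec y) (𝓝 0) (𝓝 0) := by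
    have := (continuous_mulVec Λ⁻¹).tendsto 0
    rwa [Matrix.mulVec_zero] at this
  filter_upwards [c.eq_one 0, h1.eventually (c.eq_one 0)] with y hy1 hy2
  simp [cutoffDiff, hy1, hy2]

lemma isTestOff_cutoffGen (c : Cutoff d) (κ ρ : Fin (d + 1)) :
    IsTestOff fun y => (cutoffGen c κ ρ y : ℂ) := by
  rw [cutoffGen_eq]
  have hχ : ContDiff ℝ ∞ fun y => c.χ y 0 := c.contDiff_apply 0
  refine ⟨contDiff_ofReal_comp ((hχ.fderiv_right (m := ∞) le_rfl).clm_apply (contDiff_mulVec _)),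
    ?_, ?_⟩
  · refine HasCompactSupport.mono (f := fderiv ℝ fun y => c.χ y 0) ((c.compact 0).fderiv ℝ) ?_
    intro y hy hy0
    apply hy
    simp [hy0]
  · have h : (fun y => c.χ y 0) =ᶠ[𝓝 0] fun _ => 1 := c.eq_one 0
    filter_upwards [h.fderiv (𝕜 := ℝ)] with y hy
    rw [hy]
    simp

end InfinitesimalPairing

/-! ### Taylor coefficients of the cut-off integral -/

section TaylorCoefficients

variable {d p q : ℕ} {m2 : ℝ}

open scoped Convolution in
-- As a convolution with the compactly supported `k`, the integral is smooth in `x` and may be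
-- differentiated under the integral sign.
lemma integral_mul_comp_sub_eq_convolution (k G : Spacetime d → ℂ) (x : Spacetime d) :
    ∫ y, k y * G (y - x)
      = ((fun y => G (-y)) ⋆[ContinuousLinearMap.mul ℝ ℂ, volume] k) x := by
  rw [convolution_def, ← integral_sub_left_eq_self _ volume x]
  refine integral_congr_ae (Eventually.of_forall fun y => ?_)
  simp only [sub_sub_cancel_left, ContinuousLinearMap.mul_apply']
  exact mul_comm _ _

lemma contDiff_integral_mul_comp_sub {k G : Spacetime d → ℂ} (hk : ContDiff ℝ ∞ k)
    (hkc : HasCompactSupport k) (hG : ContDiff ℝ ∞ G) :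
    ContDiff ℝ ∞ fun x => ∫ y, k y * G (y - x) := by
  simp only [integral_mul_comp_sub_eq_convolution]
  exact hkc.contDiff_convolution_right _
    (hG.continuous.comp continuous_neg).locallyIntegrable hk

lemma fderiv_integral_mul_comp_sub {k G : Spacetime d → ℂ} (hk : ContDiff ℝ ∞ k)
    (hkc : HasCompactSupport k) (hG : ContDiff ℝ ∞ G) (x v : Spacetime d) :
    fderiv ℝ (fun x => ∫ y, k y * G (y - x)) x v = -∫ y, k y * fderiv ℝ G (y - x) v := by
  have hloc : LocallyIntegrable fun y => G (-y) :=
    (hG.continuous.comp continuous_neg).locallyIntegrable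
  have hG' : ContDiff ℝ ∞ fun y => G (y - x) := hG.comp (contDiff_id.sub contDiff_const)
  have h1 : ∀ y, fderiv ℝ (fun y => G (y - x)) y v = fderiv ℝ G (y - x) v := fun y => by
    simp only [sub_eq_add_neg, fderiv_comp_add_right]
  simp only [← h1]
  -- The derivative of a convolution falls on `k`; integration by parts brings the right-hand side
  -- to the same form.
  rw [integral_mul_fderiv_of_compact hk hkc hG', neg_neg]
  simp only [integral_mul_comp_sub_eq_convolution k G]
  rw [(hkc.hasFDerivAt_convolution_right (ContinuousLinearMap.mul ℝ ℂ) hloc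
    (hk.of_le (by exact_mod_cast le_top)) x).fderiv,
    convolution_precompR_apply _ hloc (hkc.fderiv ℝ) (hk.continuous_fderiv (by simp)),
    integral_mul_comp_sub_eq_convolution]

lemma partials_integral_mul_comp_sub {k G : Spacetime d → ℂ} (hk : ContDiff ℝ ∞ k)
    (hkc : HasCompactSupport k) (hG : ContDiff ℝ ∞ G) (μ : Fin p → Fin (d + 1))
    (x : Spacetime d) :
    partials μ (fun x => ∫ y, k y * G (y - x)) x
      = ∫ y, ((-1) ^ p * k y) * partials μ G (y - x) := by
  induction p generalizing x with
  | zero => simp [partials_zero]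
  | succ p ih =>
    rw [partials_succ _ (contDiff_integral_mul_comp_sub hk hkc hG), funext (ih (Fin.tail μ)),
      fderiv_integral_mul_comp_sub (contDiff_const.mul hk) hkc.mul_left (contDiff_partials _ hG),
      ← integral_neg]
    refine integral_congr_ae (Eventually.of_forall fun y => ?_)
    simp only [← partials_succ _ hG]
    ring

/-- Substituting `y ↦ Λy` in the first integral removes `Λ` from both factors `H_ε`. Translation
invariance leaves `χ(Λ(y - z), 0)`, so the difference involves `Λ⁻¹` in `cutoffDiff`. -/
lemma omegaReg_sub_omegaReg (c : Cutoff d) (hc : c.TranslationInvariant)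
    (H : FeynmanParametrix d m2) {Λ : Matrix (Fin (d + 1)) (Fin (d + 1)) ℝ}
    (hΛ : Λ ∈ properLorentz d) {ε : ℝ} (hε : 0 < ε) (x₁ x₂ z : Spacetime d) :
    omegaReg c H ε (Λ.mulVec x₁) (Λ.mulVec x₂) (Λ.mulVec z) - omegaReg c H ε x₁ x₂ z
      = ∫ y, (-Complex.I * (cutoffDiff c Λ⁻¹ (y - z) : ℂ) * H.reg ε (y - x₁))
        * H.reg ε (y - x₂) := by
  have hr := (H.contDiff_reg hε).continuous
  have hshift : ∀ x : Spacetime d, Continuous fun y => H.reg ε (y - x) := fun x =>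
    hr.comp (continuous_id.sub continuous_const)
  have hχ : ∀ z, Continuous fun y => (c.χ y z : ℂ) := fun z =>
    (contDiff_ofReal_comp (c.contDiff_apply z)).continuous
  have hinv : ∀ x y, H.reg ε (Λ.mulVec y - Λ.mulVec x) = H.reg ε (y - x) := fun x y => by
    rw [← Matrix.mulVec_sub]
    exact H.reg_eq_of_sqDist_eq ε (sqDist_mulVec hΛ.1 _)
  have hχ0 : ∀ y z, c.χ y z = c.χ (y - z) 0 := fun y z => by
    have := hc (y - z) 0 z
    rwa [sub_add_cancel, zero_add] at this
  have h1 : omegaReg c H ε (Λ.mulVec x₁) (Λ.mulVec x₂) (Λ.mulVec z)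
      = -Complex.I * ∫ y, (c.χ (Λ.mulVec (y - z)) 0 : ℂ) * H.reg ε (y - x₁)
        * H.reg ε (y - x₂) := by
    have hcont : Continuous fun y => (c.χ y (Λ.mulVec z) : ℂ) * H.reg ε (y - Λ.mulVec x₁)
        * H.reg ε (y - Λ.mulVec x₂) := ((hχ _).mul (hshift _)).mul (hshift _)
    rw [omegaReg, ← integral_comp_mulVec hΛ.2 hcont]
    simp only [hinv, hχ0 (Λ.mulVec _), Matrix.mulVec_sub]
  have hc1 : HasCompactSupport fun y => (c.χ (Λ.mulVec (y - z)) 0 : ℂ) := by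
    have := (hasCompactSupport_comp_mulVec (properLorentz.isUnit_det hΛ)
      (c.compact 0)).comp_homeomorph (Homeomorph.subRight z)
    exact this.comp_left Complex.ofReal_zero
  have hs1 : Continuous fun y => (c.χ (Λ.mulVec (y - z)) 0 : ℂ) :=
    (hχ 0).comp ((continuous_mulVec Λ).comp (continuous_id.sub continuous_const))
  rw [h1, omegaReg, ← mul_sub, ← integral_sub, ← integral_const_mul]
  · refine integral_congr_ae (Eventually.of_forall fun y => ?_)
    dsimp only
    rw [cutoffDiff, Matrix.nonsing_inv_nonsing_inv _ (properLorentz.isUnit_det hΛ), hχ0 y z]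
    push_cast
    ring
  · simp only [mul_assoc]
    exact integrable_mul_of_compact hs1 hc1 ((hshift _).mul (hshift _))
  · simp only [mul_assoc]
    exact integrable_mul_of_compact (hχ z) ((c.compact z).comp_left Complex.ofReal_zero)
      ((hshift _).mul (hshift _))

lemma properLorentz.inv {Λ : Matrix (Fin (d + 1)) (Fin (d + 1)) ℝ}
    (h : Λ ∈ properLorentz d) : Λ⁻¹ ∈ properLorentz d :=
  ⟨properLorentz.inv_transpose_mul h, properLorentz.det_inv h⟩

/-- One variable is differentiated at a time, everything independent of it being treated as the
compactly supported factor. The signs `(-1)^q` and `(-1)^p` combine with `-i` into the prefactor of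
`pairReg`. -/
theorem partials_omegaReg (c : Cutoff d) (hc : c.TranslationInvariant)
    (H : FeynmanParametrix d m2) {Λ : Matrix (Fin (d + 1)) (Fin (d + 1)) ℝ}
    (hΛ : Λ ∈ properLorentz d) {ε : ℝ} (hε : 0 < ε) (z : Spacetime d)
    (μ : Fin (p + q) → Fin (d + 1)) :
    partials (firstIdx μ) (fun x₁ => partials (secondIdx μ) (fun x₂ =>
      omegaReg c H ε (Λ.mulVec x₁) (Λ.mulVec x₂) (Λ.mulVec z) - omegaReg c H ε x₁ x₂ z) z) z
      = pairReg H p q (cutoffDiff c Λ⁻¹) ε μ := by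
  have hr := H.contDiff_reg hε
  have hk := isTestOff_cutoffDiff c (properLorentz.inv hΛ)
  have hks : ContDiff ℝ ∞ fun y => -Complex.I * (cutoffDiff c Λ⁻¹ (y - z) : ℂ) :=
    contDiff_const.mul (hk.smooth.comp (contDiff_id.sub contDiff_const))
  have hkc : HasCompactSupport fun y => -Complex.I * (cutoffDiff c Λ⁻¹ (y - z) : ℂ) :=
    (hk.compact.comp_homeomorph (Homeomorph.subRight z)).mul_left
  have hr1 : ∀ x : Spacetime d, ContDiff ℝ ∞ fun y => H.reg ε (y - x) := fun x =>
    hr.comp (contDiff_id.sub contDiff_const)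
  have h2 : ∀ x₁, partials (secondIdx μ) (fun x₂ => ∫ y,
      (-Complex.I * (cutoffDiff c Λ⁻¹ (y - z) : ℂ) * H.reg ε (y - x₁)) * H.reg ε (y - x₂)) z
      = ∫ y, (((-1) ^ q * partials (secondIdx μ) (H.reg ε) (y - z))
        * (-Complex.I * (cutoffDiff c Λ⁻¹ (y - z) : ℂ))) * H.reg ε (y - x₁) := by
    intro x₁
    rw [partials_integral_mul_comp_sub (hks.mul (hr1 x₁)) hkc.mul_right hr]
    refine integral_congr_ae (Eventually.of_forall fun y => ?_)
    dsimp only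
    ring
  simp only [omegaReg_sub_omegaReg c hc H hΛ hε, h2]
  have hs2 : ContDiff ℝ ∞ fun y => (-1) ^ q * partials (secondIdx μ) (H.reg ε) (y - z) :=
    contDiff_const.mul ((contDiff_partials _ hr).comp (contDiff_id.sub contDiff_const))
  rw [partials_integral_mul_comp_sub (hs2.mul hks) hkc.mul_left hr, pairReg_apply,
    ← integral_const_mul, ← integral_sub_right_eq_self (fun y => Complex.I * (-1) ^ (1 + p + q)
      * ((cutoffDiff c Λ⁻¹ y : ℂ) * pairKernel p q (H.reg ε) y μ)) z]
  refine integral_congr_ae (Eventually.of_forall fun y => ?_)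
  dsimp only [pairKernel]
  rw [pow_add, pow_add]
  ring

end TaylorCoefficients

/-! ### The tensors `Q` and `B` as coboundaries -/

section Coboundary

variable {d p q r : ℕ} {m2 : ℝ}

/-- A common limit of group coboundaries and infinitesimal coboundaries is a coboundary. -/
lemma exists_coboundary_of_tendsto {ι : Type*} {u : Filter ι} [u.NeBot] {a : ι → CTensor d r}
    {Q : Matrix (Fin (d + 1)) (Fin (d + 1)) ℝ → CTensor d r}
    {B : Fin (d + 1) → Fin (d + 1) → CTensor d r}
    (hQ : ∀ Λ ∈ properLorentz d, Tendsto (fun i => slotAct Λ⁻¹ (a i) - a i) u (𝓝 (Q Λ)))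
    (hB : ∀ κ ρ, Tendsto (fun i => genAct (lorentzGen κ ρ) (a i)) u (𝓝 (B κ ρ))) :
    ∃ b : CTensor d r, (∀ Λ ∈ properLorentz d, Q Λ = slotAct Λ⁻¹ b - b) ∧
      ∀ κ ρ, B κ ρ = genAct (lorentzGen κ ρ) b := by
  -- Both coboundary maps are combined into one, so that the same preimage serves `Q` and `B`.
  let T : CTensor d r →ₗ[ℂ]
      (properLorentz d → CTensor d r) × (Fin (d + 1) → Fin (d + 1) → CTensor d r) :=
    (LinearMap.pi fun Λ : properLorentz d => slotAct Λ.1⁻¹ - LinearMap.id).prod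
      (LinearMap.pi fun κ => LinearMap.pi fun ρ => genActHom (lorentzGen κ ρ))
  have hlim : Tendsto (fun i => T (a i)) u (𝓝 (fun Λ => Q Λ.1, B)) := by
    refine Tendsto.prodMk_nhds (tendsto_pi_nhds.2 fun Λ => hQ Λ.1 Λ.2)
      (tendsto_pi_nhds.2 fun κ => tendsto_pi_nhds.2 fun ρ => hB κ ρ)
  have hcl : IsClosed (LinearMap.range T : Set
      ((properLorentz d → CTensor d r) × (Fin (d + 1) → Fin (d + 1) → CTensor d r))) :=
    -- The target is an infinite product, but the range of `T` is finite-dimensional, hence closed.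
    Submodule.closed_of_finiteDimensional _
  obtain ⟨b, hb⟩ := hcl.mem_of_tendsto hlim (Eventually.of_forall fun i => ⟨a i, rfl⟩)
  refine ⟨b, fun Λ hΛ => ?_, fun κ ρ => ?_⟩
  · exact (congrFun (congrArg Prod.fst hb) ⟨Λ, hΛ⟩).symm
  · exact (congrFun (congrFun (congrArg Prod.snd hb) κ) ρ).symm

lemma tendsto_tensorQ (H : FeynmanParametrix d m2) (c : Cutoff d)
    {Λ : Matrix (Fin (d + 1)) (Fin (d + 1)) ℝ} (hΛ : Λ ∈ properLorentz d)
    (μ : Fin (p + q) → Fin (d + 1)) :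
    Tendsto (fun ε => pairReg H p q (cutoffDiff c Λ) ε μ) (𝓝[>] 0) (𝓝 (tensorQ c H p q Λ μ)) :=
  tendsto_pairing H (isTestOff_cutoffDiff c hΛ) μ

lemma tendsto_tensorB (H : FeynmanParametrix d m2) (c : Cutoff d) (κ ρ : Fin (d + 1))
    (μ : Fin (p + q) → Fin (d + 1)) :
    Tendsto (fun ε => pairReg H p q (cutoffGen c κ ρ) ε μ) (𝓝[>] 0)
      (𝓝 (tensorB c H p q κ ρ μ)) :=
  tendsto_pairing H (isTestOff_cutoffGen c κ ρ) μ

/-- There is a tensor whose group coboundary is `Q` and whose infinitesimal coboundary is `B`. -/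
theorem exists_tensorQ_tensorB_eq (H : FeynmanParametrix d m2) (c : Cutoff d) (p q : ℕ) :
    ∃ b : CTensor d (p + q), (∀ Λ ∈ properLorentz d, tensorQ c H p q Λ = slotAct Λ⁻¹ b - b) ∧
      ∀ κ ρ, tensorB c H p q κ ρ = genAct (lorentzGen κ ρ) b := by
  -- The regularized tensor `a_ε` pairs the full cutoff, which does not vanish at the origin; only
  -- its coboundaries have to converge.
  refine exists_coboundary_of_tendsto (u := 𝓝[>] (0 : ℝ))
    (a := fun ε => pairReg H p q (fun y => c.χ y 0) ε) (fun Λ hΛ => ?_) fun κ ρ => ?_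
  · refine (tendsto_pi_nhds.2 fun μ => tendsto_tensorQ H c hΛ μ).congr' ?_
    filter_upwards [self_mem_nhdsWithin] with ε hε
    exact pairReg_cutoffDiff H c hΛ hε
  · refine (tendsto_pi_nhds.2 fun μ => tendsto_tensorB H c κ ρ μ).congr' ?_
    filter_upwards [self_mem_nhdsWithin] with ε hε
    exact pairReg_cutoffGen H c κ ρ hε

lemma lorentzAct_sub (Λ : Matrix (Fin (d + 1)) (Fin (d + 1)) ℝ) (S T : CTensor d r) :
    lorentzAct Λ (S - T) = lorentzAct Λ S - lorentzAct Λ T := by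
  simp only [lorentzAct_eq_slotAct, map_sub]

/-- Two tensors have the same coboundary if and only if they differ by an invariant tensor. -/
lemma coboundary_eq_iff {a b : CTensor d r} :
    (∀ Λ ∈ restrictedLorentz d, lorentzAct Λ a - a = lorentzAct Λ b - b) ↔
      b - a ∈ lorentzInvariants d r := by
  rw [mem_lorentzInvariants]
  refine forall₂_congr fun Λ _ => ?_
  rw [lorentzAct_sub, sub_eq_sub_iff_sub_eq_sub, eq_comm, ← neg_sub (lorentzAct Λ b), ← neg_sub b,
    neg_inj]
  exact eq_comm

end Coboundary

theorem mainTheorem11 (d : ℕ) (hd : 1 ≤ d) (m2 : ℝ) (H : FeynmanParametrix d m2)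
    (c : Cutoff d) (hc : c.TranslationInvariant) (p q : ℕ) :
    -- at every regulator, the integral that defines `Q(Λ⁻¹)` gives the Taylor coefficients of
    -- `Ω(Λx₁, Λx₂; Λz) - Ω(x₁, x₂; z)` at `x₁ = x₂ = z`
    (∀ Λ ∈ restrictedLorentz d, ∀ ε : ℝ, 0 < ε → ∀ (z : Spacetime d)
      (μ : Fin (p + q) → Fin (d + 1)),
      partials (firstIdx μ) (fun x₁ => partials (secondIdx μ) (fun x₂ =>
        omegaReg c H ε (Λ.mulVec x₁) (Λ.mulVec x₂) (Λ.mulVec z) - omegaReg c H ε x₁ x₂ z) z) z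
        = pairReg H p q (cutoffDiff c Λ⁻¹) ε μ) ∧
    -- the distributional integrals that define `Q(Λ)` and `B^{κρ}` exist
    (∀ Λ ∈ restrictedLorentz d, ∀ μ,
      Tendsto (fun ε => pairReg H p q (cutoffDiff c Λ) ε μ) (𝓝[>] 0)
        (𝓝 (tensorQ c H p q Λ μ))) ∧
    (∀ κ ρ μ,
      Tendsto (fun ε => pairReg H p q (cutoffGen c κ ρ) ε μ) (𝓝[>] 0)
        (𝓝 (tensorB c H p q κ ρ μ))) ∧
    -- the cocycle identity
    (∀ Λ₁ ∈ restrictedLorentz d, ∀ Λ₂ ∈ restrictedLorentz d,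
      tensorQ c H p q (Λ₁ * Λ₂) = tensorQ c H p q Λ₁ + lorentzAct Λ₁ (tensorQ c H p q Λ₂)) ∧
    -- `Q` is a coboundary
    (∃ a : CTensor d (p + q), ∀ Λ ∈ restrictedLorentz d,
      tensorQ c H p q Λ = lorentzAct Λ a - a) ∧
    -- the solution is determined modulo Lorentz-invariant tensors, and it is given modulo such
    -- tensors by the inductive formula
    (∀ a : CTensor d (p + q),
      (∀ Λ ∈ restrictedLorentz d, tensorQ c H p q Λ = lorentzAct Λ a - a) →
      (∀ a' : CTensor d (p + q),
        (∀ Λ ∈ restrictedLorentz d, tensorQ c H p q Λ = lorentzAct Λ a' - a') ↔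
          IsLorentzInvariant (a' - a)) ∧
      ∀ S : SymIdempotents (p + q),
        IsLorentzInvariant (a - S.solve (-genContract (tensorB c H p q) +
          (4 : ℂ) • metricTraceSum (p + q) a))) ∧
    -- the idempotents of the formula exist, and the tensor computed by the induction solves
    -- the equation
    (∀ r, Nonempty (SymIdempotents r)) ∧
    (∀ S : ∀ r, SymIdempotents r, ∀ Λ ∈ restrictedLorentz d,
      tensorQ c H p q Λ = lorentzAct Λ (inductiveSol S (p + q) (tensorB c H p q))
        - inductiveSol S (p + q) (tensorB c H p q)) := by
  obtain ⟨b, hQ, hB⟩ := exists_tensorQ_tensorB_eq H c p q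
  -- All claims about solutions reduce to comparison with the single tensor `b`.
  have hsol : ∀ a : CTensor d (p + q),
      (∀ Λ ∈ restrictedLorentz d, tensorQ c H p q Λ = lorentzAct Λ a - a) ↔
        b - a ∈ lorentzInvariants d (p + q) := fun a => by
    rw [← coboundary_eq_iff]
    refine forall₂_congr fun Λ hΛ => ?_
    rw [hQ Λ (restrictedLorentz_subset hΛ), ← lorentzAct_eq_slotAct, eq_comm]
  refine ⟨fun Λ hΛ ε hε z μ => partials_omegaReg c hc H (restrictedLorentz_subset hΛ) hε z μ,
    fun Λ hΛ μ => tendsto_tensorQ H c (restrictedLorentz_subset hΛ) μ,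
    fun κ ρ μ => tendsto_tensorB H c κ ρ μ, fun Λ₁ h₁ Λ₂ h₂ => ?_,
    ⟨b, fun Λ hΛ => hQ Λ (restrictedLorentz_subset hΛ)⟩, fun a ha => ⟨fun a' => ?_, fun S => ?_⟩,
    nonempty_symIdempotents, fun S => ?_⟩
  · have h₁' := restrictedLorentz_subset h₁
    have h₂' := restrictedLorentz_subset h₂
    rw [hQ _ (properLorentz.mul h₁' h₂'), hQ _ h₁', hQ _ h₂', Matrix.mul_inv_rev, slotAct_mul,
      lorentzAct_eq_slotAct, map_sub]
    abel
  · rw [hsol, ← mem_lorentzInvariants]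
    have h := (hsol a).1 ha
    constructor
    · intro h'
      simpa using Submodule.sub_mem _ h h'
    · intro h'
      simpa using Submodule.sub_mem _ h h'
  · have h := Submodule.neg_mem _ ((hsol a).1 ha)
    rw [neg_sub] at h
    exact sub_solve_mem_lorentzInvariants S hB h
  · exact (hsol _).2 (sub_inductiveSol_mem_lorentzInvariants S (p + q) _ b hB)
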